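/- **Definitions.** Write $;$ for relative product, $1'$ for the identity and $0'=\overline{1'}$ for the diversity element of a relation algebra. For $q\ge 4$ let $\mathbf E^{23}_q$ be the finite symmetric integral relation algebra with $q$ atoms $e_0=1',e_1,\dots,e_{q-1}$ such that $a;b=0'$ and $a;a=\overline a$ for distinct diversity atoms $a,b$. If $\mathbf E\subseteq\mathbf A$ are finite symmetric integral relation algebras, $\mathbf A$ is a *special extension* of $\mathbf E$ if for all diversity atoms $a,b,c$ of $\mathbf E$: (1) if not $a=b=c$ and $a;b\ge c$, then $x;y\ge c$ for all atoms $x\le a$, $y\le b$ of $\mathbf A$; (2) if $a;a\ge a$, then $x;y\cdot a\ne 0$ for all atoms $x,y\le a$ of $\mathbf A$. Diversity atoms $a,b,c$ of a symmetric integral relation algebra form a *flexible trio* if $a;a=b;b=c;c=1$, $a;b=a;c=b;c=0'$, and every atom $x\notin\{1',a,b,c\}$ has product $0'$ with at least two of $a,b,c$. The complete atomic algebra $\mathbf C_{\mathbf E}(\mathbf A)$ is the complex algebra of the following atom structure. Its atoms are $1'$ and $x^{(i)}$ for each diversity atom $x$ of $\mathbf A$ and $i\in\omega$; every atom is its own converse;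 its cycles are $[1',1',1']$, $[1',x^{(i)},x^{(i)}]$, and those $[x^{(i)},y^{(j)},z^{(k)}]$ such that $x;y\ge z$ and, in case $x,y,z$ lie below the same atom of $\mathbf E$, $(i\le j=k)\lor(j\le k=i)\lor(k\le i=j)$. (In a symmetric algebra $[u,v,w]$ is the set of all permutations of $\langle u,v,w\rangle$, and $\langle u,v,w\rangle$ belongs to a cycle iff $u;v\ge w$.) For an atomic relation algebra $\mathbf C$, $B_n(\mathbf C)$ is the set of *basic matrices*: $n\times n$ matrices $\mu$ of atoms of $\mathbf C$ with $\mu_{ii}\le 1'$, $\breve\mu_{ij}=\mu_{ji}$, and $\mu_{ij}\le\mu_{il};\mu_{lj}$. A set $M\subseteq B_n(\mathbf C)$ is an *$n$-dimensional cylindric basis* for $\mathbf C$ ($n\geq3$) if (C$_0$) whenever $a,b,c$ are atoms with $a\le b;c$ there is $\mu\in M$ with $\mu_{01}=a$, $\mu_{02}=b$, $\mu_{21}=c$; (C$_1$) if $\mu,\mu'\in M$, $i\ne j$, and $\mu,\mu'$ agree at all entries having neither index in $\{i,j\}$, then there is $\mu''\in M$ that agrees with $\mu$ at all entries not involving $i$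 and with $\mu'$ at all entries not involving $j$; (C$_2$) $M$ is closed under replacing $\mu$ by $\mu\circ[i/j]$, where $[i/j]$ sends $i$ to $j$ and fixes all other indices. $\mathbf{Ca}(M)$ is the algebra of all subsets of $M$ with $c_iX=\{\mu\in M:\mu$ agrees with some member of $X$ at all entries not involving $i\}$ and $d_{ij}=\{\mu\in M:\mu_{ij}\le 1'\}$. $\mathsf{CA}_n$ is the class of $n$-dimensional cylindric algebras; $\mathbf S\mathsf{Nr}_m\mathsf{CA}_n$ ($m\le n$) is the class of algebras isomorphic to subalgebras of neat $m$-dimensional reducts of members of $\mathsf{CA}_n$. For $n\ge3$ the relation algebraic reduct $\mathbf{Ra}(\mathbf D)$ of an $n$-dimensional cylindric algebra $\mathbf D$ has as elements those $x\in\mathbf D$ with $c_kx=x$ for $2\le k<n$, the Boolean operations of $\mathbf D$, identity $d_{01}$, $x;y=c_2(s^1_2x\cdot s^0_2y)$ and $\breve x=s^2_0s^0_1s^1_2x$, where $s^i_jx=c_i(d_{ij}\cdot x)$. $\mathsf{Ra}\,\mathsf{CA}_n$ is the class of algebras isomorphic to $\mathbf{Ra}(\mathbf S)$ for some $\mathbf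 S\in\mathbf S\mathsf{Nr}_3\mathsf{CA}_n$. **Theorem 3.** Let $4\le r\in\omega$ and $\mathbf A=\mathbf E^{23}_{r+3}$. There is a subalgebra $\mathbf E$ of $\mathbf A$ whose atoms are exactly the $r$ distinct elements $$a_0=e_0=1',\quad a_1=e_1+e_2,\quad a_2=e_3+e_4,\quad a_3=e_5+e_6,\quad a_i=e_{i+3}\ (4\le i\le r-1).$$ For this $\mathbf E$: $\mathbf A$ is a special extension of $\mathbf E$; $a_1,a_2,a_3$ is a flexible trio of $\mathbf E$; $\mathbf C_{\mathbf E}(\mathbf A)$ is a complete atomic relation algebra; and the subalgebra of $\mathbf C_{\mathbf E}(\mathbf A)$ generated by its atoms is an atomic, atom-generated, symmetric, integral, representable relation algebra all of whose finitely generated subalgebras are finite. Moreover, whenever $3\le n\le r+3$: 1. $B_n(\mathbf C_{\mathbf E}(\mathbf A))$ is an $n$-dimensional cylindric basis for $\mathbf C_{\mathbf E}(\mathbf A)$; 2. $\mathbf{Ca}(B_n(\mathbf C_{\mathbf E}(\mathbf A)))$ is a complete atomic $n$-dimensional cylindric algebra; 3. $\mathbf C_{\mathbf E}(\mathbf A)$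 is isomorphic to the relation algebraic reduct of $\mathbf{Ca}(B_n(\mathbf C_{\mathbf E}(\mathbf A)))$, and $\mathbf C_{\mathbf E}(\mathbf A)\in\mathsf{Ra}\,\mathsf{CA}_n$; 4. $\mathbf{Ca}(B_n(\mathbf C_{\mathbf E}(\mathbf A)))\notin\mathbf S\mathsf{Nr}_n\mathsf{CA}_{r+4}$. If $r=4$, so that $\mathbf A=\mathbf E^{23}_7$, then $\mathbf C_{\mathbf E}(\mathbf A)\in\mathsf{Ra}\,\mathsf{CA}_7$ but $\mathbf C_{\mathbf E}(\mathbf A)\notin\mathsf{Ra}\,\mathsf{CA}_8$. -/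

import Mathlib

universe u v w

namespace RelCyl

/-! ## Relation algebras -/

/-- The non-Boolean operations of an algebra of relational type: relative multiplication `x ; y`,
converse, and the identity element `1'`. The diversity element `0'` is `identᶜ`. -/
class RelSig (α : Type u) [BooleanAlgebra α] where
  comp : α → α → α
  conv : α → α
  ident : α

open RelSig

/-- Tarski's axioms for relation algebras. -/
structure IsRelationAlgebra (α : Type u) [BooleanAlgebra α] [RelSig α] : Prop where
  comp_assoc : ∀ x y z : α, comp (comp x y) z = comp x (comp y z)
  sup_comp : ∀ x y z : α, comp (x ⊔ y) z = comp x z ⊔ comp y z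
  comp_ident : ∀ x : α, comp x ident = x
  conv_conv : ∀ x : α, conv (conv x) = x
  conv_sup : ∀ x y : α, conv (x ⊔ y) = conv x ⊔ conv y
  conv_comp : ∀ x y : α, conv (comp x y) = comp (conv y) (conv x)
  conv_comp_compl_le : ∀ x y : α, comp (conv x) (comp x y)ᶜ ≤ yᶜ

def IsSymmetric (α : Type u) [BooleanAlgebra α] [RelSig α] : Prop :=
  ∀ x : α, conv x = x

def IsIntegralRA (α : Type u) [BooleanAlgebra α] [RelSig α] : Prop :=
  Nontrivial α ∧ ∀ x y : α, comp x y = ⊥ → x = ⊥ ∨ y = ⊥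

/-- Completeness of a Boolean algebra: every subset has a join. -/
def HasAllJoins (α : Type u) [BooleanAlgebra α] : Prop :=
  ∀ s : Set α, ∃ a, IsLUB s a

/-- `h` represents `α` as an algebra of binary relations on `U`, whose unit is `h ⊤` (the
conditions force `h ⊤` to be an equivalence relation on `U`). -/
structure IsRepresentation {α : Type u} [BooleanAlgebra α] [RelSig α] {U : Type v}
    (h : α → U → U → Prop) : Prop where
  injective : Function.Injective h
  map_sup : ∀ x y p q, h (x ⊔ y) p q ↔ h x p q ∨ h y p q
  map_compl : ∀ x p q, h xᶜ p q ↔ h ⊤ p q ∧ ¬ h x p q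
  map_comp : ∀ x y p q, h (comp x y) p q ↔ ∃ t, h x p t ∧ h y t q
  map_conv : ∀ x p q, h (conv x) p q ↔ h x q p
  map_ident : ∀ p q, h ident p q ↔ p = q

/-- `α` is isomorphic to an algebra of binary relations. -/
def IsRepresentable (α : Type u) [BooleanAlgebra α] [RelSig α] : Prop :=
  ∃ (U : Type u) (h : α → U → U → Prop), IsRepresentation h

/-! ## Subalgebras -/

structure RelSubalgebra (α : Type u) [BooleanAlgebra α] [RelSig α]
    extends BooleanSubalgebra α where
  comp_mem' : ∀ {x y : α}, x ∈ carrier → y ∈ carrier → comp x y ∈ carrier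
  conv_mem' : ∀ {x : α}, x ∈ carrier → conv x ∈ carrier
  ident_mem' : ident ∈ carrier

namespace RelSubalgebra

variable {α : Type u} [BooleanAlgebra α] [RelSig α]

instance : SetLike (RelSubalgebra α) α where
  coe S := S.carrier
  coe_injective S T h := by
    obtain ⟨⟨⟨_, _⟩, _⟩, _⟩ := S
    congr

instance (S : RelSubalgebra α) : BooleanAlgebra S :=
  inferInstanceAs (BooleanAlgebra S.toBooleanSubalgebra)

instance (S : RelSubalgebra α) : RelSig S where
  comp x y := ⟨comp x.1 y.1, S.comp_mem' x.2 y.2⟩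
  conv x := ⟨conv x.1, S.conv_mem' x.2⟩
  ident := ⟨ident, S.ident_mem'⟩

/-- The subalgebra generated by a set of elements. -/
def generate (s : Set α) : RelSubalgebra α where
  carrier := {x | ∀ S : RelSubalgebra α, s ⊆ S → x ∈ S}
  supClosed' _ hx _ hy S hS := S.supClosed' (hx S hS) (hy S hS)
  infClosed' _ hx _ hy S hS := S.infClosed' (hx S hS) (hy S hS)
  compl_mem' hx S hS := S.compl_mem' (hx S hS)
  bot_mem' S _ := S.bot_mem'
  comp_mem' hx hy S hS := S.comp_mem' (hx S hS) (hy S hS)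
  conv_mem' hx S hS := S.conv_mem' (hx S hS)
  ident_mem' S _ := S.ident_mem'

/-- The element `a` of the ambient algebra is an atom of the subalgebra `S`. -/
def IsAtomOf (S : RelSubalgebra α) (a : α) : Prop :=
  ∃ h : a ∈ S, IsAtom (⟨a, h⟩ : S)

end RelSubalgebra

/-- `α` is generated by its atoms. -/
def IsAtomGenerated (α : Type u) [BooleanAlgebra α] [RelSig α] : Prop :=
  ∀ x : α, x ∈ RelSubalgebra.generate {a : α | IsAtom a}

/-- Every finitely generated subalgebra of `α` is finite. -/
def FinGenSubalgebrasFinite (α : Type u) [BooleanAlgebra α] [RelSig α] : Prop :=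
  ∀ s : Set α, s.Finite → (RelSubalgebra.generate s : Set α).Finite

/-! ## Special extensions and flexible trios -/

structure IsFiniteSymmetricIntegralRA (α : Type u) [BooleanAlgebra α] [RelSig α] : Prop where
  finite : Finite α
  relationAlgebra : IsRelationAlgebra α
  symmetric : IsSymmetric α
  integral : IsIntegralRA α

/-- `A` is a special extension of its subalgebra `E`. -/
structure IsSpecialExtension {A : Type u} [BooleanAlgebra A] [RelSig A]
    (E : RelSubalgebra A) : Prop where
  ambient : IsFiniteSymmetricIntegralRA A
  sub : IsFiniteSymmetricIntegralRA E
  split : ∀ a b c : A, E.IsAtomOf a → E.IsAtomOf b → E.IsAtomOf c →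
    a ≤ identᶜ → b ≤ identᶜ → c ≤ identᶜ →
    ¬ (a = b ∧ b = c) → c ≤ comp a b →
    ∀ x y : A, IsAtom x → IsAtom y → x ≤ a → y ≤ b → c ≤ comp x y
  thin : ∀ a : A, E.IsAtomOf a → a ≤ identᶜ → a ≤ comp a a →
    ∀ x y : A, IsAtom x → IsAtom y → x ≤ a → y ≤ a → comp x y ⊓ a ≠ ⊥

structure IsFlexibleTrio {α : Type u} [BooleanAlgebra α] [RelSig α] (a b c : α) : Prop where
  atom_a : IsAtom a
  atom_b : IsAtom b
  atom_c : IsAtom c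
  diversity_a : a ≤ identᶜ
  diversity_b : b ≤ identᶜ
  diversity_c : c ≤ identᶜ
  aa : comp a a = ⊤
  bb : comp b b = ⊤
  cc : comp c c = ⊤
  ab : comp a b = identᶜ
  ac : comp a c = identᶜ
  bc : comp b c = identᶜ
  other : ∀ x : α, IsAtom x → x ≠ ident → x ≠ a → x ≠ b → x ≠ c →
    (comp x a = identᶜ ∧ comp x b = identᶜ) ∨
    (comp x a = identᶜ ∧ comp x c = identᶜ) ∨
    (comp x b = identᶜ ∧ comp x c = identᶜ)

/-! ## Complex algebras of atom structures -/

/-- A set `X` with a ternary relation, a unary operation and a distinguished subset. -/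
structure RelAtomStructure (X : Type u) where
  cyc : X → X → X → Prop
  conv : X → X
  ident : Set X

/-- The complex algebra of an atom structure: all subsets of `X`. -/
def Cm {X : Type u} (_ : RelAtomStructure X) : Type u := Set X

instance {X : Type u} (S : RelAtomStructure X) : BooleanAlgebra (Cm S) :=
  inferInstanceAs (BooleanAlgebra (Set X))

instance {X : Type u} (S : RelAtomStructure X) : RelSig (Cm S) where
  comp (P Q : Set X) := ({z | ∃ x ∈ P, ∃ y ∈ Q, S.cyc x y z} : Set X)
  conv (P : Set X) := S.conv '' P
  ident := S.ident

/-! ## The no 1-cycles algebras -/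

/-- The atom structure on `e₀ = 1', e₁, …, e_{q-1}`: the identity cycles together with all the
diversity cycles except the 1-cycles. -/
def e23Structure (q : ℕ) : RelAtomStructure (Fin q) where
  cyc x y z :=
    (x.val = 0 ∧ y = z) ∨ (y.val = 0 ∧ x = z) ∨ (z.val = 0 ∧ x = y) ∨
    (x.val ≠ 0 ∧ y.val ≠ 0 ∧ z.val ≠ 0 ∧ ¬ (x = y ∧ y = z))
  conv x := x
  ident := {x | x.val = 0}

/-- The finite symmetric integral algebra with atoms `e₀ = 1', e₁, …, e_{q-1}` in which
`a ; b = 0'` and `a ; a = aᶜ` for distinct diversity atoms `a`, `b`. -/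
abbrev E23 (q : ℕ) : Type := Cm (e23Structure q)

/-- The atom `e_k` of `E23 q`, for `k < q`. -/
def eAtom (q k : ℕ) : E23 q := ({x | x.val = k} : Set (Fin q))

/-- The elements `a₀ = e₀`, `a₁ = e₁ + e₂`, `a₂ = e₃ + e₄`, `a₃ = e₅ + e₆` and
`a_i = e_{i+3}` for `4 ≤ i`. -/
def blockAtom (q : ℕ) : ℕ → E23 q
  | 0 => eAtom q 0
  | 1 => eAtom q 1 ⊔ eAtom q 2
  | 2 => eAtom q 3 ⊔ eAtom q 4
  | 3 => eAtom q 5 ⊔ eAtom q 6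
  | i => eAtom q (i + 3)

/-! ## The infinite atom structure obtained from a finite algebra and a subalgebra -/

section Split

variable {A : Type u} [BooleanAlgebra A] [RelSig A]

variable (A) in
/-- The atoms of `C_E(A)`: `none` is `1'`, and `some (x, i)` is `x^(i)`, for a diversity atom
`x` of `A` and `i ∈ ω`. -/
abbrev SplitAtom : Type u := Option ({x : A // IsAtom x ∧ x ≤ identᶜ} × ℕ)

/-- The thinning condition `T(i,j,k)`. -/
def Thin (i j k : ℕ) : Prop := (i ≤ j ∧ j = k) ∨ (j ≤ k ∧ k = i) ∨ (k ≤ i ∧ i = j)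

/-- The elements `x`, `y`, `z` lie below a common atom of `E`, that is, if they are atoms of `A`,
they have the same cover in `E`. -/
def SameCover (E : RelSubalgebra A) (x y z : A) : Prop :=
  ∃ a, E.IsAtomOf a ∧ x ≤ a ∧ y ≤ a ∧ z ≤ a

/-- The triples of atoms in the cycles `[1',1',1']`, `[1',x^(i),x^(i)]`, and
`[x^(i),y^(j),z^(k)]` where `x ; y ≥ z` and, if `x`, `y`, `z` have the same cover, `T(i,j,k)`. -/
def splitCyc (E : RelSubalgebra A) : SplitAtom A → SplitAtom A → SplitAtom A → Prop
  | none, s, t => s = t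
  | some s, none, t => some s = t
  | some s, some t, none => s = t
  | some (x, i), some (y, j), some (z, k) =>
      z.1 ≤ comp x.1 y.1 ∧ (SameCover E x.1 y.1 z.1 → Thin i j k)

def splitStructure (E : RelSubalgebra A) : RelAtomStructure (SplitAtom A) where
  cyc := splitCyc E
  conv s := s
  ident := {none}

/-- The complete atomic algebra `C_E(A)`. -/
abbrev SplitAlg (E : RelSubalgebra A) : Type u := Cm (splitStructure E)

end Split

/-- The subalgebra of `α` generated by the atoms of `α`. -/
abbrev atomSubalgebra (α : Type u) [BooleanAlgebra α] [RelSig α] : RelSubalgebra α :=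
  RelSubalgebra.generate {a : α | IsAtom a}

/-! ## Cylindric algebras -/

/-- Cylindrifications `c_i` and diagonal elements `d_ij`, for `i, j < n`. -/
class CylSig (n : ℕ) (α : Type u) [BooleanAlgebra α] where
  cyl : Fin n → α → α
  diag : Fin n → Fin n → α

open CylSig

/-- `α` is an `n`-dimensional cylindric algebra. -/
structure IsCylindricAlgebra (n : ℕ) (α : Type u) [BooleanAlgebra α] [CylSig n α] : Prop where
  cyl_bot : ∀ i : Fin n, cyl i (⊥ : α) = ⊥
  le_cyl : ∀ (i : Fin n) (x : α), x ≤ cyl i x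
  cyl_inf_cyl : ∀ (i : Fin n) (x y : α), cyl i (x ⊓ cyl i y) = cyl i x ⊓ cyl i y
  cyl_comm : ∀ (i j : Fin n) (x : α), cyl i (cyl j x) = cyl j (cyl i x)
  diag_self : ∀ i : Fin n, (diag i i : α) = ⊤
  diag_trans : ∀ i j k : Fin n, k ≠ i → k ≠ j →
    (diag i j : α) = cyl k (diag i k ⊓ diag k j)
  cyl_diag : ∀ i j : Fin n, i ≠ j → ∀ x : α,
    cyl i (diag i j ⊓ x) ⊓ cyl i (diag i j ⊓ xᶜ) = ⊥

/-- `f` is an isomorphism of the `m`-dimensional algebra `α` onto a subalgebra of the neat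
`m`-dimensional reduct of the `n`-dimensional algebra `D`; the elements of this reduct are
the `x` in `D` such that `c_k x = x` whenever `m ≤ k < n`. -/
structure IsNeatEmbedding {m n : ℕ} (hmn : m ≤ n) {α : Type u} [BooleanAlgebra α] [CylSig m α]
    {D : Type v} [BooleanAlgebra D] [CylSig n D] (f : α → D) : Prop where
  injective : Function.Injective f
  map_sup : ∀ x y, f (x ⊔ y) = f x ⊔ f y
  map_compl : ∀ x, f xᶜ = (f x)ᶜ
  map_cyl : ∀ (i : Fin m) (x : α), f (cyl i x) = cyl (Fin.castLE hmn i) (f x)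
  map_diag : ∀ i j : Fin m, f (diag i j) = diag (Fin.castLE hmn i) (Fin.castLE hmn j)
  mem_neat : ∀ (x : α) (k : Fin n), m ≤ k.val → cyl k (f x) = f x

/-- `α` belongs to `S Nr_m CA_n`, the class of (algebras isomorphic to) subalgebras of neat
`m`-dimensional reducts of `n`-dimensional cylindric algebras. -/
def InSNrCA {m n : ℕ} (hmn : m ≤ n) (α : Type v) [BooleanAlgebra α] [CylSig m α] : Prop :=
  ∃ (D : Type u) (_ : BooleanAlgebra D) (_ : CylSig n D),
    IsCylindricAlgebra n D ∧ ∃ f : α → D, IsNeatEmbedding hmn f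

section Ra

variable {n : ℕ} {D : Type u} [BooleanAlgebra D] [CylSig n D]

/-- The substitution `s^i_j`. -/
def subst (i j : Fin n) (x : D) : D := if i = j then x else cyl i (diag i j ⊓ x)

/-- Relative multiplication in the relation algebraic reduct:
`x ; y = c₂(s¹₂ x · s⁰₂ y)`. -/
def raComp (hn : 3 ≤ n) (x y : D) : D :=
  cyl (⟨2, by omega⟩ : Fin n)
    (subst (⟨1, by omega⟩ : Fin n) ⟨2, by omega⟩ x ⊓ subst (⟨0, by omega⟩ : Fin n) ⟨2, by omega⟩ y)

/-- Converse in the relation algebraic reduct: `₂s(0,1) x = s²₀ s⁰₁ s¹₂ x`. -/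
def raConv (hn : 3 ≤ n) (x : D) : D :=
  subst (⟨2, by omega⟩ : Fin n) ⟨0, by omega⟩
    (subst (⟨0, by omega⟩ : Fin n) ⟨1, by omega⟩ (subst (⟨1, by omega⟩ : Fin n) ⟨2, by omega⟩ x))

/-- `f` is an isomorphism of `C` onto the relation algebraic reduct of `D`, whose elements are the
2-dimensional elements of `D` and whose identity element is `d₀₁`. -/
structure IsIsoOntoRa (hn : 3 ≤ n) {C : Type v} [BooleanAlgebra C] [RelSig C] (f : C → D) :
    Prop where
  injective : Function.Injective f
  range_eq : Set.range f = {x : D | ∀ k : Fin n, 2 ≤ k.val → cyl k x = x}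
  map_sup : ∀ x y, f (x ⊔ y) = f x ⊔ f y
  map_compl : ∀ x, f xᶜ = (f x)ᶜ
  map_comp : ∀ x y, f (comp x y) = raComp hn (f x) (f y)
  map_conv : ∀ x, f (conv x) = raConv hn (f x)
  map_ident : f ident = diag (⟨0, by omega⟩ : Fin n) ⟨1, by omega⟩

end Ra

/-- `C` belongs to `Ra CA_n`, the class of (algebras isomorphic to) relation algebraic reducts of
subalgebras of neat 3-dimensional reducts of `n`-dimensional cylindric algebras. -/
def InRaCA {n : ℕ} (hn : 3 ≤ n) (C : Type v) [BooleanAlgebra C] [RelSig C] : Prop :=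
  ∃ (S : Type u) (_ : BooleanAlgebra S) (_ : CylSig 3 S),
    InSNrCA.{u, u} hn S ∧ ∃ f : C → S, IsIsoOntoRa (le_refl 3) f

/-! ## Basic matrices and cylindric bases -/

section Matrices

variable (n : ℕ) (A : Type u) [BooleanAlgebra A] [RelSig A]

/-- `n`-by-`n` matrices of atoms of `A`. -/
abbrev AtomMatrix : Type u := Fin n → Fin n → {a : A // IsAtom a}

/-- The set `B_n(A)` of basic matrices. -/
def basicMatrices : Set (AtomMatrix n A) :=
  {μ | (∀ i, (μ i i).1 ≤ ident) ∧
       (∀ i j, conv (μ i j).1 = (μ j i).1) ∧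
       (∀ i j l, (μ i j).1 ≤ comp (μ i l).1 (μ l j).1)}

variable {n A}

/-- `μ` and `μ'` agree up to `i`. -/
def AgreeUpTo (i : Fin n) (μ μ' : AtomMatrix n A) : Prop :=
  ∀ l m, l ≠ i → m ≠ i → μ l m = μ' l m

/-- `μ` and `μ'` agree up to `i, j`. -/
def AgreeUpTo₂ (i j : Fin n) (μ μ' : AtomMatrix n A) : Prop :=
  ∀ l m, l ≠ i → l ≠ j → m ≠ i → m ≠ j → μ l m = μ' l m

/-- The map `[i/j]` sends `i` to `j` and fixes everything else. -/
def replaceIdx (i j : Fin n) (m : Fin n) : Fin n := if m = i then j else m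

/-- `M` is an `n`-dimensional cylindric basis for `A`. -/
structure IsCylindricBasis (hn : 3 ≤ n) (M : Set (AtomMatrix n A)) : Prop where
  subset_basic : M ⊆ basicMatrices n A
  exists_triangle : ∀ a b c : {a : A // IsAtom a}, a.1 ≤ comp b.1 c.1 →
    ∃ μ ∈ M, μ ⟨0, by omega⟩ ⟨1, by omega⟩ = a ∧ μ ⟨0, by omega⟩ ⟨2, by omega⟩ = b ∧
      μ ⟨2, by omega⟩ ⟨1, by omega⟩ = c
  amalgamation : ∀ μ ∈ M, ∀ μ' ∈ M, ∀ i j : Fin n, i ≠ j → AgreeUpTo₂ i j μ μ' →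
    ∃ μ'' ∈ M, AgreeUpTo i μ'' μ ∧ AgreeUpTo j μ'' μ'
  replace_mem : ∀ μ ∈ M, ∀ i j : Fin n, (fun l m => μ (replaceIdx i j l) (replaceIdx i j m)) ∈ M

/-- The complex algebra `Ca(M)` of the structure `⟨M, T_i, E_ij⟩`: all subsets of `M`. -/
def Ca (M : Set (AtomMatrix n A)) : Type u := Set M

instance (M : Set (AtomMatrix n A)) : BooleanAlgebra (Ca M) :=
  inferInstanceAs (BooleanAlgebra (Set M))

instance (M : Set (AtomMatrix n A)) : CylSig n (Ca M) where
  cyl i (X : Set M) := ({μ | ∃ μ' ∈ X, AgreeUpTo i μ'.1 μ.1} : Set M)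
  diag i j := ({μ | (μ.1 i j).1 ≤ ident} : Set M)

end Matrices

end RelCyl

open RelCyl

namespace RelCyl

open RelSig CylSig

/-! ## Complex algebras -/

section Complex

variable {X : Type u} {S : RelAtomStructure X}

instance : Membership X (Cm S) := ⟨fun P x => (show Set X from P) x⟩

/-- A set of atoms as an element of the complex algebra. -/
def Cm.mk (S : RelAtomStructure X) (P : Set X) : Cm S := P

namespace Cm

theorem ext {P Q : Cm S} (h : ∀ x, x ∈ P ↔ x ∈ Q) : P = Q :=
  Set.ext (α := X) h

theorem le_iff {P Q : Cm S} : P ≤ Q ↔ ∀ x, x ∈ P → x ∈ Q := Iff.rfl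
@[simp] theorem mem_sup {P Q : Cm S} {x : X} : x ∈ P ⊔ Q ↔ x ∈ P ∨ x ∈ Q := Iff.rfl
@[simp] theorem mem_compl {P : Cm S} {x : X} : x ∈ Pᶜ ↔ x ∉ P := Iff.rfl
@[simp] theorem mem_top {x : X} : x ∈ (⊤ : Cm S) := trivial
@[simp] theorem mem_bot {x : X} : ¬ x ∈ (⊥ : Cm S) := fun h => h
@[simp] theorem mem_comp {P Q : Cm S} {z : X} :
    z ∈ comp P Q ↔ ∃ x ∈ P, ∃ y ∈ Q, S.cyc x y z := Iff.rfl
theorem mem_conv {P : Cm S} {z : X} : z ∈ RelSig.conv P ↔ ∃ x ∈ P, S.conv x = z := Iff.rfl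
theorem mem_ident {z : X} : z ∈ (ident : Cm S) ↔ z ∈ S.ident := Iff.rfl

theorem ne_bot_iff {P : Cm S} : P ≠ ⊥ ↔ ∃ x, x ∈ P := by
  constructor
  · intro h
    by_contra hc
    push Not at hc
    exact h (ext fun x => ⟨fun hx => (hc x hx).elim, fun hx => (mem_bot hx).elim⟩)
  · rintro ⟨x, hx⟩ rfl
    exact mem_bot hx

/-- The singleton of an atom. -/
def sing (S : RelAtomStructure X) (x : X) : Cm S := Cm.mk S {x}

@[simp] theorem mem_sing {x y : X} : y ∈ sing S x ↔ y = x := Iff.rfl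

theorem sing_le {x : X} {P : Cm S} : sing S x ≤ P ↔ x ∈ P :=
  ⟨fun h => h rfl, fun h y hy => by rw [mem_sing.1 hy]; exact h⟩

theorem isAtom_iff {P : Cm S} : IsAtom P ↔ ∃ x, P = sing S x :=
  Set.isAtom_iff (s := P)

theorem isAtom_sing (x : X) : IsAtom (sing S x) := isAtom_iff.2 ⟨x, rfl⟩

theorem sing_injective : Function.Injective (sing S) := fun _ _ h => by
  have : (_ : X) ∈ sing S _ := sing_le.1 h.le
  exact this

theorem isAtomic : IsAtomic (Cm S) := inferInstanceAs (IsAtomic (Set X))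

theorem hasAllJoins : HasAllJoins (Cm S) := fun s =>
  ⟨(⋃₀ (show Set (Set X) from s) : Set X), isLUB_sSup (α := Set X) s⟩

/-- Atoms of the complex algebra are the singletons. -/
noncomputable def atomEquiv (S : RelAtomStructure X) : X ≃ {a : Cm S // IsAtom a} :=
  Equiv.ofBijective (fun x => ⟨sing S x, isAtom_sing x⟩)
    ⟨fun _ _ h => sing_injective (Subtype.ext_iff.1 h), fun ⟨_, ha⟩ => by
      obtain ⟨x, rfl⟩ := isAtom_iff.1 ha
      exact ⟨x, rfl⟩⟩

/-- The member of an atom of the complex algebra. -/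
noncomputable def pt (a : {a : Cm S // IsAtom a}) : X := (atomEquiv S).symm a

@[simp] theorem pt_atomEquiv (x : X) : pt (atomEquiv S x) = x := (atomEquiv S).symm_apply_apply x

theorem coe_eq_sing (a : {a : Cm S // IsAtom a}) : a.1 = sing S (pt a) := by
  conv_lhs => rw [← (atomEquiv S).apply_symm_apply a]
  rfl

theorem pt_injective : Function.Injective (pt (S := S)) := (atomEquiv S).symm.injective

theorem sing_le_comp {x y z : X} : sing S z ≤ comp (sing S x) (sing S y) ↔ S.cyc x y z := by
  rw [sing_le, mem_comp]
  constructor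
  · rintro ⟨a, rfl, b, rfl, h⟩; exact h
  · intro h; exact ⟨x, rfl, y, rfl, h⟩

end Cm

/-- A symmetric atom structure with a single identity atom `e`. -/
structure IsSymCyc (S : RelAtomStructure X) (e : X) : Prop where
  conv_eq : ∀ x, S.conv x = x
  ident_eq : S.ident = {e}
  ident_cyc : ∀ x y, S.cyc e x y ↔ x = y
  swap : ∀ {x y z}, S.cyc x y z → S.cyc y x z
  rot : ∀ {x y z}, S.cyc x y z → S.cyc x z y

/-- Any `k` pairs of diversity atoms have an atom completing each of them to a cycle. -/
def HasExt (S : RelAtomStructure X) (e : X) (k : ℕ) : Prop :=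
  ∀ L : Finset (X × X), L.card ≤ k → (∀ p ∈ L, p.1 ≠ e ∧ p.2 ≠ e) →
    ∃ w, ∀ p ∈ L, S.cyc p.1 p.2 w

theorem HasExt.mono {e : X} {k l : ℕ} (h : HasExt S e l) (hkl : k ≤ l) : HasExt S e k :=
  fun L hL => h L (hL.trans hkl)

namespace IsSymCyc

variable {e : X}

theorem cyc_ident (h : IsSymCyc S e) (x y : X) : S.cyc x e y ↔ x = y :=
  ⟨fun hc => (h.ident_cyc x y).1 (h.swap hc), fun hc => h.swap ((h.ident_cyc x y).2 hc)⟩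

theorem cyc_to_ident (h : IsSymCyc S e) (x y : X) : S.cyc x y e ↔ x = y :=
  ⟨fun hc => (h.cyc_ident x y).1 (h.rot hc), fun hc => h.rot ((h.cyc_ident x y).2 hc)⟩

theorem conv_id (h : IsSymCyc S e) : IsSymmetric (Cm S) := fun P => Cm.ext fun z => by
  rw [Cm.mem_conv]
  simp [h.conv_eq]

theorem mem_ident (h : IsSymCyc S e) {x : X} : x ∈ (ident : Cm S) ↔ x = e := by
  rw [Cm.mem_ident, h.ident_eq]; rfl

theorem comp_comm (h : IsSymCyc S e) (P Q : Cm S) : comp P Q = comp Q P := Cm.ext fun z => by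
  simp only [Cm.mem_comp]
  constructor <;> rintro ⟨x, hx, y, hy, hc⟩ <;> exact ⟨y, hy, x, hx, h.swap hc⟩

theorem exists_common (h : IsSymCyc S e) (hk : HasExt S e 2) {x y z w m : X}
    (h1 : S.cyc x y m) (h2 : S.cyc m z w) : ∃ m', S.cyc y z m' ∧ S.cyc x m' w := by
  classical
  by_cases hx : x = e
  · subst hx
    obtain rfl := (h.ident_cyc _ _).1 h1
    exact ⟨w, h2, (h.ident_cyc _ _).2 rfl⟩
  by_cases hy : y = e
  · subst hy
    obtain rfl := (h.cyc_ident _ _).1 h1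
    exact ⟨z, (h.ident_cyc _ _).2 rfl, h2⟩
  by_cases hz : z = e
  · subst hz
    obtain rfl := (h.cyc_ident _ _).1 h2
    exact ⟨y, (h.cyc_ident _ _).2 rfl, h1⟩
  by_cases hw : w = e
  · subst hw
    obtain rfl := (h.cyc_to_ident _ _).1 h2
    exact ⟨x, h.rot (h.swap h1), (h.cyc_to_ident _ _).2 rfl⟩
  obtain ⟨m', hm⟩ := hk {(y, z), (x, w)} Finset.card_le_two (by
    intro p hp
    rcases Finset.mem_insert.1 hp with rfl | hp
    · exact ⟨hy, hz⟩
    · obtain rfl := Finset.mem_singleton.1 hp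
      exact ⟨hx, hw⟩)
  exact ⟨m', hm (y, z) (by simp), h.rot (hm (x, w) (by simp))⟩

theorem comp_assoc_le (h : IsSymCyc S e) (hk : HasExt S e 2) (P Q R : Cm S) :
    comp (comp P Q) R ≤ comp P (comp Q R) := by
  rw [Cm.le_iff]
  rintro w ⟨m, ⟨x, hx, y, hy, h1⟩, z, hz, h2⟩
  obtain ⟨m', h3, h4⟩ := h.exists_common hk h1 h2
  exact ⟨x, hx, m', ⟨y, hy, z, hz, h3⟩, h4⟩

theorem isRelationAlgebra (h : IsSymCyc S e) (hk : HasExt S e 2) : IsRelationAlgebra (Cm S) where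
  comp_assoc P Q R := by
    refine le_antisymm (h.comp_assoc_le hk P Q R) ?_
    rw [h.comp_comm P, h.comp_comm Q, h.comp_comm (comp P Q), h.comp_comm P]
    exact h.comp_assoc_le hk R Q P
  sup_comp P Q R := Cm.ext fun z => by
    simp only [Cm.mem_comp, Cm.mem_sup]
    constructor
    · rintro ⟨x, hx | hx, r⟩
      exacts [.inl ⟨x, hx, r⟩, .inr ⟨x, hx, r⟩]
    · rintro (⟨x, hx, r⟩ | ⟨x, hx, r⟩)
      exacts [⟨x, .inl hx, r⟩, ⟨x, .inr hx, r⟩]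
  comp_ident P := Cm.ext fun z => by
    simp only [Cm.mem_comp, h.mem_ident]
    constructor
    · rintro ⟨x, hx, y, rfl, hc⟩
      exact (h.cyc_ident _ _).1 hc ▸ hx
    · intro hz
      exact ⟨z, hz, e, rfl, (h.cyc_ident _ _).2 rfl⟩
  conv_conv P := by rw [h.conv_id, h.conv_id]
  conv_sup P Q := by simp only [h.conv_id _]
  conv_comp P Q := by simp only [h.conv_id _]; exact h.comp_comm P Q
  conv_comp_compl_le P Q := by
    rw [h.conv_id, Cm.le_iff]
    rintro z ⟨x, hx, y, hy, hc⟩ hz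
    exact hy ⟨x, hx, z, hz, h.rot hc⟩

theorem isIntegral (h : IsSymCyc S e) (hk : HasExt S e 1) : IsIntegralRA (Cm S) := by
  refine ⟨⟨⊥, ⊤, fun hbt => ?_⟩, fun P Q hPQ => ?_⟩
  · have : e ∈ (⊥ : Cm S) := by rw [hbt]; exact Cm.mem_top
    exact Cm.mem_bot this
  · by_contra hc
    push Not at hc
    obtain ⟨x, hx⟩ := Cm.ne_bot_iff.1 hc.1
    obtain ⟨y, hy⟩ := Cm.ne_bot_iff.1 hc.2
    suffices hw : ∃ w, S.cyc x y w by
      obtain ⟨w, hw⟩ := hw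
      have hm : w ∈ comp P Q := ⟨x, hx, y, hy, hw⟩
      rw [hPQ] at hm
      exact Cm.mem_bot hm
    by_cases hxe : x = e
    · exact ⟨y, (hxe ▸ h.ident_cyc _ _).2 rfl⟩
    by_cases hye : y = e
    · exact ⟨x, (hye ▸ h.cyc_ident _ _).2 rfl⟩
    obtain ⟨w, hw⟩ := hk {(x, y)} (by simp) (by simp [hxe, hye])
    exact ⟨w, hw (x, y) (by simp)⟩

end IsSymCyc

/-! ## Subalgebras -/

section Subalgebra

variable {α : Type u} [BooleanAlgebra α] [RelSig α]

theorem IsRelationAlgebra.sub (h : IsRelationAlgebra α) (T : RelSubalgebra α) :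
    IsRelationAlgebra T where
  comp_assoc x y z := Subtype.ext (h.comp_assoc x.1 y.1 z.1)
  sup_comp x y z := Subtype.ext (h.sup_comp x.1 y.1 z.1)
  comp_ident x := Subtype.ext (h.comp_ident x.1)
  conv_conv x := Subtype.ext (h.conv_conv x.1)
  conv_sup x y := Subtype.ext (h.conv_sup x.1 y.1)
  conv_comp x y := Subtype.ext (h.conv_comp x.1 y.1)
  conv_comp_compl_le x y := h.conv_comp_compl_le x.1 y.1

theorem IsSymmetric.sub (h : IsSymmetric α) (T : RelSubalgebra α) : IsSymmetric T :=
  fun x => Subtype.ext (h x.1)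

theorem IsIntegralRA.sub (h : IsIntegralRA α) (T : RelSubalgebra α) : IsIntegralRA T := by
  have := h.1
  refine ⟨⟨⊥, ⊤, fun hbt => bot_ne_top (α := α) (congrArg Subtype.val hbt)⟩, fun x y hxy => ?_⟩
  exact (h.2 x.1 y.1 (congrArg Subtype.val hxy)).imp (fun h => Subtype.ext h)
    fun h => Subtype.ext h

theorem IsFiniteSymmetricIntegralRA.sub (h : IsFiniteSymmetricIntegralRA α) (T : RelSubalgebra α) :
    IsFiniteSymmetricIntegralRA T where
  finite := have := h.finite; inferInstanceAs (Finite {x // x ∈ T})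
  relationAlgebra := h.relationAlgebra.sub T
  symmetric := h.symmetric.sub T
  integral := h.integral.sub T

theorem RelSubalgebra.isAtom_of_coe {T : RelSubalgebra α} {a : T} (h : IsAtom a.1) : IsAtom a := by
  refine ⟨fun h0 => h.1 (congrArg Subtype.val h0), fun b hb => Subtype.ext (h.2 b.1 hb)⟩

theorem RelSubalgebra.generate_le {s : Set α} {T : RelSubalgebra α} (h : s ⊆ T) {x : α}
    (hx : x ∈ RelSubalgebra.generate s) : x ∈ T := hx T h

theorem RelSubalgebra.subset_generate (s : Set α) : s ⊆ RelSubalgebra.generate s :=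
  fun _ hx _ hS => hS hx

theorem mem_atomSubalgebra {a : α} (h : IsAtom a) : a ∈ atomSubalgebra α :=
  RelSubalgebra.subset_generate _ h

theorem isAtomic_atomSubalgebra (h : IsAtomic α) : IsAtomic (atomSubalgebra α) where
  eq_bot_or_exists_atom_le b := by
    rcases h.eq_bot_or_exists_atom_le b.1 with hb | ⟨a, ha, hab⟩
    · exact .inl (Subtype.ext hb)
    · exact .inr ⟨⟨a, mem_atomSubalgebra ha⟩, RelSubalgebra.isAtom_of_coe ha, hab⟩

/-- The image in `α` of a subalgebra of a subalgebra of `α`. -/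
def RelSubalgebra.lift {T : RelSubalgebra α} (R : RelSubalgebra T) : RelSubalgebra α where
  carrier := {x | ∃ h : x ∈ T, (⟨x, h⟩ : T) ∈ R}
  supClosed' _ hx _ hy := ⟨T.supClosed' hx.1 hy.1, R.supClosed' hx.2 hy.2⟩
  infClosed' _ hx _ hy := ⟨T.infClosed' hx.1 hy.1, R.infClosed' hx.2 hy.2⟩
  compl_mem' hx := ⟨T.compl_mem' hx.1, R.compl_mem' hx.2⟩
  bot_mem' := ⟨T.bot_mem', R.bot_mem'⟩
  comp_mem' hx hy := ⟨T.comp_mem' hx.1 hy.1, R.comp_mem' hx.2 hy.2⟩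
  conv_mem' hx := ⟨T.conv_mem' hx.1, R.conv_mem' hx.2⟩
  ident_mem' := ⟨T.ident_mem', R.ident_mem'⟩

/-- The preimage in a subalgebra `T` of a subalgebra of `α`. -/
def RelSubalgebra.restrict (T R : RelSubalgebra α) : RelSubalgebra T where
  carrier := {x | x.1 ∈ R}
  supClosed' _ hx _ hy := R.supClosed' hx hy
  infClosed' _ hx _ hy := R.infClosed' hx hy
  compl_mem' hx := R.compl_mem' hx
  bot_mem' := R.bot_mem'
  comp_mem' hx hy := R.comp_mem' hx hy
  conv_mem' hx := R.conv_mem' hx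
  ident_mem' := R.ident_mem'

theorem isAtomGenerated_atomSubalgebra : IsAtomGenerated (atomSubalgebra α) := by
  intro x R hR
  have : x.1 ∈ RelSubalgebra.lift R := x.2 (RelSubalgebra.lift R) fun a ha =>
    ⟨mem_atomSubalgebra ha, hR (RelSubalgebra.isAtom_of_coe (a := ⟨a, mem_atomSubalgebra ha⟩) ha)⟩
  exact this.2

end Subalgebra

end Complex

/-! ## Networks -/

section Network

variable {X : Type u} {S : RelAtomStructure X} {e : X}

/-- A labelling of pairs of points by atoms in which all triangles are cycles. -/
structure IsNet (S : RelAtomStructure X) (e : X) {V : Type v} (N : V → V → X) : Prop where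
  diag : ∀ i, N i i = e
  symm : ∀ i j, N i j = N j i
  tri : ∀ i l j, S.cyc (N i l) (N l j) (N i j)

theorem IsNet.comap {V : Type v} {W : Type w} {N : V → V → X} (h : IsNet S e N) (f : W → V) :
    IsNet S e (fun i j => N (f i) (f j)) :=
  ⟨fun _ => h.diag _, fun _ _ => h.symm _ _, fun _ _ _ => h.tri _ _ _⟩

theorem IsNet.eq_of_eq_ident (hS : IsSymCyc S e) {V : Type v} {N : V → V → X} (h : IsNet S e N)
    {i j : V} (hij : N i j = e) (k : V) : N i k = N j k := by
  have := h.tri i j k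
  rw [hij, hS.ident_cyc] at this
  exact this.symm

theorem IsNet.of_distinct (hS : IsSymCyc S e) {V : Type v} {N : V → V → X} (hd : ∀ i, N i i = e)
    (hs : ∀ i j, N i j = N j i)
    (ht : ∀ i l j, i ≠ l → l ≠ j → i ≠ j → S.cyc (N i l) (N l j) (N i j)) : IsNet S e N := by
  refine ⟨hd, hs, fun i l j => ?_⟩
  by_cases h1 : i = l
  · subst h1; rw [hd]; exact (hS.ident_cyc _ _).2 rfl
  by_cases h2 : l = j
  · subst h2; rw [hd]; exact (hS.cyc_ident _ _).2 rfl
  by_cases h3 : i = j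
  · subst h3; rw [hd]; exact (hS.cyc_to_ident _ _).2 (hs _ _)
  exact ht i l j h1 h2 h3

/-- Two networks on `V` which agree off `i` and `j` can be amalgamated. -/
def HasAmalg (S : RelAtomStructure X) (e : X) (V : Type v) : Prop :=
  ∀ (N N' : V → V → X), IsNet S e N → IsNet S e N' → ∀ i j : V, i ≠ j →
    (∀ a b, a ≠ i → a ≠ j → b ≠ i → b ≠ j → N a b = N' a b) →
    ∃ N'' : V → V → X, IsNet S e N'' ∧ (∀ a b, a ≠ i → b ≠ i → N'' a b = N a b) ∧
      ∀ a b, a ≠ j → b ≠ j → N'' a b = N' a b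

theorem exists_edge (hS : IsSymCyc S e) {k : ℕ} (hk : HasExt S e k) {V : Type v}
    [Fintype V] (hV : Fintype.card V ≤ k + 2) {N N' : V → V → X} (hN : IsNet S e N)
    (hN' : IsNet S e N') {i j : V} (hij : i ≠ j)
    (hag : ∀ a b, a ≠ i → a ≠ j → b ≠ i → b ≠ j → N a b = N' a b) :
    ∃ w, ∀ l, l ≠ i → l ≠ j → S.cyc (N' i l) (N l j) w := by
  classical
  by_cases h1 : ∃ l, l ≠ i ∧ l ≠ j ∧ N' i l = e
  · obtain ⟨l, hli, hlj, hl⟩ := h1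
    refine ⟨N l j, fun m hmi hmj => ?_⟩
    rw [hN'.eq_of_eq_ident hS hl, ← hag l m hli hlj hmi hmj]
    exact hN.tri l m j
  by_cases h2 : ∃ l, l ≠ i ∧ l ≠ j ∧ N l j = e
  · obtain ⟨l, hli, hlj, hl⟩ := h2
    refine ⟨N' i l, fun m hmi hmj => ?_⟩
    rw [hN.symm m j, ← hN.eq_of_eq_ident hS hl, hag l m hli hlj hmi hmj, hN'.symm l m]
    exact hN'.tri i m l
  push Not at h1 h2
  obtain ⟨w, hw⟩ := hk (((Finset.univ.erase i).erase j).image fun l => (N' i l, N l j)) (by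
      refine Finset.card_image_le.trans ?_
      rw [Finset.card_erase_of_mem (by simp [hij.symm]), Finset.card_erase_of_mem (by simp),
        Finset.card_univ]
      omega) (by
      intro p hp
      obtain ⟨l, hl, rfl⟩ := Finset.mem_image.1 hp
      simp only [Finset.mem_erase, Finset.mem_univ, and_true] at hl
      exact ⟨h1 l hl.2 hl.1, h2 l hl.2 hl.1⟩)
  refine ⟨w, fun l hli hlj => hw (N' i l, N l j) (Finset.mem_image.2 ⟨l, ?_, rfl⟩)⟩
  simp [hli, hlj]

theorem HasExt.hasAmalg (hS : IsSymCyc S e) {k : ℕ} (hk : HasExt S e k) {V : Type v}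
    [Fintype V] (hV : Fintype.card V ≤ k + 2) : HasAmalg S e V := by
  classical
  intro N N' hN hN' i j hij hag
  obtain ⟨w, hw⟩ := exists_edge hS hk hV hN hN' hij hag
  let M : V → V → X := fun a b =>
    if (a = i ∧ b = j) ∨ (a = j ∧ b = i) then w else if a = i ∨ b = i then N' a b else N a b
  have hM1 : ∀ a b, a ≠ i → b ≠ i → M a b = N a b := fun a b ha hb => by simp [M, ha, hb]
  have hM2 : ∀ a b, a ≠ j → b ≠ j → M a b = N' a b := fun a b ha hb => by
    by_cases hai : a = i
    · simp [M, hai, hb, hij]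
    · by_cases hbi : b = i
      · simp [M, hbi, ha, hij]
      · simp only [M, hai, hbi, ha, hb]
        simpa using hag a b hai ha hbi hb
  have hMw : M i j = w := by simp [M]
  have hMw' : M j i = w := by simp [M]
  have hs : ∀ a b, M a b = M b a := fun a b => by
    simp only [M]
    rw [hN.symm a b, hN'.symm a b]
    congr 1
    · exact propext ⟨fun h => h.symm.imp And.symm And.symm, fun h => h.symm.imp And.symm And.symm⟩
    · congr 1
      exact propext or_comm
  have key : ∀ l, l ≠ i → l ≠ j → S.cyc (M i l) (M l j) (M i j) := fun l hi hj => by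
    rw [hMw, hM2 i l hij hj, hM1 l j hi hij.symm]
    exact hw l hi hj
  refine ⟨M, IsNet.of_distinct hS ?_ hs ?_, hM1, hM2⟩
  · intro a
    by_cases ha : a = i
    · rw [hM2 a a (ha ▸ hij) (ha ▸ hij)]; exact hN'.diag a
    · rw [hM1 a a ha ha]; exact hN.diag a
  · intro a l b hal hlb hab
    by_cases hni : a ≠ i ∧ l ≠ i ∧ b ≠ i
    · rw [hM1 _ _ hni.1 hni.2.1, hM1 _ _ hni.2.1 hni.2.2, hM1 _ _ hni.1 hni.2.2]
      exact hN.tri a l b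
    by_cases hnj : a ≠ j ∧ l ≠ j ∧ b ≠ j
    · rw [hM2 _ _ hnj.1 hnj.2.1, hM2 _ _ hnj.2.1 hnj.2.2, hM2 _ _ hnj.1 hnj.2.2]
      exact hN'.tri a l b
    by_cases hai : a = i
    · subst hai
      by_cases hlj : l = j
      · subst hlj
        rw [hs l b]
        exact hS.swap (hS.rot (hS.swap (key b hab.symm hlb.symm)))
      · obtain rfl : b = j := by tauto
        exact key l hal.symm hlj
    · by_cases hli : l = i
      · subst hli
        by_cases haj : a = j
        · subst haj
          rw [hs a l, hs a b]
          exact hS.rot (hS.swap (hS.rot (hS.swap (key b hlb.symm hab.symm))))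
        · obtain rfl : b = j := by tauto
          rw [hs a l]
          exact hS.rot (key a hal haj)
      · obtain rfl : b = i := by tauto
        by_cases haj : a = j
        · subst haj
          rw [hs a l, hs l b, hs a b]
          exact hS.swap (key l hlb hal.symm)
        · obtain rfl : l = j := by tauto
          rw [hs l b, hs a b]
          exact hS.rot (hS.swap (key a hab haj))

/-- A network can be changed at the point `i` so as to extend a network on `S` and `i` with which
it agrees on `S`. -/
theorem HasAmalg.extend {V : Type v} [Fintype V] (hA : HasAmalg S e V)
    {N M : V → V → X} (hN : IsNet S e N) (hM : IsNet S e M) (s : Set V) (i o : V)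
    (hi : i ∉ s) (ho : o ∈ s) (hag : ∀ a ∈ s, ∀ b ∈ s, N a b = M a b) :
    ∃ N' : V → V → X, IsNet S e N' ∧ (∀ a b, a ≠ i → b ≠ i → N' a b = N a b) ∧
      ∀ a ∈ insert i s, ∀ b ∈ insert i s, N' a b = M a b := by
  classical
  suffices H : ∀ T : Finset V, ∃ N' : V → V → X, IsNet S e N' ∧
      (∀ a b, a ∈ s ∨ a ∈ T → b ∈ s ∨ b ∈ T → a ≠ i → b ≠ i → N' a b = N a b) ∧
      ∀ a ∈ insert i s, ∀ b ∈ insert i s, N' a b = M a b by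
    obtain ⟨N', h1, h2, h3⟩ := H Finset.univ
    exact ⟨N', h1, fun a b => h2 a b (.inr (Finset.mem_univ _)) (.inr (Finset.mem_univ _)), h3⟩
  intro T
  induction T using Finset.induction_on with
  | empty => exact ⟨M, hM, fun a b ha hb _ _ => (hag a (by simpa using ha) b (by simpa using hb)).symm,
      fun _ _ _ _ => rfl⟩
  | insert t T ht ih =>
    obtain ⟨N₁, h1, h2, h3⟩ := ih
    by_cases hts : t ∈ insert i s
    · refine ⟨N₁, h1, fun a b ha hb hai hbi => ?_, h3⟩
      have aux : ∀ a, a ∈ s ∨ a ∈ insert t T → a ≠ i → a ∈ s ∨ a ∈ T := by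
        intro a ha hai
        rcases ha with ha | ha
        · exact .inl ha
        · rcases Finset.mem_insert.1 ha with rfl | ha
          · exact .inl (hts.resolve_left hai)
          · exact .inr ha
      exact h2 a b (aux a ha hai) (aux b hb hbi) hai hbi
    · have hti : t ≠ i := fun h => hts (.inl h)
      have hts' : t ∉ s := fun h => hts (.inr h)
      have hoi : o ≠ i := fun h => hi (h ▸ ho)
      let c₁ : V → V := fun x => if (x ∈ s ∨ x ∈ insert t T) ∧ x ≠ i then x else o
      let c₂ : V → V := fun x => if x ∈ s ∨ x ∈ T ∨ x = i then x else o
      have hc : ∀ x, x ≠ i → x ≠ t → c₁ x = c₂ x ∧ (c₂ x ∈ s ∨ c₂ x ∈ T) ∧ c₂ x ≠ i := by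
        intro x hx hxt
        by_cases hxs : x ∈ s ∨ x ∈ T
        · have e1 : c₁ x = x := if_pos ⟨by simpa [hxt] using hxs, hx⟩
          have e2 : c₂ x = x := if_pos (by tauto)
          rw [e1, e2]
          exact ⟨rfl, hxs, hx⟩
        · have e1 : c₁ x = o := if_neg (by simp only [Finset.mem_insert]; tauto)
          have e2 : c₂ x = o := if_neg (by tauto)
          rw [e1, e2]
          exact ⟨rfl, .inl ho, hoi⟩
      obtain ⟨N', g1, g2, g3⟩ := hA _ _ (hN.comap c₁) (h1.comap c₂) i t hti.symm
        (fun a b hai hat hbi hbt => by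
          obtain ⟨ea, ma, na⟩ := hc a hai hat
          obtain ⟨eb, mb, nb⟩ := hc b hbi hbt
          simp only [ea, eb]
          exact (h2 _ _ ma mb na nb).symm)
      refine ⟨N', g1, fun a b ha hb hai hbi => ?_, fun a ha b hb => ?_⟩
      · rw [g2 a b hai hbi]
        have e1 : c₁ a = a := if_pos ⟨ha, hai⟩
        have e2 : c₁ b = b := if_pos ⟨hb, hbi⟩
        rw [e1, e2]
      · have aux : ∀ a, a ∈ insert i s → a ≠ t ∧ c₂ a = a := by
          intro a ha
          refine ⟨fun h => hts (h ▸ ha), if_pos ?_⟩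
          rcases ha with ha | ha
          · exact .inr (.inr ha)
          · exact .inl ha
        rw [g3 a b (aux a ha).1 (aux b hb).1, (aux a ha).2, (aux b hb).2]
        exact h3 a ha b hb

/-- The network with vertices `0, 1, 2` and the given edges. -/
def triangleNet (e a b c : X) : Fin 3 → Fin 3 → X :=
  ![![e, a, b], ![a, e, c], ![b, c, e]]

theorem isNet_triangleNet (hS : IsSymCyc S e) {a b c : X} (h : S.cyc b c a) :
    IsNet S e (triangleNet e a b c) := by
  refine IsNet.of_distinct hS ?_ ?_ ?_
  · intro i; fin_cases i <;> rfl
  · intro i j; fin_cases i <;> fin_cases j <;> rfl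
  · have h1 := hS.rot h
    have h2 := hS.swap h
    have h3 := hS.rot h2
    have h4 := hS.swap h1
    have h5 := hS.swap h3
    intro i l j
    fin_cases i <;> fin_cases l <;> fin_cases j <;> simp [triangleNet] <;> assumption

/-! ## Basic matrices -/

/-- The labelling of a matrix of atoms by members of the atoms. -/
noncomputable def AtomMatrix.net {n : ℕ} (μ : AtomMatrix n (Cm S)) : Fin n → Fin n → X :=
  fun i j => Cm.pt (μ i j)

theorem mem_basicMatrices (hS : IsSymCyc S e) {n : ℕ} {μ : AtomMatrix n (Cm S)} :
    μ ∈ basicMatrices n (Cm S) ↔ IsNet S e μ.net := by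
  simp only [basicMatrices, Set.mem_ofPred_eq, hS.conv_id _, Cm.coe_eq_sing,
    Cm.sing_le, hS.mem_ident, Cm.sing_injective.eq_iff]
  constructor
  · rintro ⟨h1, h2, h3⟩
    exact ⟨h1, h2, fun i l j => Cm.sing_le_comp.1 (Cm.sing_le.2 (h3 i j l))⟩
  · rintro ⟨h1, h2, h3⟩
    exact ⟨h1, h2, fun i j l => Cm.sing_le.1 (Cm.sing_le_comp.2 (h3 i l j))⟩

/-- The matrix of atoms of a labelling. -/
noncomputable def toMatrix {n : ℕ} (S : RelAtomStructure X) (N : Fin n → Fin n → X) :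
    AtomMatrix n (Cm S) := fun i j => Cm.atomEquiv S (N i j)

@[simp] theorem net_toMatrix {n : ℕ} (N : Fin n → Fin n → X) : (toMatrix S N).net = N := by
  funext i j
  exact Cm.pt_atomEquiv _

/-- The basic matrix of a network. -/
noncomputable def IsNet.matrix (hS : IsSymCyc S e) {n : ℕ} {N : Fin n → Fin n → X}
    (h : IsNet S e N) : basicMatrices n (Cm S) :=
  ⟨toMatrix S N, (mem_basicMatrices hS).2 (by rwa [net_toMatrix])⟩

@[simp] theorem IsNet.net_matrix (hS : IsSymCyc S e) {n : ℕ} {N : Fin n → Fin n → X}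
    (h : IsNet S e N) : (h.matrix hS).1.net = N := net_toMatrix N

theorem isNet_net (hS : IsSymCyc S e) {n : ℕ} (μ : basicMatrices n (Cm S)) :
    IsNet S e μ.1.net := (mem_basicMatrices hS).1 μ.2

theorem net_injective {n : ℕ} : Function.Injective (AtomMatrix.net (S := S) (n := n)) :=
  fun _ _ h => funext₂ fun i j => Cm.pt_injective (congrFun₂ h i j)

theorem agreeUpTo_iff {n : ℕ} {i : Fin n} {μ ν : AtomMatrix n (Cm S)} :
    AgreeUpTo i μ ν ↔ ∀ l m, l ≠ i → m ≠ i → μ.net l m = ν.net l m := by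
  simp only [AgreeUpTo, AtomMatrix.net, Cm.pt_injective.eq_iff]

theorem isCylindricBasis_basicMatrices (hS : IsSymCyc S e) {n : ℕ} (hn : 3 ≤ n)
    (hA : HasAmalg S e (Fin n)) : IsCylindricBasis hn (basicMatrices n (Cm S)) where
  subset_basic := le_rfl
  exists_triangle a b c habc := by
    rw [Cm.coe_eq_sing a, Cm.coe_eq_sing b, Cm.coe_eq_sing c, Cm.sing_le_comp] at habc
    have hN := (isNet_triangleNet hS habc).comap
      (fun x : Fin n => if h : x.val < 3 then ⟨x.val, h⟩ else (0 : Fin 3))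
    refine ⟨_, (hN.matrix hS).2, Cm.pt_injective ?_, Cm.pt_injective ?_, Cm.pt_injective ?_⟩
    · exact congrFun₂ (hN.net_matrix hS) _ _
    · exact congrFun₂ (hN.net_matrix hS) _ _
    · exact congrFun₂ (hN.net_matrix hS) _ _
  amalgamation μ hμ μ' hμ' i j hij hag := by
    rw [mem_basicMatrices hS] at hμ hμ'
    obtain ⟨N, h1, h2, h3⟩ := hA _ _ hμ hμ' i j hij
      fun a b hai haj hbi hbj => congrArg Cm.pt (hag a b hai haj hbi hbj)
    refine ⟨_, (h1.matrix hS).2, agreeUpTo_iff.2 ?_, agreeUpTo_iff.2 ?_⟩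
    · rw [h1.net_matrix hS]; exact h2
    · rw [h1.net_matrix hS]; exact h3
  replace_mem μ hμ i j := by
    rw [mem_basicMatrices hS] at hμ ⊢
    exact hμ.comap _

end Network

/-! ## The cylindric algebra of basic matrices -/

section Cylindric

variable {X : Type u} {S : RelAtomStructure X} {e : X} {n : ℕ}

instance Ca.instMembership {A : Type u} [BooleanAlgebra A] [RelSig A] (M : Set (AtomMatrix n A)) :
    Membership M (Ca M) := ⟨fun P x => (show Set M from P) x⟩

/-- A set of matrices as an element of `Ca M`. -/
def Ca.mk {A : Type u} [BooleanAlgebra A] [RelSig A] (M : Set (AtomMatrix n A)) (P : Set M) :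
    Ca M := P

namespace Ca

section

variable {A : Type u} [BooleanAlgebra A] {M : Set (AtomMatrix n A)}

theorem isAtomic : IsAtomic (Ca M) := inferInstanceAs (IsAtomic (Set M))

theorem hasAllJoins : HasAllJoins (Ca M) := fun s =>
  ⟨(⋃₀ (show Set (Set M) from s) : Set M), isLUB_sSup (α := Set M) s⟩

end

section

variable {A : Type u} [BooleanAlgebra A] [RelSig A] {M : Set (AtomMatrix n A)}

theorem ext {P Q : Ca M} (h : ∀ x, x ∈ P ↔ x ∈ Q) : P = Q := Set.ext (α := M) h

@[simp] theorem mem_mk {P : Set M} {x : M} : x ∈ Ca.mk M P ↔ x ∈ P := Iff.rfl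
@[simp] theorem mem_inf {P Q : Ca M} {x : M} : x ∈ P ⊓ Q ↔ x ∈ P ∧ x ∈ Q := Iff.rfl
@[simp] theorem mem_compl {P : Ca M} {x : M} : x ∈ Pᶜ ↔ x ∉ P := Iff.rfl
@[simp] theorem mem_top {x : M} : x ∈ (⊤ : Ca M) := trivial
@[simp] theorem mem_bot {x : M} : ¬ x ∈ (⊥ : Ca M) := fun h => h
theorem mem_cyl {i : Fin n} {P : Ca M} {μ : M} :
    μ ∈ cyl i P ↔ ∃ ν ∈ P, AgreeUpTo i ν.1 μ.1 := Iff.rfl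
theorem mem_diag {i j : Fin n} {μ : M} : μ ∈ (diag i j : Ca M) ↔ (μ.1 i j).1 ≤ ident := Iff.rfl

end

variable {P Q : Ca (basicMatrices n (Cm S))} {μ ν : basicMatrices n (Cm S)}

theorem mem_cyl_net {i : Fin n} : μ ∈ cyl i P ↔
    ∃ ν ∈ P, ∀ l m, l ≠ i → m ≠ i → ν.1.net l m = μ.1.net l m := by
  simp only [mem_cyl, agreeUpTo_iff]

theorem mem_diag_net (hS : IsSymCyc S e) {i j : Fin n} :
    μ ∈ (diag i j : Ca (basicMatrices n (Cm S))) ↔ μ.1.net i j = e := by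
  rw [mem_diag, Cm.coe_eq_sing, Cm.sing_le, hS.mem_ident]; rfl

end Ca

theorem net_eq_of_diag (hS : IsSymCyc S e) {μ ν : basicMatrices n (Cm S)} {i j : Fin n}
    (hij : i ≠ j) (hμ : μ.1.net i j = e) (hν : ν.1.net i j = e)
    (h : ∀ l m, l ≠ i → m ≠ i → μ.1.net l m = ν.1.net l m) : μ = ν := by
  refine Subtype.ext (net_injective (funext₂ fun a b => ?_))
  have key : ∀ b, b ≠ i → μ.1.net i b = ν.1.net i b := fun b hb => by
    rw [(isNet_net hS μ).eq_of_eq_ident hS hμ, (isNet_net hS ν).eq_of_eq_ident hS hν,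
      h j b hij.symm hb]
  by_cases ha : a = i
  · subst ha
    by_cases hb : b = a
    · subst hb
      rw [(isNet_net hS μ).diag, (isNet_net hS ν).diag]
    · exact key b hb
  · by_cases hb : b = i
    · subst hb
      rw [(isNet_net hS μ).symm, (isNet_net hS ν).symm]
      exact key a ha
    · exact h a b ha hb

theorem isCylindricAlgebra_Ca (hS : IsSymCyc S e) (hA : HasAmalg S e (Fin n)) :
    IsCylindricAlgebra n (Ca (basicMatrices n (Cm S))) where
  cyl_bot i := Ca.ext fun μ => ⟨fun ⟨_, h, _⟩ => h, fun h => h.elim⟩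
  le_cyl i P := fun μ hμ => ⟨μ, hμ, fun _ _ _ _ => rfl⟩
  cyl_inf_cyl i P Q := Ca.ext fun μ => by
    simp only [Ca.mem_cyl, Ca.mem_inf]
    constructor
    · rintro ⟨ν, ⟨h1, ξ, h2, h3⟩, h4⟩
      exact ⟨⟨ν, h1, h4⟩, ξ, h2, fun l m hl hm => (h3 l m hl hm).trans (h4 l m hl hm)⟩
    · rintro ⟨⟨ν, h1, h4⟩, ξ, h2, h3⟩
      exact ⟨ν, ⟨h1, ξ, h2, fun l m hl hm => (h3 l m hl hm).trans (h4 l m hl hm).symm⟩, h4⟩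
  cyl_comm i j P := by
    by_cases hij : i = j
    · rw [hij]
    have key : ∀ i j : Fin n, i ≠ j → ∀ P : Ca (basicMatrices n (Cm S)),
        cyl i (cyl j P) ≤ cyl j (cyl i P) := by
      rintro i j hij P μ ⟨ν, ⟨ξ, h1, h2⟩, h3⟩
      rw [agreeUpTo_iff] at h2 h3
      obtain ⟨N, g1, g2, g3⟩ := hA _ _ (isNet_net hS ξ) (isNet_net hS μ) i j hij
        fun a b hai haj hbi hbj => (h2 a b haj hbj).trans (h3 a b hai hbi)
      refine ⟨g1.matrix hS, ⟨ξ, h1, ?_⟩, ?_⟩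
      · rw [agreeUpTo_iff, g1.net_matrix hS]
        exact fun l m hl hm => (g2 l m hl hm).symm
      · rw [agreeUpTo_iff, g1.net_matrix hS]
        exact g3
    exact le_antisymm (key i j hij P) (key j i (Ne.symm hij) P)
  diag_self i := Ca.ext fun μ => by
    rw [Ca.mem_diag_net hS, (isNet_net hS μ).diag]
    simp
  diag_trans i j k hki hkj := Ca.ext fun μ => by
    simp only [Ca.mem_diag_net hS, Ca.mem_cyl_net, Ca.mem_inf]
    constructor
    · intro h
      have hN := (isNet_net hS μ).comap (replaceIdx k j)
      refine ⟨hN.matrix hS, ?_, ?_⟩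
      · rw [hN.net_matrix hS]
        simp only [replaceIdx, hki.symm, hkj.symm, if_true, if_false]
        exact ⟨h, (isNet_net hS μ).diag j⟩
      · rw [hN.net_matrix hS]
        intro l m hl hm
        simp only [replaceIdx, hl, hm, if_false]
    · rintro ⟨ν, ⟨h1, h2⟩, h3⟩
      rw [← h3 i j hki.symm hkj.symm, (isNet_net hS ν).eq_of_eq_ident hS h1, h2]
  cyl_diag i j hij P := Ca.ext fun μ => by
    simp only [Ca.mem_cyl_net, Ca.mem_inf, Ca.mem_diag_net hS, Ca.mem_compl, Ca.mem_bot, iff_false]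
    rintro ⟨⟨ν, ⟨h1, h2⟩, h3⟩, ξ, ⟨h4, h5⟩, h6⟩
    refine h5 ?_
    rwa [← net_eq_of_diag hS hij h1 h4 fun l m hl hm => (h3 l m hl hm).trans (h6 l m hl hm).symm]

/-- The element of `Ca(B_n)` given by a set of labels of the edge `01`. -/
def raMap (S : RelAtomStructure X) (hn : 3 ≤ n) (P : Cm S) : Ca (basicMatrices n (Cm S)) :=
  Ca.mk _ {μ | μ.1.net ⟨0, by omega⟩ ⟨1, by omega⟩ ∈ P}

@[simp] theorem mem_raMap (hn : 3 ≤ n) {P : Cm S} {μ : basicMatrices n (Cm S)} :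
    μ ∈ raMap S hn P ↔ μ.1.net ⟨0, by omega⟩ ⟨1, by omega⟩ ∈ P := Iff.rfl

theorem mem_subst (hS : IsSymCyc S e) {i j : Fin n} (hij : i ≠ j)
    {P : Ca (basicMatrices n (Cm S))} {μ : basicMatrices n (Cm S)} :
    μ ∈ subst i j P ↔ ((isNet_net hS μ).comap (replaceIdx i j)).matrix hS ∈ P := by
  rw [subst, if_neg hij, Ca.mem_cyl_net]
  set ν := ((isNet_net hS μ).comap (replaceIdx i j)).matrix hS with hν
  have hN : ν.1.net = fun a b => μ.1.net (replaceIdx i j a) (replaceIdx i j b) :=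
    IsNet.net_matrix hS _
  have hd : ν.1.net i j = e := by
    rw [hN]
    simp only [replaceIdx, if_true, hij.symm, if_false]
    exact (isNet_net hS μ).diag j
  have ha : ∀ l m, l ≠ i → m ≠ i → ν.1.net l m = μ.1.net l m := fun l m hl hm => by
    rw [hN]; simp only [replaceIdx, hl, hm, if_false]
  constructor
  · rintro ⟨ξ, ⟨h1, h2⟩, h3⟩
    replace h1 := (Ca.mem_diag_net hS).1 h1
    rwa [← net_eq_of_diag hS hij h1 hd fun l m hl hm => (h3 l m hl hm).trans (ha l m hl hm).symm]
  · intro h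
    exact ⟨ν, ⟨(Ca.mem_diag_net hS).2 hd, h⟩, ha⟩

theorem raMap_injective (hS : IsSymCyc S e) (hn : 3 ≤ n) : Function.Injective (raMap S hn) := by
  intro P Q h
  refine Cm.ext fun x => ?_
  have hN := (isNet_triangleNet hS (a := x) (b := e) (c := x) ((hS.ident_cyc _ _).2 rfl)).comap
    (fun y : Fin n => if h : y.val < 3 then ⟨y.val, h⟩ else (0 : Fin 3))
  have key : ∀ P : Cm S, hN.matrix hS ∈ raMap S hn P ↔ x ∈ P := fun P => by
    rw [mem_raMap, hN.net_matrix hS]; rfl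
  rw [← key P, ← key Q, h]

theorem raMap_range (hS : IsSymCyc S e) (hn : 3 ≤ n) : Set.range (raMap S hn) =
    {x : Ca (basicMatrices n (Cm S)) | ∀ k : Fin n, 2 ≤ k.val → cyl k x = x} := by
  ext Q
  constructor
  · rintro ⟨P, rfl⟩ k hk
    refine Ca.ext fun μ => ⟨?_, fun h => ⟨μ, h, fun _ _ _ _ => rfl⟩⟩
    rintro ⟨ν, h1, h2⟩
    rw [agreeUpTo_iff] at h2
    replace h1 := (mem_raMap hn).1 h1
    rw [mem_raMap]
    rwa [← h2 _ _ (by rw [Fin.ne_iff_vne]; simp only; omega) (by rw [Fin.ne_iff_vne]; simp only; omega)]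
  · intro hQ
    have hcl : ∀ k : Fin n, 2 ≤ k.val → ∀ μ ν : basicMatrices n (Cm S),
        (∀ l m, l ≠ k → m ≠ k → μ.1.net l m = ν.1.net l m) → μ ∈ Q → ν ∈ Q := by
      intro k hk μ ν h hμ
      rw [← hQ k hk, Ca.mem_cyl_net]
      exact ⟨μ, hμ, h⟩
    have key : ∀ T : Finset (Fin n), (∀ k ∈ T, 2 ≤ k.val) → ∀ μ ν : basicMatrices n (Cm S),
        ν.1.net = (fun a b => μ.1.net (if a ∈ T then ⟨0, by omega⟩ else a)
          (if b ∈ T then ⟨0, by omega⟩ else b)) → (μ ∈ Q ↔ ν ∈ Q) := by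
      intro T
      induction T using Finset.induction_on with
      | empty =>
        intro _ μ ν hν
        have : ν = μ := Subtype.ext (net_injective (by rw [hν]; simp))
        rw [this]
      | insert k T hk ih =>
        intro hT μ ν hν
        have hN := (isNet_net hS μ).comap fun a => if a ∈ T then (⟨0, by omega⟩ : Fin n) else a
        rw [ih (fun k hk => hT k (Finset.mem_insert_of_mem hk)) μ (hN.matrix hS)
          (hN.net_matrix hS)]
        have h0 : ∀ l m, l ≠ k → m ≠ k → (hN.matrix hS).1.net l m = ν.1.net l m := by
          intro l m hl hm
          rw [hN.net_matrix hS, hν]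
          simp [Finset.mem_insert, hl, hm]
        have hk2 := hT k (Finset.mem_insert_self _ _)
        exact ⟨hcl k hk2 _ _ h0, hcl k hk2 _ _ fun l m hl hm => (h0 l m hl hm).symm⟩
    have key' : ∀ μ ν : basicMatrices n (Cm S), μ ∈ Q →
        μ.1.net ⟨0, by omega⟩ ⟨1, by omega⟩ = ν.1.net ⟨0, by omega⟩ ⟨1, by omega⟩ → ν ∈ Q := by
      intro μ ν hμ h01
      let T : Finset (Fin n) := Finset.univ.filter fun k => 2 ≤ k.val
      have hT : ∀ k ∈ T, 2 ≤ k.val := fun k hk => (Finset.mem_filter.1 hk).2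
      have hc := fun ξ : basicMatrices n (Cm S) =>
        (isNet_net hS ξ).comap fun a => if a ∈ T then (⟨0, by omega⟩ : Fin n) else a
      have h1 := (key T hT μ _ ((hc μ).net_matrix hS)).1 hμ
      refine (key T hT ν ((hc μ).matrix hS) ?_).2 h1
      rw [(hc μ).net_matrix hS]
      funext a b
      have hT' : ∀ a, (if a ∈ T then (⟨0, by omega⟩ : Fin n) else a) = ⟨0, by omega⟩ ∨
          (if a ∈ T then (⟨0, by omega⟩ : Fin n) else a) = ⟨1, by omega⟩ := by
        intro a
        by_cases ha : a ∈ T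
        · simp [ha]
        · rw [if_neg ha]
          have : ¬ 2 ≤ a.val := fun h => ha (Finset.mem_filter.2 ⟨Finset.mem_univ _, h⟩)
          simp only [Fin.ext_iff]
          omega
      rcases hT' a with ha | ha <;> rcases hT' b with hb | hb <;> rw [ha, hb]
      · rw [(isNet_net hS μ).diag, (isNet_net hS ν).diag]
      · exact h01
      · rw [(isNet_net hS μ).symm, (isNet_net hS ν).symm]; exact h01
      · rw [(isNet_net hS μ).diag, (isNet_net hS ν).diag]
    refine ⟨Cm.mk S {x | ∃ μ ∈ Q, μ.1.net ⟨0, by omega⟩ ⟨1, by omega⟩ = x}, Ca.ext fun μ => ?_⟩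
    constructor
    · rintro ⟨ν, h1, h2⟩
      exact key' ν μ h1 h2
    · intro h
      exact ⟨μ, h, rfl⟩

theorem mem_raComp_raMap (hS : IsSymCyc S e) (hn : 3 ≤ n) {P Q : Cm S}
    {μ : basicMatrices n (Cm S)} : μ ∈ raComp hn (raMap S hn P) (raMap S hn Q) ↔
    ∃ ν : basicMatrices n (Cm S), ν.1.net ⟨0, by omega⟩ ⟨2, by omega⟩ ∈ P ∧
      ν.1.net ⟨2, by omega⟩ ⟨1, by omega⟩ ∈ Q ∧
      ∀ l m, l ≠ (⟨2, by omega⟩ : Fin n) → m ≠ (⟨2, by omega⟩ : Fin n) →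
        ν.1.net l m = μ.1.net l m := by
  rw [raComp, Ca.mem_cyl_net]
  refine exists_congr fun ν => ?_
  have h1 : (⟨1, by omega⟩ : Fin n) ≠ ⟨2, by omega⟩ := by simp
  have h2 : (⟨0, by omega⟩ : Fin n) ≠ ⟨2, by omega⟩ := by simp
  have := Ca.mem_inf (x := ν) (P := subst (⟨1, by omega⟩ : Fin n) ⟨2, by omega⟩ (raMap S hn P))
    (Q := subst (⟨0, by omega⟩ : Fin n) ⟨2, by omega⟩ (raMap S hn Q))
  rw [mem_subst hS h1, mem_subst hS h2, mem_raMap, mem_raMap, IsNet.net_matrix hS,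
    IsNet.net_matrix hS] at this
  simp only [replaceIdx, if_true, Fin.mk.injEq, one_ne_zero, zero_ne_one, if_false] at this
  rw [← and_assoc]
  exact and_congr this Iff.rfl

theorem raMap_comp (hS : IsSymCyc S e) (hn : 3 ≤ n) (hA : HasAmalg S e (Fin n)) (P Q : Cm S) :
    raMap S hn (comp P Q) = raComp hn (raMap S hn P) (raMap S hn Q) := Ca.ext fun μ => by
  rw [mem_raComp_raMap hS, mem_raMap, Cm.mem_comp]
  constructor
  · rintro ⟨x, hx, y, hy, hc⟩
    have hM := (isNet_triangleNet hS hc).comap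
      (fun y : Fin n => if h : y.val < 3 then ⟨y.val, h⟩ else (0 : Fin 3))
    have n0 : 0 < n := by omega
    have n1 : 1 < n := by omega
    obtain ⟨N, h1, h2, h3⟩ := hA.extend (isNet_net hS μ) hM {⟨0, n0⟩, ⟨1, n1⟩}
      ⟨2, by omega⟩ ⟨0, n0⟩ (by simp) (by simp) (by
        rintro a (rfl | rfl) b (rfl | rfl)
        · rw [(isNet_net hS μ).diag, hM.diag]
        · rfl
        · rw [(isNet_net hS μ).symm]; rfl
        · rw [(isNet_net hS μ).diag, hM.diag])
    refine ⟨h1.matrix hS, ?_, ?_, ?_⟩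
    · rw [h1.net_matrix hS, h3 _ (by simp) _ (by simp)]; exact hx
    · rw [h1.net_matrix hS, h3 _ (by simp) _ (by simp)]; exact hy
    · rw [h1.net_matrix hS]; exact h2
  · rintro ⟨ν, h1, h2, h3⟩
    refine ⟨_, h1, _, h2, ?_⟩
    rw [← h3 _ _ (by simp) (by simp)]
    exact (isNet_net hS ν).tri _ _ _

theorem raConv_raMap (hS : IsSymCyc S e) (hn : 3 ≤ n) (P : Cm S) :
    raConv hn (raMap S hn P) = raMap S hn P := Ca.ext fun μ => by
  have h1 : (⟨1, by omega⟩ : Fin n) ≠ ⟨2, by omega⟩ := by simp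
  have h2 : (⟨0, by omega⟩ : Fin n) ≠ ⟨1, by omega⟩ := by simp
  have h3 : (⟨2, by omega⟩ : Fin n) ≠ ⟨0, by omega⟩ := by simp
  rw [raConv, mem_subst hS h3, mem_subst hS h2, mem_subst hS h1, mem_raMap, mem_raMap,
    IsNet.net_matrix hS, IsNet.net_matrix hS, IsNet.net_matrix hS]
  simp only [replaceIdx, if_true, Fin.mk.injEq, zero_ne_one, if_false,
    OfNat.ofNat_ne_zero, OfNat.one_ne_ofNat]
  rw [(isNet_net hS μ).symm]

theorem isIsoOntoRa_raMap (hS : IsSymCyc S e) (hn : 3 ≤ n) (hA : HasAmalg S e (Fin n)) :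
    IsIsoOntoRa hn (raMap S hn) where
  injective := raMap_injective hS hn
  range_eq := raMap_range hS hn
  map_sup _ _ := rfl
  map_compl _ := rfl
  map_comp := raMap_comp hS hn hA
  map_conv P := by rw [hS.conv_id, raConv_raMap hS]
  map_ident := Ca.ext fun μ => by rw [mem_raMap, hS.mem_ident, Ca.mem_diag_net hS]

/-- A basic matrix restricted to its first `m` indices. -/
noncomputable def restrictMatrix (hS : IsSymCyc S e) {m n : ℕ} (hmn : m ≤ n)
    (μ : basicMatrices n (Cm S)) : basicMatrices m (Cm S) :=
  ((isNet_net hS μ).comap (Fin.castLE hmn)).matrix hS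

theorem isNeatEmbedding_restrict (hS : IsSymCyc S e) {m n : ℕ} (hmn : m ≤ n) (hm : 3 ≤ m)
    (hA : HasAmalg S e (Fin n)) : IsNeatEmbedding hmn
      (fun P : Ca (basicMatrices m (Cm S)) => Ca.mk (basicMatrices n (Cm S))
        {μ | restrictMatrix hS hmn μ ∈ P}) := by
  have hr : ∀ μ : basicMatrices n (Cm S), (restrictMatrix hS hmn μ).1.net =
      fun a b => μ.1.net (Fin.castLE hmn a) (Fin.castLE hmn b) := fun μ => IsNet.net_matrix hS _
  let c : Fin n → Fin m := fun y => if h : y.val < m then ⟨y.val, h⟩ else ⟨0, by omega⟩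
  have hc : ∀ a, c (Fin.castLE hmn a) = a := fun a => by simp [c]
  refine ⟨fun P Q hPQ => Ca.ext fun μ => ?_, fun _ _ => rfl, fun _ => rfl, fun i P => ?_,
    fun i j => ?_, fun P k hk => ?_⟩
  · have hN := (isNet_net hS μ).comap c
    have : restrictMatrix hS hmn (hN.matrix hS) = μ := by
      refine Subtype.ext (net_injective ?_)
      rw [hr, hN.net_matrix hS]
      funext a b
      simp only [hc]
    have h1 : hN.matrix hS ∈ Ca.mk (basicMatrices n (Cm S)) {μ | restrictMatrix hS hmn μ ∈ P} ↔
        hN.matrix hS ∈ Ca.mk (basicMatrices n (Cm S)) {μ | restrictMatrix hS hmn μ ∈ Q} := by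
      rw [show Ca.mk (basicMatrices n (Cm S)) {μ | restrictMatrix hS hmn μ ∈ P} = _ from hPQ]
    simpa [this] using h1
  · refine Ca.ext fun μ => ?_
    rw [Ca.mem_mk, Set.mem_ofPred_eq, Ca.mem_cyl_net, Ca.mem_cyl_net]
    simp only [hr]
    constructor
    · rintro ⟨ν, h1, h2⟩
      have hM := (isNet_net hS ν).comap c
      have hi : (Fin.castLE hmn i) ∉ {a : Fin n | a.val < m ∧ a ≠ Fin.castLE hmn i} := by simp
      obtain ⟨o, ho⟩ : ∃ o : Fin m, o ≠ i := by
        have : Nontrivial (Fin m) := Fin.nontrivial_iff_two_le.2 (by omega)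
        exact exists_ne i
      obtain ⟨N, g1, g2, g3⟩ := hA.extend (isNet_net hS μ) hM
        {a : Fin n | a.val < m ∧ a ≠ Fin.castLE hmn i} (Fin.castLE hmn i) (Fin.castLE hmn o) hi
        ⟨o.2, fun h => ho (Fin.castLE_injective hmn h)⟩ (by
          rintro a ⟨ha, ha'⟩ b ⟨hb, hb'⟩
          obtain ⟨a, rfl⟩ : ∃ a', a = Fin.castLE hmn a' := ⟨⟨a.val, ha⟩, rfl⟩
          obtain ⟨b, rfl⟩ : ∃ a', b = Fin.castLE hmn a' := ⟨⟨b.val, hb⟩, rfl⟩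
          rw [hc, hc]
          exact (h2 a b (fun h => ha' (h ▸ rfl)) (fun h => hb' (h ▸ rfl))).symm)
      refine ⟨g1.matrix hS, ?_, ?_⟩
      · have : restrictMatrix hS hmn (g1.matrix hS) = ν := by
          refine Subtype.ext (net_injective ?_)
          rw [hr, g1.net_matrix hS]
          funext a b
          have aux : ∀ a : Fin m, Fin.castLE hmn a ∈
              insert (Fin.castLE hmn i) {a : Fin n | a.val < m ∧ a ≠ Fin.castLE hmn i} := by
            intro a
            by_cases h : a = i
            · exact .inl (h ▸ rfl)
            · exact .inr ⟨a.2, fun h' => h (Fin.castLE_injective hmn h')⟩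
          rw [g3 _ (aux a) _ (aux b), hc, hc]
        rw [Ca.mem_mk, Set.mem_ofPred_eq, this]
        exact h1
      · rw [g1.net_matrix hS]; exact g2
    · rintro ⟨ν, h1, h2⟩
      refine ⟨restrictMatrix hS hmn ν, h1, fun l k hl hk => ?_⟩
      rw [hr]
      exact h2 _ _ (fun h => hl (Fin.castLE_injective hmn h))
        fun h => hk (Fin.castLE_injective hmn h)
  · refine Ca.ext fun μ => ?_
    rw [Ca.mem_mk, Set.mem_ofPred_eq, Ca.mem_diag_net hS, Ca.mem_diag_net hS, hr]
  · refine Ca.ext fun μ => ⟨?_, fun h => ⟨μ, h, fun _ _ _ _ => rfl⟩⟩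
    rintro ⟨ν, h1, h2⟩
    rw [agreeUpTo_iff] at h2
    have : restrictMatrix hS hmn ν = restrictMatrix hS hmn μ := by
      refine Subtype.ext (net_injective ?_)
      rw [hr, hr]
      funext a b
      refine h2 _ _ ?_ ?_ <;>
      · rw [Fin.ne_iff_vne, Fin.val_castLE]; omega
    rw [Ca.mem_mk, Set.mem_ofPred_eq, ← this]
    exact h1

theorem inRaCA_of_hasAmalg (hS : IsSymCyc S e) (hn : 3 ≤ n) (hA : HasAmalg S e (Fin n))
    (hA₃ : HasAmalg S e (Fin 3)) : InRaCA.{u} hn (Cm S) :=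
  ⟨Ca (basicMatrices 3 (Cm S)), inferInstance, inferInstance,
    ⟨Ca (basicMatrices n (Cm S)), inferInstance, inferInstance, isCylindricAlgebra_Ca hS hA, _,
      isNeatEmbedding_restrict hS hn le_rfl hA⟩,
    _, isIsoOntoRa_raMap hS le_rfl hA₃⟩

end Cylindric

/-! ## Substitutions in cylindric algebras -/

section Substitution

variable {n : ℕ} {D : Type u} [BooleanAlgebra D] [CylSig n D]

namespace IsCylindricAlgebra

variable {i j k l : Fin n} {x y : D}

theorem cyl_cyl (h : IsCylindricAlgebra n D) (i : Fin n) (x : D) :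
    cyl i (cyl i x) = cyl i x := by
  have h1 : cyl i (⊤ : D) = ⊤ := top_le_iff.1 (h.le_cyl i ⊤)
  have := h.cyl_inf_cyl i ⊤ x
  rwa [top_inf_eq, h1, top_inf_eq] at this

theorem cyl_top (h : IsCylindricAlgebra n D) (i : Fin n) : cyl i (⊤ : D) = ⊤ :=
  top_le_iff.1 (h.le_cyl i ⊤)

theorem inf_eq_bot_comm (h : IsCylindricAlgebra n D) (i : Fin n) (x y : D) :
    x ⊓ cyl i y = ⊥ ↔ cyl i x ⊓ y = ⊥ := by
  have key : ∀ x y : D, x ⊓ cyl i y = ⊥ → cyl i x ⊓ y = ⊥ := fun x y hxy => by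
    have h1 : cyl i x ⊓ cyl i y = ⊥ := by rw [← h.cyl_inf_cyl, hxy, h.cyl_bot]
    exact le_bot_iff.1 (h1 ▸ inf_le_inf_left _ (h.le_cyl i y))
  refine ⟨key x y, fun hxy => ?_⟩
  rw [inf_comm] at hxy ⊢
  exact key y x hxy

theorem cyl_le_iff (h : IsCylindricAlgebra n D) (hy : cyl i y = y) : cyl i x ≤ y ↔ x ≤ y := by
  refine ⟨(h.le_cyl i x).trans, fun hxy => ?_⟩
  rw [← inf_eq_left.2 hxy]
  conv_lhs => rw [← hy, h.cyl_inf_cyl, hy]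
  exact inf_le_right

theorem cyl_mono (h : IsCylindricAlgebra n D) (i : Fin n) (hxy : x ≤ y) : cyl i x ≤ cyl i y :=
  (h.cyl_le_iff (h.cyl_cyl i y)).2 (hxy.trans (h.le_cyl i y))

theorem cyl_compl (h : IsCylindricAlgebra n D) (hx : cyl i x = x) : cyl i xᶜ = xᶜ := by
  refine le_antisymm ?_ (h.le_cyl i _)
  rw [le_compl_iff_disjoint_right, disjoint_iff, ← h.inf_eq_bot_comm, hx, compl_inf_eq_bot]

theorem cyl_sup (h : IsCylindricAlgebra n D) (i : Fin n) (x y : D) :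
    cyl i (x ⊔ y) = cyl i x ⊔ cyl i y := by
  refine le_antisymm ?_ (sup_le (h.cyl_mono i le_sup_left) (h.cyl_mono i le_sup_right))
  have hc : cyl i (cyl i x ⊔ cyl i y) = cyl i x ⊔ cyl i y := by
    have h1 := h.cyl_compl (h.cyl_cyl i x)
    have h2 := h.cyl_compl (h.cyl_cyl i y)
    have h3 : cyl i ((cyl i x)ᶜ ⊓ (cyl i y)ᶜ) = (cyl i x)ᶜ ⊓ (cyl i y)ᶜ := by
      conv_lhs => rw [← h2, h.cyl_inf_cyl, h1, h2]
    have := h.cyl_compl h3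
    rwa [compl_inf, compl_compl, compl_compl] at this
  exact (h.cyl_le_iff hc).2 (sup_le_sup (h.le_cyl i x) (h.le_cyl i y))

theorem cyl_inf_of_closed (h : IsCylindricAlgebra n D) (x : D) (hy : cyl i y = y) :
    cyl i (x ⊓ y) = cyl i x ⊓ y := by
  conv_lhs => rw [← hy, h.cyl_inf_cyl, hy]

theorem closed_inf (h : IsCylindricAlgebra n D) (hx : cyl i x = x) (hy : cyl i y = y) :
    cyl i (x ⊓ y) = x ⊓ y := by
  rw [h.cyl_inf_of_closed x hy, hx]

theorem closed_cyl (h : IsCylindricAlgebra n D) (j : Fin n) (hx : cyl i x = x) :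
    cyl i (cyl j x) = cyl j x := by
  rw [h.cyl_comm, hx]

theorem diag_closed (h : IsCylindricAlgebra n D) (hki : k ≠ i) (hkj : k ≠ j) :
    cyl k (diag i j : D) = diag i j := by
  rw [h.diag_trans i j k hki hkj, h.cyl_cyl]

theorem diag_comm_le (h : IsCylindricAlgebra n D) (i j : Fin n) : (diag i j : D) ≤ diag j i := by
  by_cases hij : i = j
  · rw [hij]
  have h1 : cyl i (diag j i ⊓ diag i j : D) = ⊤ := by
    rw [← h.diag_trans j j i hij hij, h.diag_self]
  have h2 := h.cyl_diag i j hij (diag j i)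
  rw [inf_comm (diag i j) (diag j i), h1, top_inf_eq] at h2
  have h3 : (diag i j ⊓ (diag j i)ᶜ : D) ≤ ⊥ := h2 ▸ h.le_cyl i _
  exact (le_compl_iff_disjoint_right.2 (disjoint_iff_inf_le.2 h3)).trans (compl_compl _).le

theorem diag_comm (h : IsCylindricAlgebra n D) (i j : Fin n) : (diag i j : D) = diag j i :=
  le_antisymm (h.diag_comm_le i j) (h.diag_comm_le j i)

theorem cyl_diag_eq_top (h : IsCylindricAlgebra n D) (hij : i ≠ j) : cyl i (diag i j : D) = ⊤ := by
  refine top_le_iff.1 ?_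
  rw [← h.diag_self j, h.diag_trans j j i hij hij]
  exact h.cyl_mono i inf_le_right

theorem diag_trans_le (h : IsCylindricAlgebra n D) (i j k : Fin n) :
    (diag i j ⊓ diag j k : D) ≤ diag i k := by
  by_cases h1 : j = i
  · rw [h1]; exact inf_le_right
  by_cases h2 : j = k
  · rw [h2]; exact inf_le_left
  rw [h.diag_trans i k j h1 h2]
  exact h.le_cyl j _

theorem subst_of_ne (hij : i ≠ j) (x : D) : subst i j x = cyl i (diag i j ⊓ x) := if_neg hij

theorem subst_self (i : Fin n) (x : D) : subst i i x = x := if_pos rfl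

theorem subst_of_closed (h : IsCylindricAlgebra n D) (j : Fin n) (hx : cyl i x = x) :
    subst i j x = x := by
  by_cases hij : i = j
  · rw [hij, subst_self]
  rw [subst_of_ne hij, h.cyl_inf_of_closed _ hx, h.cyl_diag_eq_top hij, top_inf_eq]

/-- Below the diagonal `d_ij` an element coincides with its image under `s^i_j`. -/
theorem diag_inf_subst (h : IsCylindricAlgebra n D) (i j : Fin n) (x : D) :
    diag i j ⊓ subst i j x = diag i j ⊓ x := by
  by_cases hij : i = j
  · rw [hij, subst_self]
  rw [subst_of_ne hij]
  refine le_antisymm (le_inf inf_le_left ?_) (le_inf inf_le_left (h.le_cyl i _))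
  have h1 := h.cyl_diag i j hij x
  have h2 : (diag i j ⊓ cyl i (diag i j ⊓ x)) ⊓ xᶜ = ⊥ := by
    refine le_bot_iff.1 (h1 ▸ ?_)
    exact le_inf (inf_le_left.trans inf_le_right)
      ((inf_le_inf_right _ inf_le_left).trans (h.le_cyl i _))
  have := disjoint_iff.2 h2
  exact (le_compl_iff_disjoint_right.2 this).trans (compl_compl _).le

/-- The substitution `s^i_j x` is the only `i`-closed element which coincides with `x` below
`d_ij`. -/
theorem subst_eq_of (h : IsCylindricAlgebra n D) (hij : i ≠ j) (hy : cyl i y = y)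
    (hxy : diag i j ⊓ x = diag i j ⊓ y) : subst i j x = y := by
  rw [subst_of_ne hij, hxy, ← subst_of_ne hij, h.subst_of_closed j hy]

theorem cyl_subst_self (h : IsCylindricAlgebra n D) (hij : i ≠ j) (x : D) :
    cyl i (subst i j x) = subst i j x := by
  rw [subst_of_ne hij, h.cyl_cyl]

theorem subst_closed (h : IsCylindricAlgebra n D) (hki : k ≠ i) (hkj : k ≠ j)
    (hx : cyl k x = x) : cyl k (subst i j x) = subst i j x := by
  by_cases hij : i = j
  · rw [hij, subst_self, hx]
  rw [subst_of_ne hij]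
  exact h.closed_cyl i (h.closed_inf (h.diag_closed hki hkj) hx)

theorem subst_inf (h : IsCylindricAlgebra n D) (i j : Fin n) (x y : D) :
    subst i j (x ⊓ y) = subst i j x ⊓ subst i j y := by
  by_cases hij : i = j
  · subst hij; simp only [subst_self]
  refine h.subst_eq_of hij (h.closed_inf (h.cyl_subst_self hij x) (h.cyl_subst_self hij y)) ?_
  rw [inf_inf_distrib_left, inf_inf_distrib_left (diag i j) (subst i j x), h.diag_inf_subst,
    h.diag_inf_subst]

theorem subst_sup (h : IsCylindricAlgebra n D) (i j : Fin n) (x y : D) :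
    subst i j (x ⊔ y) = subst i j x ⊔ subst i j y := by
  by_cases hij : i = j
  · subst hij; simp only [subst_self]
  rw [subst_of_ne hij, subst_of_ne hij, subst_of_ne hij, inf_sup_left, h.cyl_sup]

theorem subst_bot (h : IsCylindricAlgebra n D) (i j : Fin n) : subst i j (⊥ : D) = ⊥ :=
  h.subst_of_closed j (h.cyl_bot i)

theorem subst_top (h : IsCylindricAlgebra n D) (i j : Fin n) : subst i j (⊤ : D) = ⊤ :=
  h.subst_of_closed j (h.cyl_top i)

/-- `s^i_j s^k_i x = s^i_j s^k_j x`. -/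
theorem subst_subst_chain (h : IsCylindricAlgebra n D) (hij : i ≠ j) (hki : k ≠ i) (hkj : k ≠ j)
    (x : D) : subst i j (subst k i x) = subst i j (subst k j x) := by
  rw [subst_of_ne hij, subst_of_ne hij]
  congr 1
  have key : ∀ i j : Fin n, k ≠ i → k ≠ j →
      (diag i j ⊓ subst k i x : D) ≤ diag i j ⊓ subst k j x := by
    intro i j hki hkj
    refine le_inf inf_le_left ?_
    rw [subst_of_ne hki, inf_comm, ← h.cyl_inf_of_closed _ (h.diag_closed hki hkj),
      subst_of_ne hkj]
    refine h.cyl_mono k (le_inf ?_ (inf_le_left.trans inf_le_right))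
    exact (le_inf (inf_le_left.trans inf_le_left) inf_le_right).trans (h.diag_trans_le k i j)
  refine le_antisymm (key i j hki hkj) ?_
  rw [h.diag_comm i j]
  exact key j i hkj hki

theorem subst_subst_cancel (h : IsCylindricAlgebra n D) (hij : i ≠ j) (hx : cyl j x = x) :
    subst j i (subst i j x) = x := by
  refine h.subst_eq_of hij.symm hx ?_
  rw [h.diag_comm, h.diag_inf_subst]

theorem subst_comm (h : IsCylindricAlgebra n D) (hik : i ≠ k) (hil : i ≠ l) (hjk : j ≠ k)
    (x : D) : subst i j (subst k l x) = subst k l (subst i j x) := by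
  by_cases hij : i = j
  · rw [hij, subst_self, subst_self]
  by_cases hkl : k = l
  · rw [hkl, subst_self, subst_self]
  rw [subst_of_ne hij, subst_of_ne hkl, subst_of_ne hkl, subst_of_ne hij]
  rw [inf_comm (diag i j), ← h.cyl_inf_of_closed _ (h.diag_closed hik.symm hjk.symm),
    inf_comm (diag k l) (cyl i _), ← h.cyl_inf_of_closed _ (h.diag_closed hik hil), h.cyl_comm]
  congr 2
  ac_rfl

end IsCylindricAlgebra

end Substitution

/-! ## Two-dimensional elements on arbitrary pairs of indices -/

section Edge

variable {n : ℕ} {D : Type u} [BooleanAlgebra D] [CylSig n D]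

/-- An element which depends on the indices `p` and `q` only, and is equal to its converse formed
with the spare index `s`. -/
structure IsSymEdge (p q s : Fin n) (x : D) : Prop where
  closed : ∀ k, k ≠ p → k ≠ q → cyl k x = x
  conv : subst s p (subst p q (subst q s x)) = x

/-- The copy on the indices `k`, `l` of an element `x` which lives on the indices `p`, `q`. -/
def edge (p q k l : Fin n) (x : D) : D :=
  if l = p then subst q k x else subst p k (subst q l x)

namespace IsSymEdge

variable {p q s i j k l a : Fin n} {x y z : D}

theorem subst_fst (h : IsCylindricAlgebra n D) (hpq : p ≠ q) (hps : p ≠ s) (hqs : q ≠ s)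
    (hx : IsSymEdge p q s x) (hlp : l ≠ p) (hlq : l ≠ q) :
    subst p l x = subst p q (subst q l x) := by
  have h1 : subst p s x = subst p q (subst q s x) := by
    conv_lhs => rw [← hx.conv]
    exact h.subst_subst_cancel hps.symm (h.cyl_subst_self hpq _)
  by_cases hls : l = s
  · rw [hls, h1]
  have hs := hx.closed s hps.symm hqs.symm
  rw [← h.subst_of_closed (i := s) l (h.subst_closed hps.symm (Ne.symm hls) hs),
    ← h.subst_subst_chain (Ne.symm hls) hps hlp.symm, h1,
    h.subst_comm hps.symm hqs.symm hlp, h.subst_subst_chain (Ne.symm hls) hqs hlq.symm,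
    h.subst_of_closed (i := s) l (h.subst_closed hqs.symm (Ne.symm hls) hs)]

theorem subst_snd (h : IsCylindricAlgebra n D) (hpq : p ≠ q) (hps : p ≠ s) (hqs : q ≠ s)
    (hx : IsSymEdge p q s x) (hlp : l ≠ p) (hlq : l ≠ q) :
    subst q l x = subst q p (subst p l x) := by
  rw [hx.subst_fst h hpq hps hqs hlp hlq]
  exact (h.subst_subst_cancel hpq (h.cyl_subst_self hlq.symm _)).symm

theorem edge_symm (h : IsCylindricAlgebra n D) (hpq : p ≠ q) (hps : p ≠ s) (hqs : q ≠ s)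
    (hx : IsSymEdge p q s x) (hkl : k ≠ l) : edge p q k l x = edge p q l k x := by
  simp only [edge]
  by_cases hlp : l = p
  · subst hlp
    rw [if_pos rfl, if_neg hkl, IsCylindricAlgebra.subst_self]
  by_cases hkp : k = p
  · subst hkp
    rw [if_pos rfl, if_neg hlp, IsCylindricAlgebra.subst_self]
  rw [if_neg hlp, if_neg hkp]
  by_cases hkq : k = q
  · subst hkq
    rw [IsCylindricAlgebra.subst_self]
    exact (hx.subst_fst h hpq hps hqs hlp hkl.symm).symm
  by_cases hlq : l = q
  · subst hlq
    rw [IsCylindricAlgebra.subst_self]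
    exact hx.subst_fst h hpq hps hqs hkp hkl
  rw [h.subst_comm hpq (Ne.symm hlp) hkq, hx.subst_fst h hpq hps hqs hkp hkq,
    h.subst_subst_chain (Ne.symm hlq) hpq (Ne.symm hlp),
    h.subst_of_closed (i := q) l (h.subst_closed hpq.symm (Ne.symm hlq)
      (h.cyl_subst_self (Ne.symm hkq) _))]

theorem edge_closed (h : IsCylindricAlgebra n D)
    (hx : IsSymEdge p q s x) (hik : i ≠ k) (hil : i ≠ l) :
    cyl i (edge p q k l x) = edge p q k l x := by
  rw [edge]
  split_ifs with hlp
  · subst hlp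
    by_cases hiq : i = q
    · subst hiq; exact h.cyl_subst_self hik _
    · exact h.subst_closed hiq hik (hx.closed i hil hiq)
  · by_cases hip : i = p
    · subst hip; exact h.cyl_subst_self hik _
    · refine h.subst_closed hip hik ?_
      by_cases hiq : i = q
      · subst hiq; exact h.cyl_subst_self hil _
      · exact h.subst_closed hiq hil (hx.closed i hip hiq)

theorem subst_edge (h : IsCylindricAlgebra n D) (hpq : p ≠ q) (hps : p ≠ s) (hqs : q ≠ s)
    (hx : IsSymEdge p q s x) (hai : a ≠ i) (haj : a ≠ j) (hij : i ≠ j) :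
    subst i j (edge p q a i x) = edge p q a j x := by
  have S : ∀ (i : Fin n) (x : D), subst i i x = x := IsCylindricAlgebra.subst_self
  by_cases hap : a = p
  · subst hap
    rw [edge, if_neg hai.symm, S, edge, if_neg haj.symm, S]
    by_cases hiq : i = q
    · subst hiq
      rw [S]
    by_cases hjq : j = q
    · subst hjq
      rw [S]
      exact h.subst_subst_cancel (Ne.symm hij) (hx.closed i hai.symm hiq)
    · rw [h.subst_subst_chain hij (Ne.symm hiq) (Ne.symm hjq)]
      exact h.subst_of_closed _ (h.subst_closed hiq hij (hx.closed i hai.symm hiq))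
  by_cases haq : a = q
  · subst haq
    have e1 : ∀ l, a ≠ l → edge p a a l x = subst p l x := by
      intro l hl
      by_cases hlp : l = p
      · subst hlp
        rw [edge, if_pos rfl, S, S]
      · rw [edge, if_neg hlp, hx.subst_fst h hpq hps hqs hlp hl.symm]
    rw [e1 i hai, e1 j haj]
    by_cases hip : i = p
    · subst hip
      rw [S]
    by_cases hjp : j = p
    · subst hjp
      rw [S]
      exact h.subst_subst_cancel (Ne.symm hij) (hx.closed i hip hai.symm)
    · rw [h.subst_subst_chain hij (Ne.symm hip) (Ne.symm hjp)]
      exact h.subst_of_closed _ (h.subst_closed hip hij (hx.closed i hip hai.symm))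
  by_cases hip : i = p
  · subst hip
    rw [hx.edge_symm h hpq hps hqs haj, edge, if_pos rfl, edge, if_neg hap]
  by_cases hiq : i = q
  · subst hiq
    rw [edge, if_neg hip, S]
    by_cases hjp : j = p
    · subst hjp
      rw [edge, if_pos rfl]
      exact (hx.subst_snd h hpq hps hqs hap haq).symm
    · rw [edge, if_neg hjp]
      exact (h.subst_comm hpq (Ne.symm hjp) haq x).symm
  rw [edge, if_neg hip]
  have hc : cyl i (subst q a x) = subst q a x :=
    h.subst_closed hiq hai.symm (hx.closed i hip hiq)
  by_cases hjp : j = p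
  · subst hjp
    rw [← show edge j q a i x = subst j a (subst q i x) from if_neg hip,
      hx.edge_symm h hpq hps hqs hai, edge, if_neg hap, edge, if_pos rfl]
    exact h.subst_subst_cancel hij.symm hc
  by_cases hjq : j = q
  · subst hjq
    rw [edge, if_neg hjp, S, h.subst_comm hip hai.symm hjp,
      h.subst_subst_cancel (Ne.symm hij) (hx.closed i hip hiq)]
  · rw [edge, if_neg hjp, h.subst_comm hip hai.symm hjp,
      h.subst_subst_chain hij (Ne.symm hiq) (Ne.symm hjq),
      h.subst_of_closed _ (h.subst_closed hiq hij (hx.closed i hip hiq))]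

end IsSymEdge

theorem edge_self (p q : Fin n) (hpq : p ≠ q) (x : D) : edge p q p q x = x := by
  rw [edge, if_neg hpq.symm, IsCylindricAlgebra.subst_self, IsCylindricAlgebra.subst_self]

theorem edge_sup (h : IsCylindricAlgebra n D) (p q k l : Fin n) (x y : D) :
    edge p q k l (x ⊔ y) = edge p q k l x ⊔ edge p q k l y := by
  simp only [edge, h.subst_sup]
  split_ifs <;> rfl

theorem edge_top (h : IsCylindricAlgebra n D) (p q k l : Fin n) :
    edge p q k l (⊤ : D) = ⊤ := by
  simp only [edge, h.subst_top, ite_self]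

theorem edge_bot (h : IsCylindricAlgebra n D) (p q k l : Fin n) :
    edge p q k l (⊥ : D) = ⊥ := by
  simp only [edge, h.subst_bot, ite_self]

theorem edge_mono (h : IsCylindricAlgebra n D) (p q k l : Fin n) {x y : D} (hxy : x ≤ y) :
    edge p q k l x ≤ edge p q k l y := by
  rw [← sup_eq_right.2 hxy, edge_sup h]
  exact le_sup_left

/-- A property of triples of distinct indices that is preserved by moving one index to a fresh
place holds of all of them as soon as it holds of one. -/
theorem forall_triple_of_move (hn : 8 ≤ n) {Pr : Fin n → Fin n → Fin n → Prop}
    (h1 : ∀ k l m j, j ≠ k → j ≠ l → j ≠ m → Pr k l m → Pr j l m)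
    (h2 : ∀ k l m j, j ≠ k → j ≠ l → j ≠ m → Pr k l m → Pr k j m)
    (h3 : ∀ k l m j, j ≠ k → j ≠ l → j ≠ m → Pr k l m → Pr k l j)
    {p s q : Fin n} (h0 : Pr p s q) {k l m : Fin n} (hkl : k ≠ l) (hkm : k ≠ m) (hlm : l ≠ m) :
    Pr k l m := by
  have fresh : ∀ t : Finset (Fin n), t.card < 8 → ∃ a, a ∉ t := by
    intro t ht
    by_contra hc
    push Not at hc
    have : t = Finset.univ := Finset.eq_univ_iff_forall.2 hc
    rw [this, Finset.card_univ, Fintype.card_fin] at ht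
    omega
  obtain ⟨a, ha⟩ := fresh {p, s, q, k, l, m} (Finset.card_le_six.trans_lt (by norm_num))
  obtain ⟨b, hb⟩ := fresh (insert a {p, s, q, k, l, m})
    ((Finset.card_insert_le _ _).trans_lt
      (Nat.lt_of_le_of_lt (Nat.succ_le_succ Finset.card_le_six) (by norm_num)))
  simp only [Finset.mem_insert, Finset.mem_singleton, not_or] at ha hb
  obtain ⟨ap, as, aq, ak, al, am⟩ := ha
  obtain ⟨ba, bp, bs, bq, bk, bl, bm⟩ := hb
  have g1 := h1 _ _ _ a ap as aq h0
  have g2 := h2 _ _ _ b ba bs bq g1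
  have g3 : Pr a b m := by
    by_cases hmq : m = q
    · rw [hmq]; exact g2
    · exact h3 _ _ _ m (Ne.symm am) (Ne.symm bm) hmq g2
  exact h2 _ _ _ l hkl.symm (Ne.symm bl) hlm (h1 _ _ _ k (Ne.symm ak) (Ne.symm bk) hkm g3)

theorem edge_triangle_eq_bot (h : IsCylindricAlgebra n D) (hn : 8 ≤ n) {p q s : Fin n}
    (hpq : p ≠ q) (hps : p ≠ s) (hqs : q ≠ s) {x y z : D} (hx : IsSymEdge p q s x)
    (hy : IsSymEdge p q s y) (hz : IsSymEdge p q s z)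
    (h0 : edge p q p s x ⊓ edge p q s q y ⊓ z = ⊥) {k l m : Fin n} (hkl : k ≠ l) (hkm : k ≠ m)
    (hlm : l ≠ m) : edge p q k l x ⊓ edge p q l m y ⊓ edge p q k m z = ⊥ := by
  have move : ∀ {x : D}, IsSymEdge p q s x → ∀ {a i j}, a ≠ i → a ≠ j → i ≠ j →
      subst i j (edge p q i a x) = edge p q j a x := fun hx a i j hai haj hij => by
    rw [hx.edge_symm h hpq hps hqs hai.symm, hx.subst_edge h hpq hps hqs hai haj hij,
      hx.edge_symm h hpq hps hqs haj]
  refine (forall_triple_of_move hn (Pr := fun k l m => (k ≠ l ∧ k ≠ m ∧ l ≠ m) ∧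
    edge p q k l x ⊓ edge p q l m y ⊓ edge p q k m z = ⊥) ?_ ?_ ?_
    ⟨⟨hps, hpq, hqs.symm⟩, (edge_self p q hpq z).symm ▸ h0⟩ hkl hkm hlm).2
  · rintro k l m j jk jl jm ⟨⟨kl, km, lm⟩, hb⟩
    refine ⟨⟨jl, jm, lm⟩, ?_⟩
    rw [← h.subst_bot k j, ← hb, h.subst_inf, h.subst_inf, move hx kl.symm jl.symm jk.symm,
      move hz km.symm jm.symm jk.symm, h.subst_of_closed j (hy.edge_closed h kl km)]
  · rintro k l m j jk jl jm ⟨⟨kl, km, lm⟩, hb⟩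
    refine ⟨⟨jk.symm, km, jm⟩, ?_⟩
    rw [← h.subst_bot l j, ← hb, h.subst_inf, h.subst_inf,
      hx.subst_edge h hpq hps hqs kl jk.symm jl.symm, move hy lm.symm jm.symm jl.symm,
      h.subst_of_closed j (hz.edge_closed h kl.symm lm)]
  · rintro k l m j jk jl jm ⟨⟨kl, km, lm⟩, hb⟩
    refine ⟨⟨kl, jk.symm, jl.symm⟩, ?_⟩
    rw [← h.subst_bot m j, ← hb, h.subst_inf, h.subst_inf,
      hz.subst_edge h hpq hps hqs km jk.symm jm.symm,
      hy.subst_edge h hpq hps hqs lm jl.symm jm.symm,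
      h.subst_of_closed j (hx.edge_closed h km.symm lm.symm)]

end Edge

/-! ## A Ramsey argument in cylindric algebras -/

section Ramsey

theorem exists_choice_inf_ne_bot {D : Type u} [BooleanAlgebra D] {ι Γ : Type*} [Fintype Γ]
    (T : Finset ι) (Q : ι → Γ → D) {P : D} (hP : P ≠ ⊥) [Nonempty Γ]
    (hQ : ∀ t ∈ T, P ≤ Finset.univ.sup (Q t)) :
    ∃ f : ι → Γ, P ⊓ T.inf (fun t => Q t (f t)) ≠ ⊥ := by
  classical
  induction T using Finset.induction_on with
  | empty => exact ⟨fun _ => Classical.arbitrary Γ, by simpa using hP⟩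
  | insert t T ht ih =>
    obtain ⟨f, hf⟩ := ih fun t' ht' => hQ t' (Finset.mem_insert_of_mem ht')
    obtain ⟨γ, hγ⟩ : ∃ γ, P ⊓ T.inf (fun t => Q t (f t)) ⊓ Q t γ ≠ ⊥ := by
      by_contra hc
      push Not at hc
      refine hf (le_bot_iff.1 ?_)
      have h1 : P ⊓ T.inf (fun t => Q t (f t)) ≤
          P ⊓ T.inf (fun t => Q t (f t)) ⊓ Finset.univ.sup (Q t) :=
        le_inf le_rfl (inf_le_left.trans (hQ t (Finset.mem_insert_self _ _)))
      refine h1.trans ?_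
      rw [Finset.sup_inf_distrib_left]
      exact Finset.sup_le fun γ _ => (hc γ).le
    refine ⟨Function.update f t γ, ?_⟩
    have h2 : T.inf (fun t' => Q t' (Function.update f t γ t')) = T.inf fun t' => Q t' (f t') :=
      Finset.inf_congr rfl fun t' ht' => by
        rw [Function.update_of_ne (fun h : t' = t => ht (h ▸ ht'))]
    rw [Finset.inf_insert, Function.update_self, h2, inf_comm (Q t γ), ← inf_assoc]
    exact hγ

variable {n : ℕ} {D : Type u} [BooleanAlgebra D] [CylSig n D] {Γ : Type v}

/-- A symmetric colouring with values in a cylindric algebra. Each pair of indices carries the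
elements `col γ` for the colours `γ` and the elements `lab t` for the labels `t`, which are
disjoint from each other at adjacent pairs unless these have a common colour. -/
structure IsColoring (z : Fin n) (γ₀ : Γ) [Fintype Γ] (col : Γ → Fin n → Fin n → D)
    (lab : ℕ → Fin n → Fin n → D) : Prop where
  col_closed : ∀ γ i k l, i ≠ k → i ≠ l → cyl i (col γ k l) = col γ k l
  lab_closed : ∀ t i k l, i ≠ k → i ≠ l → cyl i (lab t k l) = lab t k l
  col_subst : ∀ γ i j a, a ≠ i → a ≠ j → i ≠ j → subst i j (col γ a i) = col γ a j
  lab_subst : ∀ t i j a, a ≠ i → a ≠ j → i ≠ j → subst i j (lab t a i) = lab t a j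
  mono : ∀ γ k l m, k ≠ l → k ≠ m → l ≠ m → col γ k l ⊓ col γ l m ⊓ col γ k m = ⊥
  cover : ∀ t t' k l, z ≠ k → z ≠ l → k ≠ l → t ≠ t' →
    lab t z k ⊓ lab t' z l ≤ Finset.univ.sup fun γ => col γ k l
  lab_top : ∀ t l, z ≠ l → cyl l (lab t z l) = ⊤
  lab_le : ∀ t k l, k ≠ l → lab t k l ≤ col γ₀ k l

namespace IsColoring

variable [Fintype Γ] {z : Fin n} {γ₀ : Γ} {col : Γ → Fin n → Fin n → D}
  {lab : ℕ → Fin n → Fin n → D}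

/-- The index `i` sees `z` with the label `t` and each index `a < m` with the colour `c a`. -/
def star (z : Fin n) (col : Γ → Fin n → Fin n → D) (lab : ℕ → Fin n → Fin n → D) (m : ℕ)
    (c : Fin n → Γ) (t : ℕ) (i : Fin n) : D :=
  lab t z i ⊓ (Finset.univ.filter fun a : Fin n => a.val < m).inf fun a => col (c a) a i

theorem _root_.RelCyl.IsCylindricAlgebra.finset_inf_closed (h : IsCylindricAlgebra n D) {ι : Type*}
    (T : Finset ι) (f : ι → D) {k : Fin n} (hf : ∀ t ∈ T, cyl k (f t) = f t) :
    cyl k (T.inf f) = T.inf f := by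
  classical
  induction T using Finset.induction_on with
  | empty => exact h.cyl_top k
  | insert t T ht ih =>
    rw [Finset.inf_insert]
    exact h.closed_inf (hf t (Finset.mem_insert_self _ _))
      (ih fun t ht => hf t (Finset.mem_insert_of_mem ht))

theorem _root_.RelCyl.IsCylindricAlgebra.finset_sup_closed (h : IsCylindricAlgebra n D) {ι : Type*}
    (T : Finset ι) (f : ι → D) {k : Fin n} (hf : ∀ t ∈ T, cyl k (f t) = f t) :
    cyl k (T.sup f) = T.sup f := by
  classical
  induction T using Finset.induction_on with
  | empty => exact h.cyl_bot k
  | insert t T ht ih =>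
    rw [Finset.sup_insert, h.cyl_sup, hf t (Finset.mem_insert_self _ _),
      ih fun t ht => hf t (Finset.mem_insert_of_mem ht)]

theorem _root_.RelCyl.IsCylindricAlgebra.subst_finset_inf (h : IsCylindricAlgebra n D) {ι : Type*}
    (T : Finset ι) (f : ι → D) (i j : Fin n) :
    subst i j (T.inf f) = T.inf fun t => subst i j (f t) := by
  classical
  induction T using Finset.induction_on with
  | empty => exact h.subst_top i j
  | insert t T ht ih => rw [Finset.inf_insert, Finset.inf_insert, h.subst_inf, ih]

theorem star_closed (h : IsCylindricAlgebra n D) (hc : IsColoring z γ₀ col lab) {m : ℕ}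
    {c : Fin n → Γ} {t : ℕ} {i k : Fin n} (hz : z.val < m) (hk : m ≤ k.val) (hki : k ≠ i) :
    cyl k (star z col lab m c t i) = star z col lab m c t i := by
  have aux : ∀ a : Fin n, a.val < m → k ≠ a := fun a ha hka => by subst hka; omega
  refine h.closed_inf (hc.lab_closed _ _ _ _ (aux z hz) hki) (h.finset_inf_closed _ _ ?_)
  exact fun a ha => hc.col_closed _ _ _ _ (aux a (Finset.mem_filter.1 ha).2) hki

theorem subst_star (h : IsCylindricAlgebra n D) (hc : IsColoring z γ₀ col lab) {m : ℕ}
    {c : Fin n → Γ} {t : ℕ} {i j : Fin n} (hz : z.val < m) (hi : m ≤ i.val) (hj : m ≤ j.val)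
    (hij : i ≠ j) : subst i j (star z col lab m c t i) = star z col lab m c t j := by
  have aux : ∀ a k : Fin n, a.val < m → m ≤ k.val → a ≠ k := fun a k ha hk hak => by
    subst hak; omega
  rw [star, h.subst_inf, h.subst_finset_inf, hc.lab_subst _ _ _ _ (aux z i hz hi) (aux z j hz hj) hij]
  refine congrArg₂ _ rfl (Finset.inf_congr rfl fun a ha => ?_)
  have ha := (Finset.mem_filter.1 ha).2
  exact hc.col_subst _ _ _ _ (aux a i ha hi) (aux a j ha hj) hij

theorem cyl_star (h : IsCylindricAlgebra n D) (hc : IsColoring z γ₀ col lab) {m : ℕ}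
    {c : Fin n → Γ} {t : ℕ} {i j : Fin n} (hz : z.val < m) (hi : m ≤ i.val) (hj : m ≤ j.val) :
    cyl i (star z col lab m c t i) = cyl j (star z col lab m c t j) := by
  have key : ∀ i j : Fin n, m ≤ i.val → m ≤ j.val → i ≠ j →
      cyl i (star z col lab m c t i) ≤ cyl j (star z col lab m c t j) := by
    intro i j hi hj hij
    rw [h.cyl_le_iff (h.closed_cyl _ (hc.star_closed h hz hi hij))]
    rw [← hc.subst_star h hz hj hi hij.symm, IsCylindricAlgebra.subst_of_ne hij.symm]
    exact h.cyl_mono j inf_le_right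
  by_cases hij : i = j
  · rw [hij]
  · exact le_antisymm (key i j hi hj hij) (key j i hj hi (Ne.symm hij))

theorem exists_homogeneous (h : IsCylindricAlgebra n D) [Nontrivial D]
    (hc : IsColoring z γ₀ col lab) (hz : z.val = 0) {w : Fin n} (hw : w.val + 1 = n) (m : ℕ)
    (hm1 : 1 ≤ m) (hmn : m + 1 ≤ n) (K : ℕ) :
    ∃ (P : D) (c : Fin n → Γ) (T : Finset ℕ), P ≠ ⊥ ∧ K ≤ T.card ∧
      (∀ l : Fin n, m ≤ l.val → cyl l P = P) ∧
      (∀ a b : Fin n, a.val < b.val → b.val < m → P ≤ col (c a) a b) ∧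
      ∀ t ∈ T, P ≤ cyl w (star z col lab m c t w) := by
  classical
  have : Nonempty Γ := ⟨γ₀⟩
  induction m, hm1 using Nat.le_induction generalizing K with
  | base =>
    refine ⟨⊤, fun _ => γ₀, Finset.range K, top_ne_bot, by simp, fun l _ => h.cyl_top l,
      fun a b hab hb => by omega, fun t _ => ?_⟩
    have hzw : z ≠ w := fun h => by subst h; omega
    have : star z col lab 1 (fun _ => γ₀) t w = lab t z w := by
      refine inf_eq_left.2 (Finset.le_inf fun a ha => ?_)
      have ha := (Finset.mem_filter.1 ha).2
      have : a = z := Fin.ext (by omega)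
      rw [this]
      exact hc.lab_le _ _ _ hzw
    rw [this, hc.lab_top _ _ hzw]
  | succ m hm1 ih =>
    obtain ⟨P, c, T, hP, hT, hcl, hcol, hstar⟩ := ih (by omega) (Fintype.card Γ * K + 1)
    have hzm : z.val < m := by omega
    let p : Fin n := ⟨m, by omega⟩
    have hpw : p ≠ w := Fin.ne_of_val_ne (by simp only [p]; omega)
    have hzp : z ≠ p := Fin.ne_of_val_ne (by simp only [p]; omega)
    have hzw : z ≠ w := Fin.ne_of_val_ne (by omega)
    have hmw : m ≤ w.val := by omega
    obtain ⟨t₀, ht₀⟩ : T.Nonempty := Finset.card_pos.1 (by omega)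
    have hP' : P ⊓ star z col lab m c t₀ p ≠ ⊥ := by
      intro hb
      have h1 : cyl p (P ⊓ star z col lab m c t₀ p) = P := by
        rw [inf_comm, h.cyl_inf_of_closed _ (hcl p le_rfl), hc.cyl_star h hzm le_rfl hmw]
        exact inf_eq_right.2 (hstar t₀ ht₀)
      rw [hb, h.cyl_bot] at h1
      exact hP h1.symm
    have hclw : ∀ l : Fin n, m + 1 ≤ l.val → cyl l (P ⊓ star z col lab m c t₀ p) =
        P ⊓ star z col lab m c t₀ p := fun l hl =>
      h.closed_inf (hcl l (by omega)) (hc.star_closed h hzm (by omega)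
        (Fin.ne_of_val_ne (by simp only [p]; omega)))
    obtain ⟨f, hf⟩ := exists_choice_inf_ne_bot (T.erase t₀)
      (fun t γ => cyl w (star z col lab m c t w ⊓ col γ p w)) hP' (by
        intro t ht
        obtain ⟨htt, ht⟩ := Finset.mem_erase.1 ht
        have h1 : P ⊓ star z col lab m c t₀ p ≤
            cyl w (star z col lab m c t w ⊓ (P ⊓ star z col lab m c t₀ p)) := by
          rw [h.cyl_inf_of_closed _ (hclw w (by omega))]
          exact le_inf (inf_le_left.trans (hstar t ht)) le_rfl
        refine h1.trans ?_
        rw [h.cyl_le_iff (h.finset_sup_closed _ _ fun γ _ => h.cyl_cyl _ _)]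
        have h2 : star z col lab m c t w ⊓ (P ⊓ star z col lab m c t₀ p) ≤
            star z col lab m c t w ⊓ Finset.univ.sup fun γ => col γ p w :=
          le_inf inf_le_left ((le_inf (inf_le_right.trans (inf_le_right.trans inf_le_left))
            (inf_le_left.trans inf_le_left)).trans (hc.cover t₀ t p w hzp hzw hpw htt.symm))
        refine h2.trans ?_
        rw [Finset.sup_inf_distrib_left]
        exact Finset.sup_mono_fun fun γ _ => h.le_cyl w _)
    obtain ⟨γ, -, hγ⟩ := Finset.exists_le_card_fiber_of_mul_le_card_of_maps_to
      (s := T.erase t₀) (t := Finset.univ) (f := f) (n := K) (fun _ _ => Finset.mem_univ _)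
      Finset.univ_nonempty (by rw [Finset.card_erase_of_mem ht₀, Finset.card_univ]; omega)
    have hcm : ∀ a : Fin n, a.val < m → Function.update c p γ a = c a := fun a ha =>
      Function.update_of_ne (Fin.ne_of_val_ne (by simp only [p]; omega)) _ _
    refine ⟨_, Function.update c p γ, _, hf, hγ, fun l hl => ?_, fun a b hab hb => ?_,
      fun t ht => ?_⟩
    · refine h.closed_inf (hclw l hl) (h.finset_inf_closed _ _ fun t _ => ?_)
      by_cases hlw : l = w
      · rw [hlw, h.cyl_cyl]
      · exact h.closed_cyl w (h.closed_inf (hc.star_closed h hzm (by omega) hlw)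
          (hc.col_closed _ _ _ _ (Fin.ne_of_val_ne (by simp only [p]; omega)) hlw))
    · rw [hcm a (by omega)]
      by_cases hbm : b.val < m
      · exact inf_le_left.trans (inf_le_left.trans (hcol a b hab hbm))
      · obtain rfl : b = p := Fin.ext (by simp only [p]; omega)
        refine inf_le_left.trans (inf_le_right.trans (inf_le_right.trans ?_))
        exact Finset.inf_le (Finset.mem_filter.2 ⟨Finset.mem_univ _, hab⟩)
    · obtain ⟨htT, hft⟩ := Finset.mem_filter.1 ht
      refine inf_le_right.trans ((Finset.inf_le htT).trans (h.cyl_mono w ?_))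
      rw [hft]
      refine le_inf (inf_le_left.trans inf_le_left) (Finset.le_inf fun a ha => ?_)
      have ha := (Finset.mem_filter.1 ha).2
      by_cases ham : a.val < m
      · rw [hcm a ham]
        exact inf_le_left.trans (inf_le_right.trans
          (Finset.inf_le (Finset.mem_filter.2 ⟨Finset.mem_univ _, ham⟩)))
      · obtain rfl : a = p := Fin.ext (by simp only [p]; omega)
        rw [Function.update_self]
        exact inf_le_right

/-- In a nontrivial cylindric algebra of dimension `|Γ| + 2` there is no colouring by `Γ`. -/
theorem card_add_two_ne (h : IsCylindricAlgebra n D) [Nontrivial D]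
    (hc : IsColoring z γ₀ col lab) (hz : z.val = 0) : n ≠ Fintype.card Γ + 2 := by
  intro hn
  let w : Fin n := ⟨n - 1, by omega⟩
  obtain ⟨P, c, T, hP, hT, hcl, hcol, hstar⟩ := hc.exists_homogeneous h hz
    (w := w) (by simp only [w]; omega) (n - 1) (by omega) (by omega) 1
  obtain ⟨t, ht⟩ := Finset.card_pos.1 hT
  have hPw : P ⊓ star z col lab (n - 1) c t w ≠ ⊥ := by
    intro hb
    rw [← hcl w le_rfl, ← h.inf_eq_bot_comm, inf_eq_left.2 (hstar t ht)] at hb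
    exact hP hb
  obtain ⟨a, b, hab, hcab⟩ := Fintype.exists_ne_map_eq_of_card_lt
    (fun a : Fin (n - 1) => c ⟨a.val, by omega⟩) (by rw [Fintype.card_fin]; omega)
  have key : ∀ a b : Fin n, a.val < b.val → b.val < n - 1 → c a = c b → False := by
    intro a b hab hb hcab
    refine hPw (le_bot_iff.1 ?_)
    rw [← hc.mono (c a) a b w (Fin.ne_of_val_ne (by omega))
      (Fin.ne_of_val_ne (by simp only [w]; omega)) (Fin.ne_of_val_ne (by simp only [w]; omega))]
    refine le_inf (le_inf (inf_le_left.trans (hcol a b hab hb)) ?_) ?_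
    · rw [hcab]
      exact inf_le_right.trans (inf_le_right.trans
        (Finset.inf_le (Finset.mem_filter.2 ⟨Finset.mem_univ _, hb⟩)))
    · exact inf_le_right.trans (inf_le_right.trans
        (Finset.inf_le (Finset.mem_filter.2 ⟨Finset.mem_univ _, by omega⟩)))
  rcases Nat.lt_or_gt_of_ne (Fin.val_ne_of_ne hab) with hlt | hlt
  · exact key ⟨a.val, by omega⟩ ⟨b.val, by omega⟩ hlt b.2 hcab
  · exact key ⟨b.val, by omega⟩ ⟨a.val, by omega⟩ hlt a.2 hcab.symm

end IsColoring

end Ramsey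

/-! ## The no 1-cycles algebra and its subalgebra -/

section Blocks

variable {r : ℕ}

theorem exists_fin_notMem {n : ℕ} (t : Finset (Fin n)) (h : t.card < n) : ∃ a, a ∉ t := by
  by_contra hc
  push Not at hc
  rw [Finset.eq_univ_iff_forall.2 hc, Finset.card_univ, Fintype.card_fin] at h
  exact lt_irrefl _ h

theorem isSymCyc_e23 (r : ℕ) : IsSymCyc (e23Structure (r + 3)) 0 where
  conv_eq _ := rfl
  ident_eq := Set.ext fun x => (Fin.ext_iff (b := 0)).symm
  ident_cyc x y := by
    refine ⟨?_, fun h => .inl ⟨rfl, h⟩⟩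
    rintro (⟨-, h⟩ | ⟨h1, h2⟩ | ⟨h1, h2⟩ | ⟨h, -⟩)
    · exact h
    · exact Fin.ext (h1.trans (congrArg Fin.val h2))
    · exact Fin.ext ((congrArg Fin.val h2).symm.trans h1.symm)
    · exact (h rfl).elim
  swap {x y z} := by
    simp only [e23Structure, Fin.ext_iff]
    omega
  rot {x y z} := by
    simp only [e23Structure, Fin.ext_iff]
    omega

theorem e23_cyc {x y z : Fin (r + 3)} (hx : x ≠ 0) (hy : y ≠ 0) (hz : z ≠ 0) :
    (e23Structure (r + 3)).cyc x y z ↔ ¬ (x = y ∧ y = z) := by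
  simp only [e23Structure, ne_eq, Fin.ext_iff, Fin.val_zero] at *
  omega

theorem hasExt_e23 (hr : 4 ≤ r) : HasExt (e23Structure (r + 3)) 0 2 := by
  intro L hL hne
  obtain ⟨w, hw⟩ := exists_fin_notMem (insert 0 (L.image Prod.fst)) (by
    have h1 := Finset.card_insert_le (0 : Fin (r + 3)) (L.image Prod.fst)
    have h2 : (L.image Prod.fst).card ≤ L.card := Finset.card_image_le
    omega)
  simp only [Finset.mem_insert, not_or] at hw
  refine ⟨w, fun p hp => (e23_cyc (hne p hp).1 (hne p hp).2 hw.1).2 ?_⟩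
  rintro ⟨h1, h2⟩
  exact hw.2 (Finset.mem_image.2 ⟨p, hp, h1.trans h2⟩)

theorem isFiniteSymmetricIntegralRA_e23 (hr : 4 ≤ r) :
    IsFiniteSymmetricIntegralRA (E23 (r + 3)) where
  finite := inferInstanceAs (Finite (Set (Fin (r + 3))))
  relationAlgebra := (isSymCyc_e23 r).isRelationAlgebra (hasExt_e23 hr)
  symmetric := (isSymCyc_e23 r).conv_id
  integral := (isSymCyc_e23 r).isIntegral ((hasExt_e23 hr).mono (by norm_num))

/-- The index of the block to which an atom belongs. -/
def block (v : Fin (r + 3)) : ℕ := if v.val ≤ 6 then (v.val + 1) / 2 else v.val - 3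

theorem block_lt (hr : 4 ≤ r) (v : Fin (r + 3)) : block v < r := by
  rw [block]; split_ifs <;> omega

theorem block_eq_zero {v : Fin (r + 3)} : block v = 0 ↔ v = 0 := by
  rw [block, Fin.ext_iff, Fin.val_zero]; split_ifs <;> omega

theorem mem_blockAtom {k : ℕ} {v : Fin (r + 3)} : v ∈ blockAtom (r + 3) k ↔ block v = k := by
  have h : ∀ j, v ∈ eAtom (r + 3) j ↔ v.val = j := fun j => Iff.rfl
  rcases k with _ | _ | _ | _ | k <;> simp only [blockAtom, Cm.mem_sup, h, block] <;>
    split_ifs <;> omega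

theorem exists_block_eq {k : ℕ} (hk : k < r) : ∃ v : Fin (r + 3), block v = k := by
  by_cases h : k ≤ 3
  · exact ⟨⟨2 * k - 1, by omega⟩, by simp only [block]; split_ifs <;> omega⟩
  · exact ⟨⟨k + 3, by omega⟩, by simp only [block]; split_ifs <;> omega⟩

theorem exists_block_eq_ne (hr : 4 ≤ r) {k : ℕ} (h1 : 1 ≤ k) (h3 : k ≤ 3) (u : Fin (r + 3)) :
    ∃ v : Fin (r + 3), block v = k ∧ v ≠ u := by
  by_cases h : u.val = 2 * k
  · exact ⟨⟨2 * k - 1, by omega⟩, by simp only [block]; split_ifs <;> omega,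
      Fin.ne_of_val_ne (by simp only; omega)⟩
  · exact ⟨⟨2 * k, by omega⟩, by simp only [block]; split_ifs <;> omega,
      Fin.ne_of_val_ne (by simp only; omega)⟩

theorem block_injOn {u v : Fin (r + 3)} (h : block u = block v) (h3 : 4 ≤ block u) : u = v := by
  rw [Fin.ext_iff]
  revert h h3
  simp only [block]
  split_ifs <;> omega

/-- The subalgebra of unions of blocks. -/
def blockSubalgebra (_hr : 4 ≤ r) : RelSubalgebra (E23 (r + 3)) where
  carrier := {P | ∀ u v : Fin (r + 3), block u = block v → u ∈ P → v ∈ P}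
  supClosed' P hP Q hQ u v huv := Or.imp (hP u v huv) (hQ u v huv)
  infClosed' P hP Q hQ u v huv := And.imp (hP u v huv) (hQ u v huv)
  compl_mem' {P} hP u v huv hu hv := hu (hP v u huv.symm hv)
  bot_mem' u v _ h := h
  comp_mem' {P Q} hP hQ u v huv := by
    rintro ⟨x, hx, y, hy, hc⟩
    have hS := isSymCyc_e23 r
    by_cases hu : u = 0
    · have hv : v = 0 := by rw [← block_eq_zero, ← huv, block_eq_zero, hu]
      rw [hv, ← hu]
      exact ⟨x, hx, y, hy, hc⟩
    have hv : v ≠ 0 := fun hv => hu (by rw [← block_eq_zero, huv, block_eq_zero, hv])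
    by_cases hx0 : x = 0
    · subst hx0
      obtain rfl := (hS.ident_cyc _ _).1 hc
      exact ⟨0, hx, v, hQ _ _ huv hy, (hS.ident_cyc _ _).2 rfl⟩
    by_cases hy0 : y = 0
    · subst hy0
      obtain rfl := (hS.cyc_ident _ _).1 hc
      exact ⟨v, hP _ _ huv hx, 0, hy, (hS.cyc_ident _ _).2 rfl⟩
    by_cases hxyv : x = y ∧ y = v
    · obtain ⟨rfl, rfl⟩ := hxyv
      rw [e23_cyc hx0 hx0 hu] at hc
      refine ⟨u, hP _ _ huv.symm hx, x, hy, (e23_cyc hu hx0 hx0).2 fun h => hc ⟨rfl, h.1.symm⟩⟩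
    · exact ⟨x, hx, y, hy, (e23_cyc hx0 hy0 hv).2 hxyv⟩
  conv_mem' {P} hP := by
    rw [(isSymCyc_e23 r).conv_id P]
    exact hP
  ident_mem' u v huv hu := by
    have hu : u = 0 := (isSymCyc_e23 r).mem_ident.1 hu
    exact (isSymCyc_e23 r).mem_ident.2 (by rw [← block_eq_zero, ← huv, block_eq_zero, hu])

theorem blockAtom_mem (hr : 4 ≤ r) (k : ℕ) : blockAtom (r + 3) k ∈ blockSubalgebra hr := by
  intro u v huv hu
  rw [mem_blockAtom] at hu ⊢
  exact huv ▸ hu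

theorem isAtom_blockAtom (hr : 4 ≤ r) {k : ℕ} (hk : k < r) :
    IsAtom (⟨blockAtom (r + 3) k, blockAtom_mem hr k⟩ : blockSubalgebra hr) := by
  refine ⟨fun h => ?_, fun P hP => Subtype.ext ?_⟩
  · obtain ⟨v, hv⟩ := exists_block_eq hk
    have : v ∈ blockAtom (r + 3) k := mem_blockAtom.2 hv
    rw [show blockAtom (r + 3) k = ⊥ from congrArg Subtype.val h] at this
    exact Cm.mem_bot this
  · by_contra hne
    obtain ⟨v, hv⟩ := Cm.ne_bot_iff.1 hne
    have hvk : block v = k := mem_blockAtom.1 (Cm.le_iff.1 hP.le v hv)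
    refine hP.not_ge fun u hu => ?_
    exact P.2 v u (hvk.trans (mem_blockAtom.1 hu).symm) hv

theorem isAtomOf_iff (hr : 4 ≤ r) {P : E23 (r + 3)} :
    (blockSubalgebra hr).IsAtomOf P ↔ ∃ k < r, P = blockAtom (r + 3) k := by
  constructor
  · rintro ⟨hP, hat⟩
    have hne : P ≠ ⊥ := fun h => hat.1 (Subtype.ext h)
    obtain ⟨v, hv⟩ := Cm.ne_bot_iff.1 hne
    refine ⟨block v, block_lt hr v, ?_⟩
    have hle : (⟨blockAtom (r + 3) (block v), blockAtom_mem hr _⟩ : blockSubalgebra hr) ≤ ⟨P, hP⟩ :=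
      fun u hu => hP v u (mem_blockAtom.1 hu).symm hv
    rcases hat.le_iff.1 hle with h | h
    · exact ((isAtom_blockAtom hr (block_lt hr v)).1 h).elim
    · exact (congrArg Subtype.val h).symm
  · rintro ⟨k, hk, rfl⟩
    exact ⟨blockAtom_mem hr k, isAtom_blockAtom hr hk⟩

theorem blockAtom_injOn : Set.InjOn (blockAtom (r + 3)) (Set.Iio r) := by
  intro k hk l _ hkl
  obtain ⟨v, hv⟩ := exists_block_eq hk
  have : v ∈ blockAtom (r + 3) l := hkl ▸ mem_blockAtom.2 hv
  exact hv.symm.trans (mem_blockAtom.1 this)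

theorem bijOn_blockAtom (hr : 4 ≤ r) : Set.BijOn (blockAtom (r + 3)) (Set.Iio r)
    {x | (blockSubalgebra hr).IsAtomOf x} := by
  refine ⟨fun k hk => (isAtomOf_iff hr).2 ⟨k, hk, rfl⟩, blockAtom_injOn, fun P hP => ?_⟩
  obtain ⟨k, hk, rfl⟩ := (isAtomOf_iff hr).1 hP
  exact ⟨k, hk, rfl⟩

theorem mem_ident_compl {v : Fin (r + 3)} : v ∈ (identᶜ : E23 (r + 3)) ↔ v ≠ 0 := by
  rw [Cm.mem_compl, (isSymCyc_e23 r).mem_ident]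

theorem isSpecialExtension_blockSubalgebra (hr : 4 ≤ r) :
    IsSpecialExtension (blockSubalgebra hr) where
  ambient := isFiniteSymmetricIntegralRA_e23 hr
  sub := (isFiniteSymmetricIntegralRA_e23 hr).sub _
  split a b c ha hb hc ha0 hb0 hc0 hne _ x y hx hy hxa hyb z hz := by
    obtain ⟨u, rfl⟩ := Cm.isAtom_iff.1 hx
    obtain ⟨v, rfl⟩ := Cm.isAtom_iff.1 hy
    obtain ⟨i, hi, rfl⟩ := (isAtomOf_iff hr).1 ha
    obtain ⟨j, hj, rfl⟩ := (isAtomOf_iff hr).1 hb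
    obtain ⟨k, hk, rfl⟩ := (isAtomOf_iff hr).1 hc
    rw [Cm.sing_le] at hxa hyb
    refine ⟨u, rfl, v, rfl, (e23_cyc (mem_ident_compl.1 (Cm.le_iff.1 ha0 _ hxa))
      (mem_ident_compl.1 (Cm.le_iff.1 hb0 _ hyb)) (mem_ident_compl.1 (Cm.le_iff.1 hc0 _ hz))).2 ?_⟩
    rintro ⟨rfl, rfl⟩
    rw [mem_blockAtom] at hxa hyb
    replace hz := mem_blockAtom.1 hz
    exact hne ⟨by rw [← hxa, ← hyb], by rw [← hz, ← hyb]⟩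
  thin a ha ha0 haa x y hx hy hxa hya := by
    obtain ⟨u, rfl⟩ := Cm.isAtom_iff.1 hx
    obtain ⟨v, rfl⟩ := Cm.isAtom_iff.1 hy
    rw [Cm.sing_le] at hxa hya
    have h0 : ∀ w, w ∈ a → w ≠ 0 := fun w hw => mem_ident_compl.1 (Cm.le_iff.1 ha0 _ hw)
    rw [Cm.ne_bot_iff]
    suffices h : ∃ w ∈ a, ¬ (u = v ∧ v = w) by
      obtain ⟨w, hw, hne⟩ := h
      exact ⟨w, ⟨u, rfl, v, rfl, (e23_cyc (h0 _ hxa) (h0 _ hya) (h0 _ hw)).2 hne⟩, hw⟩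
    obtain ⟨s, hs, t, ht, hst⟩ := Cm.le_iff.1 haa u hxa
    rw [e23_cyc (h0 _ hs) (h0 _ ht) (h0 _ hxa)] at hst
    by_contra hc
    push Not at hc
    exact hst ⟨(hc s hs).2.symm.trans (hc t ht).2, (hc t ht).2.symm.trans (hc u hxa).2⟩

theorem comp_blockAtom_of_ne {k l : ℕ} (hk : 1 ≤ k) (hl : 1 ≤ l) (hkr : k < r) (hlr : l < r)
    (hkl : k ≠ l) : comp (blockAtom (r + 3) k) (blockAtom (r + 3) l) = (identᶜ : E23 (r + 3)) := by
  have h0 : ∀ {k : ℕ} {v : Fin (r + 3)}, 1 ≤ k → block v = k → v ≠ 0 := fun hk hv h => by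
    rw [← block_eq_zero] at h; omega
  refine Cm.ext fun z => ?_
  rw [mem_ident_compl, Cm.mem_comp]
  constructor
  · rintro ⟨x, hx, y, hy, hc⟩ rfl
    rw [(isSymCyc_e23 r).cyc_to_ident] at hc
    rw [mem_blockAtom] at hx hy
    exact hkl (by rw [← hx, ← hy, hc])
  · intro hz
    obtain ⟨u, hu⟩ := exists_block_eq hkr
    obtain ⟨v, hv⟩ := exists_block_eq hlr
    refine ⟨u, mem_blockAtom.2 hu, v, mem_blockAtom.2 hv, (e23_cyc (h0 hk hu) (h0 hl hv) hz).2 ?_⟩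
    rintro ⟨rfl, -⟩
    exact hkl (hu.symm.trans hv)

theorem comp_blockAtom_self (hr : 4 ≤ r) {k : ℕ} (hk : 1 ≤ k) (hk3 : k ≤ 3) :
    comp (blockAtom (r + 3) k) (blockAtom (r + 3) k) = (⊤ : E23 (r + 3)) := by
  have h0 : ∀ {v : Fin (r + 3)}, block v = k → v ≠ 0 := fun hv h => by
    rw [← block_eq_zero] at h; omega
  refine Cm.ext fun z => ?_
  simp only [Cm.mem_top, iff_true]
  obtain ⟨u, hu⟩ := exists_block_eq (r := r) (k := k) (by omega)
  by_cases hz : z = 0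
  · exact ⟨u, mem_blockAtom.2 hu, u, mem_blockAtom.2 hu,
      hz ▸ ((isSymCyc_e23 r).cyc_to_ident u u).2 rfl⟩
  · obtain ⟨v, hv, hvu⟩ := exists_block_eq_ne hr hk hk3 u
    exact ⟨u, mem_blockAtom.2 hu, v, mem_blockAtom.2 hv,
      (e23_cyc (h0 hu) (h0 hv) hz).2 fun h => hvu h.1.symm⟩

theorem isFlexibleTrio_blockAtom (hr : 4 ≤ r) :
    IsFlexibleTrio (⟨blockAtom (r + 3) 1, blockAtom_mem hr 1⟩ : blockSubalgebra hr)
      ⟨blockAtom (r + 3) 2, blockAtom_mem hr 2⟩ ⟨blockAtom (r + 3) 3, blockAtom_mem hr 3⟩ := by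
  have hle : ∀ k, 1 ≤ k → blockAtom (r + 3) k ≤ (identᶜ : E23 (r + 3)) := fun k hk v hv => by
    refine mem_ident_compl.2 ?_
    rw [ne_eq, ← block_eq_zero, mem_blockAtom.1 hv]
    omega
  refine ⟨isAtom_blockAtom hr (by omega), isAtom_blockAtom hr (by omega),
    isAtom_blockAtom hr (by omega), hle 1 (by omega), hle 2 (by omega), hle 3 (by omega),
    Subtype.ext (comp_blockAtom_self hr (k := 1) (by omega) (by omega)),
    Subtype.ext (comp_blockAtom_self hr (k := 2) (by omega) (by omega)),
    Subtype.ext (comp_blockAtom_self hr (k := 3) (by omega) (by omega)),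
    Subtype.ext (comp_blockAtom_of_ne (k := 1) (l := 2) (by omega) (by omega) (by omega) (by omega) (by omega)),
    Subtype.ext (comp_blockAtom_of_ne (k := 1) (l := 3) (by omega) (by omega) (by omega) (by omega) (by omega)),
    Subtype.ext (comp_blockAtom_of_ne (k := 2) (l := 3) (by omega) (by omega) (by omega) (by omega) (by omega)), ?_⟩
  rintro ⟨x, hxE⟩ hx hx0 hx1 hx2 -
  obtain ⟨k, hk, rfl⟩ := (isAtomOf_iff hr).1 ⟨hxE, hx⟩
  have h0 : k ≠ 0 := by
    rintro rfl
    refine hx0 (Subtype.ext (Cm.ext fun v => ?_))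
    rw [mem_blockAtom, block_eq_zero]
    exact (isSymCyc_e23 r).mem_ident.symm
  have h1 : k ≠ 1 := by rintro rfl; exact hx1 rfl
  have h2 : k ≠ 2 := by rintro rfl; exact hx2 rfl
  exact .inl ⟨Subtype.ext (comp_blockAtom_of_ne (by omega) (by omega) hk (by omega) h1),
    Subtype.ext (comp_blockAtom_of_ne (by omega) (by omega) hk (by omega) h2)⟩

end Blocks

/-! ## The atoms of the split algebra -/

section SplitAtoms

variable {r : ℕ}

/-- The diversity atoms of `E23`. -/
abbrev DivAtom (r : ℕ) : Type := {x : E23 (r + 3) // IsAtom x ∧ x ≤ identᶜ}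

/-- The index of a diversity atom of `E23`. -/
noncomputable def DivAtom.idx (x : DivAtom r) : Fin (r + 3) := (Cm.isAtom_iff.1 x.2.1).choose

theorem DivAtom.coe_eq (x : DivAtom r) : x.1 = Cm.sing _ x.idx :=
  (Cm.isAtom_iff.1 x.2.1).choose_spec

theorem DivAtom.idx_ne_zero (x : DivAtom r) : x.idx ≠ 0 := by
  have := x.2.2
  rw [x.coe_eq, Cm.sing_le] at this
  exact mem_ident_compl.1 this

theorem DivAtom.idx_injective : Function.Injective (DivAtom.idx (r := r)) := fun x y h =>
  Subtype.ext (by rw [x.coe_eq, y.coe_eq, h])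

/-- The diversity atom with a given index. -/
def DivAtom.of (v : Fin (r + 3)) (hv : v ≠ 0) : DivAtom r :=
  ⟨Cm.sing _ v, Cm.isAtom_sing v, Cm.sing_le.2 (mem_ident_compl.2 hv)⟩

@[simp] theorem DivAtom.idx_of (v : Fin (r + 3)) (hv : v ≠ 0) : (DivAtom.of v hv).idx = v :=
  Cm.sing_injective ((DivAtom.of v hv).coe_eq.symm)

theorem one_le_block (x : DivAtom r) : 1 ≤ block x.idx := by
  have := block_eq_zero.not.2 x.idx_ne_zero
  omega

theorem exists_divAtom {k : ℕ} (h1 : 1 ≤ k) (hk : k < r) : ∃ x : DivAtom r, block x.idx = k := by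
  obtain ⟨v, hv⟩ := exists_block_eq hk
  have hv0 : v ≠ 0 := fun h => by rw [← block_eq_zero] at h; omega
  exact ⟨DivAtom.of v hv0, by simpa using hv⟩

theorem exists_divAtom_ne (hr : 4 ≤ r) {k : ℕ} (h1 : 1 ≤ k) (h3 : k ≤ 3) (y : DivAtom r) :
    ∃ x : DivAtom r, block x.idx = k ∧ x ≠ y := by
  obtain ⟨v, hv, hne⟩ := exists_block_eq_ne hr h1 h3 y.idx
  have hv0 : v ≠ 0 := fun h => by rw [← block_eq_zero] at h; omega
  exact ⟨DivAtom.of v hv0, by simpa using hv, fun h => hne (by simpa using congrArg DivAtom.idx h)⟩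

theorem block_le_three {x y : DivAtom r} (h : block x.idx = block y.idx) (hne : x ≠ y) :
    block x.idx ≤ 3 := by
  by_contra hc
  exact hne (DivAtom.idx_injective (block_injOn h (by omega)))

theorem DivAtom.le_comp {x y z : DivAtom r} : z.1 ≤ comp x.1 y.1 ↔ ¬ (x = y ∧ y = z) := by
  rw [x.coe_eq, y.coe_eq, z.coe_eq, Cm.sing_le_comp,
    e23_cyc x.idx_ne_zero y.idx_ne_zero z.idx_ne_zero, DivAtom.idx_injective.eq_iff,
    DivAtom.idx_injective.eq_iff]

theorem sameCover_iff (hr : 4 ≤ r) {x y z : DivAtom r} :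
    SameCover (blockSubalgebra hr) x.1 y.1 z.1 ↔
      block x.idx = block y.idx ∧ block y.idx = block z.idx := by
  rw [x.coe_eq, y.coe_eq, z.coe_eq, SameCover]
  simp only [Cm.sing_le, isAtomOf_iff]
  constructor
  · rintro ⟨_, ⟨k, -, rfl⟩, h1, h2, h3⟩
    rw [mem_blockAtom] at h1 h2 h3
    exact ⟨h1.trans h2.symm, h2.trans h3.symm⟩
  · rintro ⟨h1, h2⟩
    exact ⟨_, ⟨_, block_lt hr x.idx, rfl⟩, mem_blockAtom.2 rfl, mem_blockAtom.2 h1.symm,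
      mem_blockAtom.2 (h1.trans h2).symm⟩

/-- The labels of the split algebra. -/
abbrev Split (r : ℕ) : Type := Option (DivAtom r × ℕ)

theorem splitCyc_some (hr : 4 ≤ r) {x y z : DivAtom r} {i j k : ℕ} :
    (splitStructure (blockSubalgebra hr)).cyc (some (x, i)) (some (y, j)) (some (z, k)) ↔
      ¬ (x = y ∧ y = z) ∧
        (block x.idx = block y.idx ∧ block y.idx = block z.idx → Thin i j k) := by
  rw [← DivAtom.le_comp, ← sameCover_iff hr]
  rfl

theorem Thin.swap {i j k : ℕ} (h : Thin i j k) : Thin j i k := by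
  simp only [Thin] at *; omega

theorem Thin.rot {i j k : ℕ} (h : Thin i j k) : Thin i k j := by
  simp only [Thin] at *; omega

theorem isSymCyc_split (hr : 4 ≤ r) :
    IsSymCyc (splitStructure (blockSubalgebra hr)) none where
  conv_eq _ := rfl
  ident_eq := rfl
  ident_cyc _ _ := Iff.rfl
  swap {x y z} h := by
    rcases x with _ | ⟨x, i⟩ <;> rcases y with _ | ⟨y, j⟩ <;> rcases z with _ | ⟨z, k⟩
    any_goals first | exact h | exact Eq.symm h
    rw [splitCyc_some] at h ⊢
    exact ⟨fun ⟨h1, h2⟩ => h.1 ⟨h1.symm, h1.trans h2⟩,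
      fun ⟨h1, h2⟩ => (h.2 ⟨h1.symm, h1.trans h2⟩).swap⟩
  rot {x y z} h := by
    rcases x with _ | ⟨x, i⟩ <;> rcases y with _ | ⟨y, j⟩ <;> rcases z with _ | ⟨z, k⟩
    any_goals first | exact h | exact Eq.symm h | exact (Option.some_injective _ h) | exact congrArg some h
    rw [splitCyc_some] at h ⊢
    exact ⟨fun ⟨h1, h2⟩ => h.1 ⟨h1.trans h2, h2.symm⟩,
      fun ⟨h1, h2⟩ => (h.2 ⟨h1.trans h2, h2.symm⟩).rot⟩

theorem hasExt_split (hr : 4 ≤ r) :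
    HasExt (splitStructure (blockSubalgebra hr)) none (r + 1) := by
  classical
  intro L hL hne
  let touch : ℕ → Finset (Split r × Split r) := fun b => L.filter fun p =>
    ∃ x y : DivAtom r × ℕ, p = (some x, some y) ∧ block x.1.idx = b ∧ block y.1.idx = b
  have hsome : ∀ p ∈ L, ∃ (x : DivAtom r) (i : ℕ) (y : DivAtom r) (j : ℕ),
      p = (some (x, i), some (y, j)) := by
    rintro ⟨_ | ⟨x, i⟩, _ | ⟨y, j⟩⟩ hp
    · exact ((hne _ hp).1 rfl).elim
    · exact ((hne _ hp).1 rfl).elim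
    · exact ((hne _ hp).2 rfl).elim
    · exact ⟨x, i, y, j, rfl⟩
  have hmem : ∀ {x i y j b}, (some (x, i), some (y, j)) ∈ L → block (DivAtom.idx x) = b →
      block (DivAtom.idx y) = b → (some (x, i), some (y, j)) ∈ touch b := by
    intro x i y j b hp hx hy
    exact Finset.mem_filter.2 ⟨hp, _, _, rfl, hx, hy⟩
  by_cases h0 : ∃ b, 1 ≤ b ∧ b < r ∧ touch b = ∅
  · obtain ⟨b, hb1, hbr, hb⟩ := h0
    obtain ⟨z, hz⟩ := exists_divAtom hb1 hbr
    refine ⟨some (z, 0), fun p hp => ?_⟩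
    obtain ⟨x, i, y, j, rfl⟩ := hsome p hp
    have hn : ¬ (block x.idx = block y.idx ∧ block y.idx = block z.idx) := by
      rintro ⟨h1, h2⟩
      have := hmem hp (h1.trans (h2.trans hz)) (h2.trans hz)
      rw [hb] at this
      exact Finset.notMem_empty _ this
    exact (splitCyc_some hr).2 ⟨fun h => hn ⟨by rw [h.1], by rw [h.2]⟩, fun h => (hn h).elim⟩
  by_cases h1 : ∃ b, 1 ≤ b ∧ b ≤ 3 ∧ (touch b).card = 1
  · obtain ⟨b, hb1, hb3, hb⟩ := h1
    obtain ⟨p₀, hp₀⟩ := Finset.card_eq_one.1 hb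
    have hmem₀ : p₀ ∈ touch b := hp₀ ▸ Finset.mem_singleton_self _
    obtain ⟨-, ⟨x₀, i₀⟩, ⟨y₀, j₀⟩, rfl, hx₀, hy₀⟩ := Finset.mem_filter.1 hmem₀
    obtain ⟨z, hz, hzx⟩ := exists_divAtom_ne hr hb1 hb3 x₀
    refine ⟨some (z, max i₀ j₀), fun p hp => ?_⟩
    obtain ⟨x, i, y, j, rfl⟩ := hsome p hp
    have key : block x.idx = block y.idx ∧ block y.idx = block z.idx →
        x = x₀ ∧ i = i₀ ∧ y = y₀ ∧ j = j₀ := by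
      rintro ⟨h1, h2⟩
      have := hmem hp (h1.trans (h2.trans hz)) (h2.trans hz)
      rw [hp₀, Finset.mem_singleton] at this
      simp only [Prod.mk.injEq, Option.some.injEq] at this
      exact ⟨this.1.1, this.1.2, this.2.1, this.2.2⟩
    refine (splitCyc_some hr).2 ⟨fun h => ?_, fun h => ?_⟩
    · have := key ⟨by rw [h.1], by rw [h.2]⟩
      exact hzx (by rw [← h.2, ← h.1, this.1])
    · obtain ⟨-, rfl, -, rfl⟩ := key h
      simp only [Thin]
      omega
  push Not at h0 h1
  have hdisj : ∀ b ∈ Finset.Ico 1 r, ∀ b' ∈ Finset.Ico 1 r, b ≠ b' →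
      Disjoint (touch b) (touch b') := by
    intro b _ b' _ hbb
    refine Finset.disjoint_left.2 fun p hp hp' => hbb ?_
    obtain ⟨-, x, y, rfl, hx, hy⟩ := Finset.mem_filter.1 hp
    obtain ⟨-, x', y', hxy, hx', hy'⟩ := Finset.mem_filter.1 hp'
    simp only [Prod.mk.injEq, Option.some.injEq] at hxy
    rw [← hx, ← hx', hxy.1]
  have hsum : ∑ b ∈ Finset.Ico 1 r, (touch b).card ≤ r + 1 := by
    rw [← Finset.card_biUnion hdisj]
    refine (Finset.card_le_card ?_).trans hL
    exact Finset.biUnion_subset.2 fun b _ => Finset.filter_subset _ _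
  have hlow : ∑ b ∈ Finset.Ico 1 r, (if b ≤ 3 then 2 else 1) ≤
      ∑ b ∈ Finset.Ico 1 r, (touch b).card := by
    refine Finset.sum_le_sum fun b hb => ?_
    obtain ⟨hb1, hbr⟩ := Finset.mem_Ico.1 hb
    have hpos := Finset.card_pos.2 (h0 b hb1 hbr)
    split_ifs with h3
    · have := h1 b hb1 h3
      omega
    · exact hpos
  rw [← Finset.sum_Ico_consecutive _ (show 1 ≤ 4 by norm_num) hr] at hlow
  have e1 : ∑ b ∈ Finset.Ico 1 4, (if b ≤ 3 then 2 else 1) = 6 := by decide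
  have e2 : ∑ b ∈ Finset.Ico 4 r, (if b ≤ 3 then 2 else 1) = r - 4 := by
    rw [Finset.sum_congr rfl fun b hb => if_neg (by have := (Finset.mem_Ico.1 hb).1; omega)]
    simp
  omega

end SplitAtoms

/-! ## Relation algebraic reducts of cylindric algebras of larger dimension -/

section RaEmbedding

variable {n : ℕ} {C : Type v} [BooleanAlgebra C] [RelSig C] {D : Type u} [BooleanAlgebra D]
  [CylSig n D]

/-- An embedding of `C` into the relation algebraic reduct of `D`. -/
structure IsRaEmbedding (hn : 3 ≤ n) (g : C → D) : Prop where
  injective : Function.Injective g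
  closed : ∀ x (k : Fin n), 2 ≤ k.val → cyl k (g x) = g x
  map_sup : ∀ x y, g (x ⊔ y) = g x ⊔ g y
  map_compl : ∀ x, g xᶜ = (g x)ᶜ
  map_comp : ∀ x y, g (comp x y) = raComp hn (g x) (g y)
  map_conv : ∀ x, g (conv x) = raConv hn (g x)
  map_ident : g ident = diag (⟨0, by omega⟩ : Fin n) ⟨1, by omega⟩

theorem IsNeatEmbedding.map_inf {m : ℕ} {hmn : m ≤ n} {B : Type w} [BooleanAlgebra B] [CylSig m B]
    {f : B → D} (hf : IsNeatEmbedding hmn f) (x y : B) : f (x ⊓ y) = f x ⊓ f y := by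
  have h : x ⊓ y = (xᶜ ⊔ yᶜ)ᶜ := by simp
  rw [h, hf.map_compl, hf.map_sup, hf.map_compl, hf.map_compl]
  simp

theorem IsNeatEmbedding.map_subst {m : ℕ} {hmn : m ≤ n} {B : Type w} [BooleanAlgebra B]
    [CylSig m B] {f : B → D} (hf : IsNeatEmbedding hmn f) (i j : Fin m) (x : B) :
    f (subst i j x) = subst (Fin.castLE hmn i) (Fin.castLE hmn j) (f x) := by
  by_cases hij : i = j
  · subst hij
    rw [IsCylindricAlgebra.subst_self, IsCylindricAlgebra.subst_self]
  · rw [IsCylindricAlgebra.subst_of_ne hij, IsCylindricAlgebra.subst_of_ne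
      fun h => hij (Fin.castLE_injective hmn h), hf.map_cyl, hf.map_inf, hf.map_diag]

theorem IsIsoOntoRa.comp_neat {m : ℕ} {hmn : m ≤ n} {B : Type w} [BooleanAlgebra B] [CylSig m B]
    {f : B → D} (hf : IsNeatEmbedding hmn f) {hm : 3 ≤ m} {g : C → B} (hg : IsIsoOntoRa hm g) :
    IsRaEmbedding (hm.trans hmn) (f ∘ g) where
  injective := hf.injective.comp hg.injective
  closed x k hk := by
    by_cases hkm : k.val < m
    · have h1 : g x ∈ Set.range g := ⟨x, rfl⟩
      rw [hg.range_eq] at h1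
      have h2 := hf.map_cyl ⟨k.val, hkm⟩ (g x)
      rw [h1 ⟨k.val, hkm⟩ hk] at h2
      exact h2.symm
    · exact hf.mem_neat _ k (by omega)
  map_sup x y := by simp only [Function.comp, hg.map_sup, hf.map_sup]
  map_compl x := by simp only [Function.comp, hg.map_compl, hf.map_compl]
  map_comp x y := by
    simp only [Function.comp, hg.map_comp, raComp, hf.map_cyl, hf.map_inf, hf.map_subst]
    rfl
  map_conv x := by
    simp only [Function.comp, hg.map_conv, raConv, hf.map_subst]
    rfl
  map_ident := by
    simp only [Function.comp, hg.map_ident, hf.map_diag]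
    rfl

namespace IsRaEmbedding

/-- The copy on the indices `k`, `l` of the image of `x`. -/
def atEdge (hn : 3 ≤ n) (g : C → D) (x : C) (k l : Fin n) : D :=
  edge (⟨0, by omega⟩ : Fin n) ⟨1, by omega⟩ k l (g x)

variable {hn : 3 ≤ n} {g : C → D}

theorem map_top (hg : IsRaEmbedding hn g) : g ⊤ = ⊤ := by
  have := hg.map_sup ⊤ ⊤ᶜ
  rwa [hg.map_compl, sup_compl_eq_top, sup_compl_eq_top] at this

theorem map_bot (hg : IsRaEmbedding hn g) : g ⊥ = ⊥ := by
  rw [← compl_top, hg.map_compl, hg.map_top, compl_top]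

theorem mono (hg : IsRaEmbedding hn g) {x y : C} (h : x ≤ y) : g x ≤ g y := by
  rw [← sup_eq_right.2 h, hg.map_sup]
  exact le_sup_left

theorem isSymEdge (hg : IsRaEmbedding hn g) (hs : IsSymmetric C) (x : C) :
    IsSymEdge (⟨0, by omega⟩ : Fin n) ⟨1, by omega⟩ ⟨2, by omega⟩ (g x) where
  closed k h0 h1 := hg.closed x k (by
    rw [Fin.ne_iff_vne] at h0 h1
    simp only at h0 h1
    omega)
  conv := by
    have := hg.map_conv x
    rw [hs] at this
    exact this.symm

theorem atEdge_triangle (hD : IsCylindricAlgebra n D) (hn8 : 8 ≤ n) (hg : IsRaEmbedding hn g)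
    (hs : IsSymmetric C) {x y z : C} (h : comp x y ≤ zᶜ) {k l m : Fin n} (hkl : k ≠ l)
    (hkm : k ≠ m) (hlm : l ≠ m) :
    atEdge hn g x k l ⊓ atEdge hn g y l m ⊓ atEdge hn g z k m = ⊥ := by
  refine edge_triangle_eq_bot hD hn8 (by simp) (by simp) (by simp) (hg.isSymEdge hs x)
    (hg.isSymEdge hs y) (hg.isSymEdge hs z) ?_ hkl hkm hlm
  have h1 := hg.mono h
  rw [hg.map_comp, hg.map_compl, raComp] at h1
  rw [edge, if_neg (by simp), IsCylindricAlgebra.subst_self, edge, if_neg (by simp),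
    IsCylindricAlgebra.subst_self, ← disjoint_iff]
  exact le_compl_iff_disjoint_right.1 ((hD.le_cyl _ _).trans h1)

theorem cyl_atEdge (hD : IsCylindricAlgebra n D) (hg : IsRaEmbedding hn g) (hs : IsSymmetric C)
    {x : C} (h : comp x ⊤ = ⊤) {l : Fin n} (hl : (⟨0, by omega⟩ : Fin n) ≠ l) :
    cyl l (atEdge hn g x ⟨0, by omega⟩ l) = ⊤ := by
  have h1 : cyl (⟨2, by omega⟩ : Fin n) (atEdge hn g x ⟨0, by omega⟩ ⟨2, by omega⟩) = ⊤ := by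
    have := hg.map_comp x ⊤
    rw [h, hg.map_top, raComp, hD.subst_top, inf_top_eq] at this
    rw [atEdge, edge, if_neg (by simp), IsCylindricAlgebra.subst_self, ← this]
  by_cases hl2 : l = ⟨2, by omega⟩
  · subst hl2; exact h1
  · have hx := hg.isSymEdge hs x
    have h2 := hx.subst_edge hD (by simp) (by simp) (by simp) hl
      (j := ⟨2, by omega⟩) (by simp) hl2
    rw [IsCylindricAlgebra.subst_of_ne hl2] at h2
    rw [atEdge] at h1 ⊢
    rw [← h2, hD.cyl_comm] at h1
    refine top_le_iff.1 (h1 ▸ hD.cyl_mono l ?_)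
    rw [hD.cyl_le_iff (hx.edge_closed hD (by simp) (Ne.symm hl2))]
    exact inf_le_right

end IsRaEmbedding

end RaEmbedding

theorem IsSymCyc.comp_top {X : Type u} {S : RelAtomStructure X} {e : X} (h : IsSymCyc S e)
    (hk : HasExt S e 1) {P : Cm S} (hP : P ≠ ⊥) : comp P ⊤ = ⊤ := by
  obtain ⟨x, hx⟩ := Cm.ne_bot_iff.1 hP
  refine Cm.ext fun w => ?_
  simp only [Cm.mem_top, iff_true, Cm.mem_comp, true_and]
  refine ⟨x, hx, ?_⟩
  by_cases hxe : x = e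
  · exact ⟨w, (hxe ▸ h.ident_cyc _ _).2 rfl⟩
  by_cases hwe : w = e
  · exact ⟨x, (hwe ▸ h.cyc_to_ident _ _).2 rfl⟩
  obtain ⟨y, hy⟩ := hk {(x, w)} (by simp) (by simp [hxe, hwe])
  exact ⟨y, h.rot (hy (x, w) (by simp))⟩

section NoEmbedding

variable {r : ℕ}

/-- The diversity atoms of `E23`, listed. -/
def DivAtom.ofFin (γ : Fin (r + 2)) : DivAtom r := DivAtom.of γ.succ (Fin.succ_ne_zero γ)

theorem DivAtom.exists_ofFin (x : DivAtom r) : ∃ γ, x = DivAtom.ofFin γ := by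
  obtain ⟨γ, hγ⟩ := Fin.exists_succ_eq.2 x.idx_ne_zero
  exact ⟨γ, DivAtom.idx_injective (by rw [DivAtom.ofFin, DivAtom.idx_of, hγ])⟩

/-- All the copies of a diversity atom. -/
def copies (hr : 4 ≤ r) (x : DivAtom r) : SplitAlg (blockSubalgebra hr) :=
  Cm.mk _ {s | ∃ i, s = some (x, i)}

theorem comp_copies (hr : 4 ≤ r) (x : DivAtom r) :
    comp (copies hr x) (copies hr x) ≤ (copies hr x)ᶜ := by
  rw [Cm.le_iff]
  rintro _ ⟨_, ⟨i, rfl⟩, _, ⟨j, rfl⟩, hc⟩ ⟨k, rfl⟩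
  rw [splitCyc_some] at hc
  exact hc.1 ⟨rfl, rfl⟩

theorem not_isRaEmbedding (hr : 4 ≤ r) {D : Type u} [BooleanAlgebra D] [CylSig (r + 4) D]
    (hD : IsCylindricAlgebra (r + 4) D) (hn : 3 ≤ r + 4)
    (g : SplitAlg (blockSubalgebra hr) → D) : ¬ IsRaEmbedding hn g := by
  intro hg
  classical
  have hS := isSymCyc_split hr
  have hs := hS.conv_id
  have hx := hg.isSymEdge hs
  have hext : HasExt (splitStructure (blockSubalgebra hr)) none 1 :=
    (hasExt_split hr).mono (by omega)
  have : Nontrivial D := by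
    refine ⟨g ⊥, g ⊤, fun h => ?_⟩
    have h1 := hg.injective h
    have h2 : (none : Split r) ∈ (⊥ : SplitAlg (blockSubalgebra hr)) := by
      rw [h1]; exact Cm.mem_top
    exact Cm.mem_bot h2
  have hc : IsColoring (⟨0, by omega⟩ : Fin (r + 4)) (0 : Fin (r + 2))
      (fun γ k l => IsRaEmbedding.atEdge hn g (copies hr (DivAtom.ofFin γ)) k l)
      (fun t k l => IsRaEmbedding.atEdge hn g
        (Cm.sing _ (some (DivAtom.ofFin 0, t)) : SplitAlg (blockSubalgebra hr)) k l) := by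
    refine ⟨fun γ i k l hik hil => (hx _).edge_closed hD hik hil,
      fun t i k l hik hil => (hx _).edge_closed hD hik hil,
      fun γ i j a hai haj hij =>
        (hx _).subst_edge hD (by simp) (by simp) (by simp) hai haj hij,
      fun t i j a hai haj hij =>
        (hx _).subst_edge hD (by simp) (by simp) (by simp) hai haj hij,
      fun γ k l m hkl hkm hlm =>
        IsRaEmbedding.atEdge_triangle hD (by omega) hg hs (comp_copies hr _) hkl hkm hlm,
      fun t t' k l hzk hzl hkl htt => ?_,
      fun t l hzl => IsRaEmbedding.cyl_atEdge hD hg hs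
        (hS.comp_top hext (Cm.isAtom_sing _).1) hzl,
      fun t k l hkl => edge_mono hD _ _ _ _ (hg.mono ?_)⟩
    · have h1 := IsRaEmbedding.atEdge_triangle hD (by omega) hg hs
        (x := (Cm.sing _ (some (DivAtom.ofFin 0, t)) : SplitAlg (blockSubalgebra hr)))
        (y := (Cm.sing _ (some (DivAtom.ofFin 0, t')) : SplitAlg (blockSubalgebra hr)))
        (z := ident) (by
          rw [Cm.le_iff]
          rintro _ ⟨_, rfl, _, rfl, h1⟩ rfl
          rw [hS.cyc_to_ident] at h1
          simp only [Option.some.injEq, Prod.mk.injEq, true_and] at h1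
          exact htt h1) hzk.symm hkl hzl
      have hsup : ∀ T : Finset (Fin (r + 2)),
          IsRaEmbedding.atEdge hn g (T.sup fun γ => copies hr (DivAtom.ofFin γ)) k l =
            T.sup fun γ => IsRaEmbedding.atEdge hn g (copies hr (DivAtom.ofFin γ)) k l := by
        intro T
        induction T using Finset.induction_on with
        | empty =>
          rw [Finset.sup_empty, Finset.sup_empty, IsRaEmbedding.atEdge, hg.map_bot, edge_bot hD]
        | insert γ T _ ih =>
          rw [Finset.sup_insert, Finset.sup_insert, ← ih]
          simp only [IsRaEmbedding.atEdge, hg.map_sup, edge_sup hD]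
      have htop : (ident ⊔ Finset.univ.sup fun γ => copies hr (DivAtom.ofFin γ) :
          SplitAlg (blockSubalgebra hr)) = ⊤ := by
        refine top_le_iff.1 fun w _ => ?_
        rcases w with _ | ⟨x, i⟩
        · exact .inl rfl
        · obtain ⟨γ, rfl⟩ := DivAtom.exists_ofFin x
          have hle : copies hr (DivAtom.ofFin γ) ≤
              Finset.univ.sup fun γ => copies hr (DivAtom.ofFin γ) :=
            Finset.le_sup (f := fun γ => copies hr (DivAtom.ofFin γ)) (Finset.mem_univ γ)
          exact .inr (Cm.le_iff.1 hle _ ⟨i, rfl⟩)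
      rw [← hsup]
      have h2 : IsRaEmbedding.atEdge hn g (ident : SplitAlg (blockSubalgebra hr)) k l ⊔
          IsRaEmbedding.atEdge hn g (Finset.univ.sup fun γ => copies hr (DivAtom.ofFin γ)) k l =
            ⊤ := by
        rw [IsRaEmbedding.atEdge, IsRaEmbedding.atEdge, ← edge_sup hD, ← hg.map_sup, htop,
          hg.map_top, edge_top hD]
      have h3 : IsRaEmbedding.atEdge hn g
          (Cm.sing _ (some (DivAtom.ofFin 0, t)) : SplitAlg (blockSubalgebra hr)) k
            (⟨0, by omega⟩ : Fin (r + 4)) = IsRaEmbedding.atEdge hn g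
          (Cm.sing _ (some (DivAtom.ofFin 0, t)) : SplitAlg (blockSubalgebra hr))
            (⟨0, by omega⟩ : Fin (r + 4)) k :=
        (hx _).edge_symm hD (by simp) (by simp) (by simp) hzk.symm
      rw [h3] at h1
      have h4 := le_compl_iff_disjoint_right.2 (disjoint_iff.2 h1)
      refine h4.trans ?_
      exact codisjoint_iff_compl_le_right.1 (codisjoint_iff.2 h2)
    · rw [Cm.sing_le]
      exact ⟨t, rfl⟩
  exact hc.card_add_two_ne hD rfl (by simp)

end NoEmbedding

/-! ## The subalgebra generated by the atoms -/

section Regular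

variable {r : ℕ} {hr : 4 ≤ r}

/-- On each block, membership in `P` does not depend on the atom once the index is at least `K`. -/
def IsRegular (K : ℕ) (P : SplitAlg (blockSubalgebra hr)) : Prop :=
  ∀ (x y : DivAtom r) (i j : ℕ), block x.idx = block y.idx → K ≤ i → K ≤ j →
    some (x, i) ∈ P → some (y, j) ∈ P

theorem IsRegular.mono {K L : ℕ} {P : SplitAlg (blockSubalgebra hr)} (h : IsRegular K P)
    (hKL : K ≤ L) : IsRegular L P :=
  fun x y i j hxy hi hj => h x y i j hxy (hKL.trans hi) (hKL.trans hj)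

theorem IsRegular.comp {K : ℕ} {P Q : SplitAlg (blockSubalgebra hr)} (hP : IsRegular K P)
    (hQ : IsRegular K Q) : IsRegular K (comp P Q) := by
  intro z z' k k' hz hk hk'
  have hS := isSymCyc_split hr
  rintro ⟨s, hs, t, ht, hc⟩
  rcases s with _ | ⟨(x : DivAtom r), i⟩
  · obtain rfl := (hS.ident_cyc _ _).1 hc
    exact ⟨none, hs, _, hQ z z' k k' hz hk hk' ht, (hS.ident_cyc _ _).2 rfl⟩
  rcases t with _ | ⟨(y : DivAtom r), j⟩
  · have := (hS.cyc_ident _ _).1 hc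
    rw [this] at hs
    exact ⟨_, hP z z' k k' hz hk hk' hs, none, ht, (hS.cyc_ident _ _).2 rfl⟩
  rw [splitCyc_some] at hc
  by_cases hb : block x.idx = block y.idx ∧ block y.idx = block z.idx
  · have hx : block x.idx = block z'.idx := hb.1.trans (hb.2.trans hz)
    have hy : block y.idx = block z'.idx := hb.2.trans hz
    have h3 : block z'.idx ≤ 3 := by
      by_cases hxy : x = y
      · rw [← hy]
        exact block_le_three hb.2 fun h => hc.1 ⟨hxy, h⟩
      · rw [← hx]
        exact block_le_three hb.1 hxy
    obtain ⟨v, hv, hvz⟩ := exists_divAtom_ne hr (one_le_block z') h3 z'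
    have low : ∀ {R : SplitAlg (blockSubalgebra hr)}, IsRegular K R → ∀ {x : DivAtom r} {i : ℕ},
        some (x, i) ∈ R → ∃ i' ≤ k', some (x, i') ∈ R := by
      intro R hR x i hx
      by_cases hi : i < K
      · exact ⟨i, by omega, hx⟩
      · exact ⟨k', le_rfl, hR x x i k' rfl (by omega) hk' hx⟩
    rcases hc.2 hb with ⟨h1, h2⟩ | ⟨h1, h2⟩ | ⟨h1, h2⟩
    · obtain ⟨i', hi', hm⟩ := low hP hs
      exact ⟨_, hm, _, hQ y v j k' (hy.trans hv.symm) (by omega) hk' ht, (splitCyc_some hr).2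
        ⟨fun h => hvz h.2, fun _ => .inl ⟨hi', rfl⟩⟩⟩
    · obtain ⟨j', hj', hm⟩ := low hQ ht
      exact ⟨_, hP x v i k' (hx.trans hv.symm) (by omega) hk' hs, _, hm, (splitCyc_some hr).2
        ⟨fun h => hvz (h.1.trans h.2), fun _ => .inr (.inl ⟨hj', rfl⟩)⟩⟩
    · exact ⟨_, hP x v i k' (hx.trans hv.symm) (by omega) hk' hs, _,
        hQ y v j k' (hy.trans hv.symm) (by omega) hk' ht, (splitCyc_some hr).2
          ⟨fun h => hvz h.2, fun _ => .inl ⟨le_rfl, rfl⟩⟩⟩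
  · have hb' : ¬ (block x.idx = block y.idx ∧ block y.idx = block z'.idx) :=
      fun h => hb ⟨h.1, h.2.trans hz.symm⟩
    exact ⟨_, hs, _, ht, (splitCyc_some hr).2 ⟨fun h => hb' ⟨by rw [h.1], by rw [h.2]⟩,
      fun h => (hb' h).elim⟩⟩

/-- The subalgebra of sets which are regular from `K` on. -/
def regularSubalgebra (hr : 4 ≤ r) (K : ℕ) : RelSubalgebra (SplitAlg (blockSubalgebra hr)) where
  carrier := {P | IsRegular K P}
  supClosed' P hP Q hQ x y i j h hi hj := Or.imp (hP x y i j h hi hj) (hQ x y i j h hi hj)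
  infClosed' P hP Q hQ x y i j h hi hj := And.imp (hP x y i j h hi hj) (hQ x y i j h hi hj)
  compl_mem' {P} hP x y i j h hi hj hx hy := hx (hP y x j i h.symm hj hi hy)
  bot_mem' _ _ _ _ _ _ _ h := h
  comp_mem' hP hQ := IsRegular.comp hP hQ
  conv_mem' {P} hP := by
    rw [(isSymCyc_split hr).conv_id P]
    exact hP
  ident_mem' _ _ _ _ _ _ _ h := by cases h

theorem finite_regularSubalgebra (hr : 4 ≤ r) (K : ℕ) :
    (regularSubalgebra hr K : Set (SplitAlg (blockSubalgebra hr))).Finite := by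
  have : Finite (DivAtom r) := Finite.of_injective _ DivAtom.idx_injective
  let F : Set (Split r) := insert none (some '' (Set.univ ×ˢ Set.Iic K))
  have hF : F.Finite := ((Set.finite_univ.prod (Set.finite_Iic K)).image _).insert _
  have hmem : ∀ (x : DivAtom r) (i : ℕ), i ≤ K → some (x, i) ∈ F := fun x i hi =>
    .inr ⟨(x, i), ⟨trivial, hi⟩, rfl⟩
  refine Set.Finite.of_injOn (f := fun P => ({s | s ∈ P ∧ s ∈ F} : Set (Split r)))
    (t := {s | s ⊆ F}) (fun P _ s hs => hs.2) ?_ hF.finite_subsets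
  intro P hP Q hQ hPQ
  have key : ∀ s ∈ F, (s ∈ P ↔ s ∈ Q) := fun s hs => by
    have h1 := Set.ext_iff.1 hPQ s
    exact ⟨fun h => (h1.1 ⟨h, hs⟩).1, fun h => (h1.2 ⟨h, hs⟩).1⟩
  have tail : ∀ {R : SplitAlg (blockSubalgebra hr)}, IsRegular K R → ∀ (x : DivAtom r) (i : ℕ),
      K ≤ i → (some (x, i) ∈ R ↔ some (x, K) ∈ R) := fun hR x i hi =>
    ⟨hR x x i K rfl hi le_rfl, hR x x K i rfl le_rfl hi⟩
  refine Cm.ext fun s => ?_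
  rcases s with _ | ⟨x, i⟩
  · exact key none (.inl rfl)
  · by_cases hi : i ≤ K
    · exact key _ (hmem x i hi)
    · rw [tail hP x i (by omega), tail hQ x i (by omega)]
      exact key _ (hmem x K le_rfl)

/-- The subalgebra of sets which are regular from some index on. -/
def eventuallyRegular (hr : 4 ≤ r) : RelSubalgebra (SplitAlg (blockSubalgebra hr)) where
  carrier := {P | ∃ K, IsRegular K P}
  supClosed' _ hP _ hQ := by
    obtain ⟨K, hP⟩ := hP
    obtain ⟨L, hQ⟩ := hQ
    exact ⟨max K L, (regularSubalgebra hr _).supClosed' (hP.mono (le_max_left K L))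
      (hQ.mono (le_max_right K L))⟩
  infClosed' _ hP _ hQ := by
    obtain ⟨K, hP⟩ := hP
    obtain ⟨L, hQ⟩ := hQ
    exact ⟨max K L, (regularSubalgebra hr _).infClosed' (hP.mono (le_max_left K L))
      (hQ.mono (le_max_right K L))⟩
  compl_mem' := fun ⟨K, hP⟩ => ⟨K, (regularSubalgebra hr K).compl_mem' hP⟩
  bot_mem' := ⟨0, (regularSubalgebra hr 0).bot_mem'⟩
  comp_mem' hP hQ := by
    obtain ⟨K, hP⟩ := hP
    obtain ⟨L, hQ⟩ := hQ
    exact ⟨max K L, IsRegular.comp (hP.mono (le_max_left K L)) (hQ.mono (le_max_right K L))⟩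
  conv_mem' := fun ⟨K, hP⟩ => ⟨K, (regularSubalgebra hr K).conv_mem' hP⟩
  ident_mem' := ⟨0, (regularSubalgebra hr 0).ident_mem'⟩

theorem exists_isRegular {P : SplitAlg (blockSubalgebra hr)}
    (hP : P ∈ atomSubalgebra (SplitAlg (blockSubalgebra hr))) : ∃ K, IsRegular K P := by
  refine RelSubalgebra.generate_le (T := eventuallyRegular hr) (fun a ha => ?_) hP
  obtain ⟨s, rfl⟩ := Cm.isAtom_iff.1 ha
  rcases s with _ | ⟨z, k⟩
  · exact ⟨0, fun x y i j _ _ _ h => by cases h⟩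
  · refine ⟨k + 1, fun x y i j _ hi _ h => ?_⟩
    cases h
    omega

theorem finGenSubalgebrasFinite_atomSubalgebra (hr : 4 ≤ r) :
    FinGenSubalgebrasFinite (atomSubalgebra (SplitAlg (blockSubalgebra hr))) := by
  intro s hs
  have hK : ∃ K, ∀ P ∈ s, IsRegular K P.1 := by
    induction s, hs using Set.Finite.induction_on with
    | empty => exact ⟨0, fun _ h => h.elim⟩
    | @insert P s _ _ ih =>
      obtain ⟨K, hK⟩ := ih
      obtain ⟨L, hL⟩ := exists_isRegular P.2
      refine ⟨max K L, ?_⟩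
      rintro Q (rfl | hQ)
      · exact hL.mono (le_max_right K L)
      · exact (hK Q hQ).mono (le_max_left K L)
  obtain ⟨K, hK⟩ := hK
  refine Set.Finite.of_injOn (f := Subtype.val) (t := regularSubalgebra hr K) (fun P hP => ?_)
    Subtype.val_injective.injOn (finite_regularSubalgebra hr K)
  exact RelSubalgebra.generate_le (T := RelSubalgebra.restrict _ (regularSubalgebra hr K)) hK hP

end Regular

/-! ## A representation of the subalgebra generated by the atoms -/

section Representation

variable {r : ℕ} {hr : 4 ≤ r}

/-- Labels with indices in `ℕ ∪ {∞}`. -/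
abbrev Label (r : ℕ) : Type := Option (DivAtom r × WithTop ℕ)

/-- The largest of the three indices is attained twice. -/
def TopThin (i j k : WithTop ℕ) : Prop := (i ≤ j ∧ j = k) ∨ (j ≤ k ∧ k = i) ∨ (k ≤ i ∧ i = j)

theorem TopThin.swap {i j k : WithTop ℕ} : TopThin i j k → TopThin j i k := by
  rintro (⟨h, rfl⟩ | ⟨h, rfl⟩ | ⟨h, rfl⟩)
  exacts [.inr (.inl ⟨h, rfl⟩), .inl ⟨h, rfl⟩, .inr (.inr ⟨h, rfl⟩)]

theorem TopThin.rot {i j k : WithTop ℕ} : TopThin i j k → TopThin i k j := by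
  rintro (⟨h, rfl⟩ | ⟨h, rfl⟩ | ⟨h, rfl⟩)
  exacts [.inl ⟨h, rfl⟩, .inr (.inr ⟨h, rfl⟩), .inr (.inl ⟨h, rfl⟩)]

theorem topThin_coe {i j k : ℕ} : TopThin i j k ↔ Thin i j k := by
  simp only [TopThin, Thin, Nat.cast_le, Nat.cast_inj]

/-- The triples of labels allowed in a representation. -/
def labelCyc : Label r → Label r → Label r → Prop
  | none, s, t => s = t
  | some s, none, t => some s = t
  | some s, some t, none => s = t
  | some (x, i), some (y, j), some (z, k) =>
      block x.idx = block y.idx ∧ block y.idx = block z.idx →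
        block x.idx ≤ 3 ∧ TopThin i j k ∧ (i ≠ ⊤ → j ≠ ⊤ → k ≠ ⊤ → ¬ (x = y ∧ y = z))

/-- The atom structure of labels. -/
def labelStructure (r : ℕ) : RelAtomStructure (Label r) where
  cyc := labelCyc
  conv s := s
  ident := {none}

theorem labelCyc_some {x y z : DivAtom r} {i j k : WithTop ℕ} :
    (labelStructure r).cyc (some (x, i)) (some (y, j)) (some (z, k)) ↔
      (block x.idx = block y.idx ∧ block y.idx = block z.idx →
        block x.idx ≤ 3 ∧ TopThin i j k ∧ (i ≠ ⊤ → j ≠ ⊤ → k ≠ ⊤ → ¬ (x = y ∧ y = z))) := Iff.rfl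

theorem isSymCyc_label (r : ℕ) : IsSymCyc (labelStructure r) none where
  conv_eq _ := rfl
  ident_eq := rfl
  ident_cyc _ _ := Iff.rfl
  swap {x y z} h := by
    rcases x with _ | ⟨x, i⟩ <;> rcases y with _ | ⟨y, j⟩ <;> rcases z with _ | ⟨z, k⟩
    any_goals first | exact h | exact Eq.symm h
    rw [labelCyc_some] at h ⊢
    rintro ⟨h1, h2⟩
    obtain ⟨g1, g2, g3⟩ := h ⟨h1.symm, h1.trans h2⟩
    exact ⟨h1 ▸ g1, g2.swap, fun a b c ⟨e1, e2⟩ => g3 b a c ⟨e1.symm, e1.trans e2⟩⟩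
  rot {x y z} h := by
    rcases x with _ | ⟨x, i⟩ <;> rcases y with _ | ⟨y, j⟩ <;> rcases z with _ | ⟨z, k⟩
    any_goals first | exact h | exact Eq.symm h | exact (Option.some_injective _ h) | exact congrArg some h
    rw [labelCyc_some] at h ⊢
    rintro ⟨h1, h2⟩
    obtain ⟨g1, g2, g3⟩ := h ⟨h1.trans h2, h2.symm⟩
    exact ⟨g1, g2.rot, fun a b c ⟨e1, e2⟩ => g3 a c b ⟨e1.trans e2, e2.symm⟩⟩

/-- The label of an atom of the split algebra. -/
def toLabel (s : Split r) : Label r := s.map fun p => (p.1, (p.2 : WithTop ℕ))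

theorem labelCyc_toLabel {s t u : Split r} :
    (labelStructure r).cyc (toLabel s) (toLabel t) (toLabel u) ↔
      (splitStructure (blockSubalgebra hr)).cyc s t u := by
  have inj : ∀ {x y : DivAtom r × ℕ}, (x.1, (x.2 : WithTop ℕ)) = (y.1, (y.2 : WithTop ℕ)) ↔ x = y := by
    intro x y
    rw [Prod.ext_iff, Prod.ext_iff]
    simp
  have hS := isSymCyc_split hr
  have hL := isSymCyc_label r
  have hinj : Function.Injective (toLabel (r := r)) := Option.map_injective fun x y h => inj.1 h
  rcases s with _ | ⟨x, i⟩
  · rw [hS.ident_cyc, ← hinj.eq_iff]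
    exact hL.ident_cyc _ _
  rcases t with _ | ⟨y, j⟩
  · rw [hS.cyc_ident, ← hinj.eq_iff]
    exact hL.cyc_ident _ _
  rcases u with _ | ⟨z, k⟩
  · rw [hS.cyc_to_ident, ← hinj.eq_iff]
    exact hL.cyc_to_ident _ _
  rw [splitCyc_some]
  simp only [toLabel, Option.map_some, labelCyc_some, ne_eq, WithTop.natCast_ne_top, not_false_eq_true,
    true_implies, topThin_coe]
  constructor
  · intro h
    refine ⟨fun he => ?_, fun hb => (h hb).2.1⟩
    exact (h ⟨by rw [he.1], by rw [he.2]⟩).2.2 he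
  · rintro ⟨h1, h2⟩ hb
    refine ⟨?_, h2 hb, h1⟩
    by_cases hxy : x = y
    · rw [hb.1]
      exact block_le_three hb.2 fun h => h1 ⟨hxy, h⟩
    · exact block_le_three hb.1 hxy

/-- The index `∞` replaced by `L`. -/
def trunc (L : ℕ) (l : Label r) : Split r := l.map fun p => (p.1, p.2.untopD L)

@[simp] theorem trunc_toLabel (L : ℕ) (s : Split r) : trunc L (toLabel s) = s := by
  rcases s with _ | ⟨x, i⟩ <;> rfl

/-- The label `l` belongs to the extension of `P`. -/
def Holds (P : SplitAlg (blockSubalgebra hr)) (l : Label r) : Prop :=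
  ∃ K, ∀ L, K ≤ L → trunc L l ∈ P

theorem trunc_mem_of_regular {K L M : ℕ} {P : SplitAlg (blockSubalgebra hr)} (hP : IsRegular K P)
    (hL : K ≤ L) (hM : K ≤ M) {l : Label r} (h : trunc L l ∈ P) : trunc M l ∈ P := by
  rcases l with _ | ⟨x, i⟩
  · exact h
  · induction i using WithTop.recTopCoe with
    | top => exact hP x x L M rfl hL hM h
    | coe i => exact h

theorem holds_iff {K L : ℕ} {P : SplitAlg (blockSubalgebra hr)} (hP : IsRegular K P)
    (hL : K ≤ L) {l : Label r} : Holds P l ↔ trunc L l ∈ P := by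
  constructor
  · rintro ⟨M, hM⟩
    exact trunc_mem_of_regular hP (le_max_left K M) hL (hM _ (le_max_right K M))
  · exact fun h => ⟨K, fun M hM => trunc_mem_of_regular hP hL hM h⟩

@[simp] theorem holds_toLabel {P : SplitAlg (blockSubalgebra hr)} {s : Split r} :
    Holds P (toLabel s) ↔ s ∈ P := by
  simp only [Holds, trunc_toLabel]
  exact ⟨fun ⟨K, h⟩ => h K le_rfl, fun h => ⟨0, fun _ _ => h⟩⟩

theorem Holds.comp {K : ℕ} {P Q : SplitAlg (blockSubalgebra hr)} (hP : IsRegular K P)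
    (hQ : IsRegular K Q) {a b c : Label r} (ha : Holds P a) (hb : Holds Q b)
    (hc : (labelStructure r).cyc a b c) : Holds (comp P Q) c := by
  have hS := isSymCyc_split hr
  have hL := isSymCyc_label r
  rcases a with _ | ⟨(x : DivAtom r), i⟩
  · obtain rfl := (hL.ident_cyc _ _).1 hc
    rw [holds_iff hP le_rfl] at ha
    rw [holds_iff hQ le_rfl] at hb
    rw [holds_iff (hP.comp hQ) le_rfl]
    exact ⟨none, ha, _, hb, (hS.ident_cyc _ _).2 rfl⟩
  rcases b with _ | ⟨(y : DivAtom r), j⟩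
  · have hac := (hL.cyc_ident _ _).1 hc
    rw [← hac]
    rw [holds_iff hP le_rfl] at ha
    rw [holds_iff hQ le_rfl] at hb
    rw [holds_iff (hP.comp hQ) le_rfl]
    exact ⟨_, ha, none, hb, (hS.cyc_ident _ _).2 rfl⟩
  rcases c with _ | ⟨(z : DivAtom r), k⟩
  · have hab := (hL.cyc_to_ident _ _).1 hc
    rw [← hab] at hb
    rw [holds_iff hP le_rfl] at ha
    rw [holds_iff hQ le_rfl] at hb
    rw [holds_iff (hP.comp hQ) le_rfl]
    exact ⟨_, ha, _, hb, (hS.cyc_to_ident _ _).2 rfl⟩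
  rw [labelCyc_some] at hc
  by_cases hbl : block x.idx = block y.idx ∧ block y.idx = block z.idx
  · obtain ⟨h3, hthin, hne⟩ := hc hbl
    let L := max K (max (i.untopD 0) (max (j.untopD 0) (k.untopD 0)))
    have hKL : K ≤ L := le_max_left _ _
    have bound : ∀ t : WithTop ℕ, t.untopD 0 ≤ L → t.untopD L ≤ L := by
      intro t
      induction t using WithTop.recTopCoe with
      | top => exact fun _ => le_rfl
      | coe t => exact fun h => h
    have hi : i.untopD L ≤ L := bound i (by simp only [L]; omega)
    have hj : j.untopD L ≤ L := bound j (by simp only [L]; omega)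
    have hk : k.untopD L ≤ L := bound k (by simp only [L]; omega)
    rw [holds_iff hP hKL] at ha
    rw [holds_iff hQ hKL] at hb
    rw [holds_iff (hP.comp hQ) hKL]
    have hz : block z.idx ≤ 3 := by rw [← hbl.2, ← hbl.1]; exact h3
    obtain ⟨v, hv, hvz⟩ := exists_divAtom_ne hr (one_le_block z) hz z
    have hxv : block x.idx = block v.idx := by rw [hv, hbl.1, hbl.2]
    have hyv : block y.idx = block v.idx := by rw [hv, hbl.2]
    have htop : ∀ {a b c : WithTop ℕ}, a ≤ b → b = c → b = ⊤ ∨ (a ≠ ⊤ ∧ b ≠ ⊤ ∧ c ≠ ⊤) := by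
      rintro a b _ hab rfl
      by_cases h : b = ⊤
      · exact .inl h
      · exact .inr ⟨fun ha => h (top_le_iff.1 (ha ▸ hab)), h, h⟩
    have fin : i ≠ ⊤ → j ≠ ⊤ → k ≠ ⊤ → trunc L (some (z, k)) ∈ RelSig.comp P Q := by
      intro gi gj gk
      lift i to ℕ using gi
      lift j to ℕ using gj
      lift k to ℕ using gk
      exact ⟨_, ha, _, hb, (splitCyc_some hr).2 ⟨hne (by simp) (by simp) (by simp),
        fun _ => topThin_coe.1 hthin⟩⟩
    rcases hthin with ⟨h1, h2⟩ | ⟨h1, h2⟩ | ⟨h1, h2⟩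
    · rcases htop h1 h2 with h | ⟨g1, g2, g3⟩
      · subst h2 h
        exact ⟨_, ha, _, hQ y v L L hyv hKL hKL hb, (splitCyc_some hr).2
          ⟨fun h => hvz h.2, fun _ => .inl ⟨hi, rfl⟩⟩⟩
      · exact fin g1 g2 g3
    · rcases htop h1 h2 with h | ⟨g1, g2, g3⟩
      · subst h2 h
        exact ⟨_, hP x v L L hxv hKL hKL ha, _, hb, (splitCyc_some hr).2
          ⟨fun h => hvz (h.1.trans h.2), fun _ => .inr (.inl ⟨hj, rfl⟩)⟩⟩
      · exact fin g3 g1 g2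
    · rcases htop h1 h2 with h | ⟨g1, g2, g3⟩
      · subst h2 h
        exact ⟨_, hP x v L L hxv hKL hKL ha, _, hQ y v L L hyv hKL hKL hb, (splitCyc_some hr).2
          ⟨fun h => hvz h.2, fun _ => .inr (.inr ⟨hk, rfl⟩)⟩⟩
      · exact fin g2 g3 g1
  · rw [holds_iff hP le_rfl] at ha
    rw [holds_iff hQ le_rfl] at hb
    rw [holds_iff (hP.comp hQ) le_rfl]
    exact ⟨_, ha, _, hb, (splitCyc_some hr).2
      ⟨fun h => hbl ⟨congrArg (fun t : DivAtom r => block t.idx) h.1,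
        congrArg (fun t : DivAtom r => block t.idx) h.2⟩, fun h => (hbl h).elim⟩⟩

theorem Holds.exists_of_comp {K : ℕ} {P Q : SplitAlg (blockSubalgebra hr)} (hP : IsRegular K P)
    (hQ : IsRegular K Q) {c : Label r} (hc : Holds (RelSig.comp P Q) c) :
    ∃ a b, Holds P a ∧ Holds Q b ∧ (labelStructure r).cyc a b c := by
  have hS := isSymCyc_split hr
  have hL := isSymCyc_label r
  by_cases hfin : ∃ s, c = toLabel s
  · obtain ⟨u, rfl⟩ := hfin
    obtain ⟨s, hs, t, ht, hcyc⟩ := holds_toLabel.1 hc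
    exact ⟨toLabel s, toLabel t, holds_toLabel.2 hs, holds_toLabel.2 ht,
      (labelCyc_toLabel (hr := hr)).2 hcyc⟩
  obtain ⟨z, rfl⟩ : ∃ z, c = some (z, ⊤) := by
    rcases c with _ | ⟨z, k⟩
    · exact (hfin ⟨none, rfl⟩).elim
    · induction k using WithTop.recTopCoe with
      | top => exact ⟨z, rfl⟩
      | coe k => exact (hfin ⟨some (z, k), rfl⟩).elim
  rw [holds_iff (hP.comp hQ) le_rfl] at hc
  obtain ⟨s, hs, t, ht, hcyc⟩ := hc
  rcases s with _ | ⟨(x : DivAtom r), i⟩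
  · obtain rfl := (hS.ident_cyc _ _).1 hcyc
    exact ⟨none, _, ⟨0, fun _ _ => hs⟩, (holds_iff hQ le_rfl).2 ht, (hL.ident_cyc _ _).2 rfl⟩
  rcases t with _ | ⟨(y : DivAtom r), j⟩
  · have := (hS.cyc_ident _ _).1 hcyc
    rw [this] at hs
    exact ⟨_, none, (holds_iff hP le_rfl).2 hs, ⟨0, fun _ _ => ht⟩, (hL.cyc_ident _ _).2 rfl⟩
  have hcyc' := (splitCyc_some hr).1 hcyc
  by_cases hbl : block x.idx = block y.idx ∧ block y.idx = block z.idx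
  · have h3 : block x.idx ≤ 3 := by
      by_cases hxy : x = y
      · rw [hbl.1]
        exact block_le_three hbl.2 fun h => hcyc'.1 ⟨hxy, h⟩
      · exact block_le_three hbl.1 hxy
    have hPx : K ≤ i → Holds P (some (x, ⊤)) := fun hi =>
      (holds_iff hP le_rfl).2 (hP x x i K rfl hi le_rfl hs)
    have hQy : K ≤ j → Holds Q (some (y, ⊤)) := fun hj =>
      (holds_iff hQ le_rfl).2 (hQ y y j K rfl hj le_rfl ht)
    have hPi : Holds P (some (x, (i : WithTop ℕ))) := holds_toLabel.2 hs
    have hQj : Holds Q (some (y, (j : WithTop ℕ))) := holds_toLabel.2 ht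
    rcases hcyc'.2 hbl with ⟨h1, h2⟩ | ⟨h1, h2⟩ | ⟨h1, h2⟩
    · have h2 : j = K := h2
      exact ⟨_, _, hPi, hQy h2.ge, labelCyc_some.2 fun _ =>
        ⟨h3, .inl ⟨le_top, rfl⟩, fun _ _ h => (h rfl).elim⟩⟩
    · have h2 : K = i := h2
      exact ⟨_, _, hPx h2.le, hQj, labelCyc_some.2 fun _ =>
        ⟨h3, .inr (.inl ⟨le_top, rfl⟩), fun _ _ h => (h rfl).elim⟩⟩
    · have h1 : K ≤ i := h1
      exact ⟨_, _, hPx h1, hQy (h2 ▸ h1), labelCyc_some.2 fun _ =>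
        ⟨h3, .inl ⟨le_top, rfl⟩, fun _ _ h => (h rfl).elim⟩⟩
  · exact ⟨toLabel (some (x, i)), toLabel (some (y, j)), holds_toLabel.2 hs, holds_toLabel.2 ht,
      labelCyc_some.2 fun h => (hbl h).elim⟩

end Representation

section Construction

variable {r : ℕ}

/-- Labels with index `∞` in one of the three large blocks. -/
def IsFlex (l : Label r) : Prop := ∃ x : DivAtom r, l = some (x, ⊤) ∧ block x.idx ≤ 3

theorem IsFlex.ne_none {l : Label r} (h : IsFlex l) : l ≠ none := by
  obtain ⟨x, rfl, -⟩ := h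
  exact Option.some_ne_none _

theorem IsFlex.cyc {a b c : Label r} (ha : IsFlex a) (hb : IsFlex b) (hc : c ≠ none) :
    (labelStructure r).cyc a b c := by
  obtain ⟨x, rfl, hx⟩ := ha
  obtain ⟨y, rfl, -⟩ := hb
  obtain ⟨⟨z, k⟩, rfl⟩ := Option.ne_none_iff_exists'.1 hc
  exact labelCyc_some.2 fun _ => ⟨hx, .inr (.inr ⟨le_top, rfl⟩), fun h => (h rfl).elim⟩

theorem exists_flex (hr : 4 ≤ r) {a b c d : Label r} (ha : a ≠ none) (hb : b ≠ none)
    (hc : c ≠ none) (hd : d ≠ none) : ∃ f, IsFlex f ∧ (labelStructure r).cyc f a c ∧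
      (labelStructure r).cyc f b d := by
  obtain ⟨⟨x, i⟩, rfl⟩ := Option.ne_none_iff_exists'.1 ha
  obtain ⟨⟨y, j⟩, rfl⟩ := Option.ne_none_iff_exists'.1 hb
  obtain ⟨⟨z, k⟩, rfl⟩ := Option.ne_none_iff_exists'.1 hc
  obtain ⟨⟨w, l⟩, rfl⟩ := Option.ne_none_iff_exists'.1 hd
  obtain ⟨m, h1, h3, hx, hy⟩ : ∃ m, 1 ≤ m ∧ m ≤ 3 ∧ m ≠ block (DivAtom.idx x) ∧
      m ≠ block (DivAtom.idx y) := by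
    by_cases g1 : 1 ≠ block (DivAtom.idx x) ∧ 1 ≠ block (DivAtom.idx y)
    · exact ⟨1, by omega, by omega, g1⟩
    by_cases g2 : 2 ≠ block (DivAtom.idx x) ∧ 2 ≠ block (DivAtom.idx y)
    · exact ⟨2, by omega, by omega, g2⟩
    · exact ⟨3, by omega, by omega, by omega, by omega⟩
  obtain ⟨v, hv⟩ := exists_divAtom (r := r) h1 (by omega)
  exact ⟨some (v, ⊤), ⟨v, rfl, hv.trans_le h3⟩, labelCyc_some.2 fun h => (hx (hv ▸ h.1)).elim,
    labelCyc_some.2 fun h => (hy (hv ▸ h.1)).elim⟩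

/-- A labelling in which different points have different labels to each other. -/
structure IsProperNet (N : ℕ → ℕ → Label r) : Prop where
  net : IsNet (labelStructure r) none N
  proper : ∀ i j, N i j = none → i = j

/-- A proper network can be relabelled at `s` so as to witness a given cycle. -/
theorem IsProperNet.exists_update (hr : 4 ≤ r) {N : ℕ → ℕ → Label r} (hN : IsProperNet N)
    {f₀ : Label r} (hf₀ : IsFlex f₀) {s p q : ℕ} (hps : p ≠ s) (hqs : q ≠ s) {a b : Label r}
    (ha : a ≠ none) (hb : b ≠ none) (hab : (labelStructure r).cyc a b (N p q)) :
    ∃ N', IsProperNet N' ∧ (∀ i j, i ≠ s → j ≠ s → N' i j = N i j) ∧ N' p s = a ∧ N' s q = b ∧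
      ∀ l, l ≠ s → l ≠ p → l ≠ q → N l p = f₀ → N l q = f₀ → N' l s = f₀ ∧ N' s l = f₀ := by
  classical
  have hL := isSymCyc_label r
  have hg : ∀ l, ∃ f, IsFlex f ∧ (l ≠ p → l ≠ q → (labelStructure r).cyc f a (N l p) ∧
      (labelStructure r).cyc f b (N l q)) ∧ (N l p = f₀ → N l q = f₀ → f = f₀) := by
    intro l
    by_cases h : N l p = f₀ ∧ N l q = f₀
    · refine ⟨f₀, hf₀, fun _ _ => ?_, fun _ _ => rfl⟩
      rw [h.1, h.2]
      exact ⟨hL.rot (hf₀.cyc hf₀ ha), hL.rot (hf₀.cyc hf₀ hb)⟩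
    · by_cases hl : l ≠ p ∧ l ≠ q
      · obtain ⟨f, h1, h2, h3⟩ := exists_flex hr ha hb (fun h' => hl.1 (hN.proper _ _ h'))
          (fun h' => hl.2 (hN.proper _ _ h'))
        exact ⟨f, h1, fun _ _ => ⟨h2, h3⟩, fun h1 h2 => (h ⟨h1, h2⟩).elim⟩
      · exact ⟨f₀, hf₀, fun h1 h2 => (hl ⟨h1, h2⟩).elim, fun _ _ => rfl⟩
  choose g hg1 hg2 hg3 using hg
  let row : ℕ → Label r := fun l => if l = p then a else if l = q then b else g l
  have rp : row p = a := if_pos rfl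
  have rq : row q = b := by
    by_cases h : q = p
    · subst h
      rw [hN.net.diag, hL.cyc_to_ident] at hab
      rw [rp, hab]
    · simp only [row, if_neg h, if_true]
  have rg : ∀ l, l ≠ p → l ≠ q → row l = g l := fun l h1 h2 => by
    simp only [row, if_neg h1, if_neg h2]
  have rn : ∀ l, row l ≠ none := by
    intro l
    by_cases h1 : l = p
    · rw [h1, rp]; exact ha
    by_cases h2 : l = q
    · rw [h2, rq]; exact hb
    · rw [rg l h1 h2]; exact (hg1 l).ne_none
  have key : ∀ l j, l ≠ j → (labelStructure r).cyc (row l) (N l j) (row j) := by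
    intro l j hlj
    have hne : N l j ≠ none := fun h => hlj (hN.proper _ _ h)
    by_cases hlp : l = p
    · subst hlp
      rw [rp]
      by_cases hjq : j = q
      · subst hjq
        rw [rq]
        exact hL.rot hab
      · rw [rg j hlj.symm hjq, hN.net.symm]
        exact hL.rot (hL.swap (hg2 j hlj.symm hjq).1)
    by_cases hlq : l = q
    · subst hlq
      rw [rq]
      by_cases hjp : j = p
      · subst hjp
        rw [rp, hN.net.symm]
        exact hL.rot (hL.swap hab)
      · rw [rg j hjp hlj.symm, hN.net.symm]
        exact hL.rot (hL.swap (hg2 j hjp hlj.symm).2)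
    rw [rg l hlp hlq]
    by_cases hjp : j = p
    · subst hjp
      rw [rp]
      exact hL.rot (hg2 l hlp hlq).1
    by_cases hjq : j = q
    · subst hjq
      rw [rq]
      exact hL.rot (hg2 l hlp hlq).2
    · rw [rg j hjp hjq]
      exact hL.rot ((hg1 l).cyc (hg1 j) hne)
  let N' : ℕ → ℕ → Label r := fun i j =>
    if i = j then none else if i = s then row j else if j = s then row i else N i j
  have h1 : ∀ i, N' i i = none := fun i => if_pos rfl
  have h2 : ∀ j, j ≠ s → N' s j = row j := fun j hj => by simp [N', hj.symm]
  have h3 : ∀ j, j ≠ s → N' j s = row j := fun j hj => by simp [N', hj]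
  have h4 : ∀ i j, i ≠ s → j ≠ s → N' i j = N i j := fun i j hi hj => by
    by_cases hij : i = j
    · rw [hij, h1, hN.net.diag]
    · simp [N', hi, hj, hij]
  have h5 : ∀ i j, N' i j = N' j i := fun i j => by
    by_cases hi : i = s
    · subst hi
      by_cases hj : j = i
      · rw [hj]
      · rw [h2 j hj, h3 j hj]
    · by_cases hj : j = s
      · subst hj
        rw [h2 i hi, h3 i hi]
      · rw [h4 i j hi hj, h4 j i hj hi, hN.net.symm]
  refine ⟨N', ⟨IsNet.of_distinct hL h1 h5 fun i l j hil hlj hij => ?_, fun i j hij => ?_⟩, h4,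
    by rw [h3 p hps, rp], by rw [h2 q hqs, rq], fun l hls hlp hlq e1 e2 => ?_⟩
  · by_cases hi : i = s
    · subst hi
      rw [h2 l hil.symm, h4 l j hil.symm hij.symm, h2 j hij.symm]
      exact key l j hlj
    by_cases hl : l = s
    · subst hl
      rw [h3 i hi, h2 j hlj.symm, h4 i j hi hlj.symm]
      exact hL.rot (key i j hij)
    by_cases hj : j = s
    · subst hj
      rw [h4 i l hi hl, h3 l hl, h3 i hi, hN.net.symm]
      exact hL.swap (key l i hil.symm)
    · rw [h4 i l hi hl, h4 l j hl hj, h4 i j hi hj]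
      exact hN.net.tri i l j
  · by_contra hne
    by_cases hi : i = s
    · subst hi
      rw [h2 j (Ne.symm hne)] at hij
      exact rn j hij
    by_cases hj : j = s
    · subst hj
      rw [h3 i hi] at hij
      exact rn i hij
    · rw [h4 i j hi hj] at hij
      exact hne (hN.proper _ _ hij)
  · rw [h3 l hls, h2 l hls, rg l hlp hlq, hg3 l e1 e2]
    exact ⟨rfl, rfl⟩

/-- A proper network in which the points from `n` on are related to all others by `f₀`. -/
structure IsStage (f₀ : Label r) (n : ℕ) (N : ℕ → ℕ → Label r) : Prop extends IsProperNet N where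
  generic : ∀ i j, i ≠ j → n ≤ max i j → N i j = f₀

theorem isStage_zero {f₀ : Label r} (hf₀ : IsFlex f₀) :
    IsStage f₀ 0 (fun i j => if i = j then none else f₀) where
  net := IsNet.of_distinct (isSymCyc_label r) (fun i => if_pos rfl)
    (fun i j => by simp only [eq_comm]) fun i l j hil hlj hij => by
      simp only [if_neg hil, if_neg hlj, if_neg hij]
      exact hf₀.cyc hf₀ hf₀.ne_none
  proper i j h := by
    by_contra hij
    rw [if_neg hij] at h
    exact hf₀.ne_none h
  generic i j hij _ := if_neg hij

/-- A triangle `a, b` to be erected on the edge `p, q`. -/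
abbrev Demand (r : ℕ) : Type := (ℕ × ℕ) × (Label r × Label r)

theorem IsStage.exists_succ (hr : 4 ≤ r) {f₀ : Label r} (hf₀ : IsFlex f₀) {n : ℕ}
    {N : ℕ → ℕ → Label r} (hN : IsStage f₀ n N) (d : Demand r) :
    ∃ N', IsStage f₀ (n + 1) N' ∧ (∀ i j, i ≠ n → j ≠ n → N' i j = N i j) ∧
      (d.1.1 < n → d.1.2 < n → d.2.1 ≠ none → d.2.2 ≠ none →
        (labelStructure r).cyc d.2.1 d.2.2 (N d.1.1 d.1.2) →
        N' d.1.1 n = d.2.1 ∧ N' n d.1.2 = d.2.2) := by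
  obtain ⟨⟨p, q⟩, a, b⟩ := d
  by_cases h : p < n ∧ q < n ∧ a ≠ none ∧ b ≠ none ∧ (labelStructure r).cyc a b (N p q)
  · obtain ⟨hp, hq, ha, hb, hab⟩ := h
    obtain ⟨N', g1, g2, g3, g4, g5⟩ :=
      hN.toIsProperNet.exists_update hr hf₀ hp.ne hq.ne ha hb hab
    refine ⟨N', ⟨g1, fun i j hij hn => ?_⟩, g2, fun _ _ _ _ _ => ⟨g3, g4⟩⟩
    have gen : ∀ l, n + 1 ≤ l → N' l n = f₀ ∧ N' n l = f₀ := fun l hl =>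
      g5 l (by omega) (by omega) (by omega) (hN.generic l p (by omega) (by omega))
        (hN.generic l q (by omega) (by omega))
    by_cases hi : i = n
    · subst hi
      exact (gen j (by omega)).2
    by_cases hj : j = n
    · subst hj
      exact (gen i (by omega)).1
    · rw [g2 i j hi hj]
      exact hN.generic i j hij (by omega)
  · exact ⟨N, ⟨hN.toIsProperNet, fun i j hij hn => hN.generic i j hij (by omega)⟩,
      fun _ _ _ _ => rfl, fun h1 h2 h3 h4 h5 => (h ⟨h1, h2, h3, h4, h5⟩).elim⟩

theorem exists_saturated_net (hr : 4 ≤ r) : ∃ N : ℕ → ℕ → Label r, IsProperNet N ∧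
    ∀ p q a b, (labelStructure r).cyc a b (N p q) → ∃ t, N p t = a ∧ N t q = b := by
  have hL := isSymCyc_label r
  have : Finite (DivAtom r) := Finite.of_injective _ DivAtom.idx_injective
  have : Countable (WithTop ℕ) := inferInstanceAs (Countable (Option ℕ))
  have : Nonempty (Demand r) := ⟨((0, 0), (none, none))⟩
  obtain ⟨d₀, hd₀⟩ := exists_surjective_nat (Demand r)
  obtain ⟨x₀, hx₀⟩ := exists_divAtom (r := r) (k := 1) le_rfl (by omega)
  have hf₀ : IsFlex (some (x₀, ⊤) : Label r) := ⟨x₀, rfl, by omega⟩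
  choose F hF1 hF2 hF3 using fun (n : ℕ) (N : {N : ℕ → ℕ → Label r // IsStage (some (x₀, ⊤)) n N}) =>
    N.2.exists_succ hr hf₀ (d₀ n.unpair.1)
  let G : (n : ℕ) → {N : ℕ → ℕ → Label r // IsStage (some (x₀, ⊤)) n N} := fun n =>
    Nat.rec ⟨_, isStage_zero hf₀⟩ (fun n N => ⟨F n N, hF1 n N⟩) n
  have hG : ∀ n, (G (n + 1)).1 = F n (G n) := fun n => rfl
  let N : ℕ → ℕ → Label r := fun i j => (G (max i j + 1)).1 i j
  have hstable : ∀ i j m, max i j < m → (G m).1 i j = N i j := by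
    intro i j m hm
    induction m, hm using Nat.le_induction with
    | base => rfl
    | succ m hm ih =>
      rw [hG, hF2 m (G m) i j (by omega) (by omega), ih]
  refine ⟨N, ⟨⟨fun i => (G _).2.net.diag i, fun i j => ?_, fun i l j => ?_⟩, fun i j h =>
    (G _).2.proper i j h⟩, fun p q a b hab => ?_⟩
  · rw [← hstable i j (i + j + 1) (by omega), ← hstable j i (i + j + 1) (by omega)]
    exact (G _).2.net.symm i j
  · rw [← hstable i l (i + l + j + 1) (by omega), ← hstable l j (i + l + j + 1) (by omega),
      ← hstable i j (i + l + j + 1) (by omega)]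
    exact (G _).2.net.tri i l j
  · have hdiag : ∀ i, N i i = none := fun i => (G _).2.net.diag i
    by_cases ha : a = none
    · subst ha
      exact ⟨p, hdiag p, ((hL.ident_cyc _ _).1 hab).symm⟩
    by_cases hb : b = none
    · subst hb
      exact ⟨q, ((hL.cyc_ident _ _).1 hab).symm, hdiag q⟩
    obtain ⟨k, hk⟩ := hd₀ ((p, q), (a, b))
    let n := Nat.pair k (max p q + 1)
    have hn : max p q + 1 ≤ n := Nat.right_le_pair k _
    have hdn : d₀ n.unpair.1 = ((p, q), (a, b)) := by rw [Nat.unpair_pair]; exact hk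
    have := hF3 n (G n)
    rw [hdn, ← hG] at this
    obtain ⟨h1, h2⟩ := this (show p < n by omega) (show q < n by omega) ha hb
      (by rw [hstable p q n (by omega)]; exact hab)
    refine ⟨n, ?_, ?_⟩
    · rw [← hstable p n (n + 1) (by omega)]; exact h1
    · rw [← hstable n q (n + 1) (by omega)]; exact h2

theorem isRepresentable_atomSubalgebra (hr : 4 ≤ r) :
    IsRepresentable (atomSubalgebra (SplitAlg (blockSubalgebra hr))) := by
  have hL := isSymCyc_label r
  have hS := isSymCyc_split hr
  obtain ⟨N, hN, hsat⟩ := exists_saturated_net hr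
  have top : ∀ p q, Holds (⊤ : SplitAlg (blockSubalgebra hr)) (N p q) := fun p q =>
    ⟨0, fun _ _ => Cm.mem_top⟩
  refine ⟨ℕ, fun P p q => Holds P.1 (N p q), ⟨fun P Q hPQ => Subtype.ext (Cm.ext fun s => ?_),
    fun P Q p q => ?_, fun P p q => ?_, fun P Q p q => ?_, fun P p q => ?_, fun p q => ?_⟩⟩
  · obtain ⟨t, ht, -⟩ := hsat 0 0 (toLabel s) (toLabel s)
      (by rw [hN.net.diag, hL.cyc_to_ident])
    have := congrFun (congrFun hPQ 0) t
    simp only [ht, holds_toLabel, eq_iff_iff] at this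
    exact this
  · obtain ⟨K, hK⟩ := exists_isRegular P.2
    obtain ⟨L, hL⟩ := exists_isRegular Q.2
    have hPQ : IsRegular (max K L) (P ⊔ Q).1 := (regularSubalgebra hr _).supClosed'
      (hK.mono (le_max_left K L)) (hL.mono (le_max_right K L))
    rw [holds_iff hPQ le_rfl, holds_iff hK (le_max_left K L), holds_iff hL (le_max_right K L)]
    rfl
  · obtain ⟨K, hK⟩ := exists_isRegular P.2
    have hP : IsRegular K (Pᶜ).1 := (regularSubalgebra hr _).compl_mem' hK
    rw [holds_iff hP le_rfl, holds_iff hK le_rfl]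
    exact ⟨fun h => ⟨top p q, h⟩, fun h => h.2⟩
  · obtain ⟨K, hK⟩ := exists_isRegular P.2
    obtain ⟨L, hL⟩ := exists_isRegular Q.2
    have hP := hK.mono (le_max_left K L)
    have hQ := hL.mono (le_max_right K L)
    constructor
    · intro h
      obtain ⟨a, b, ha, hb, hab⟩ := Holds.exists_of_comp hP hQ h
      obtain ⟨t, rfl, rfl⟩ := hsat p q a b hab
      exact ⟨t, ha, hb⟩
    · rintro ⟨t, ha, hb⟩
      exact Holds.comp hP hQ ha hb (hN.net.tri p t q)
  · rw [hN.net.symm p q, show (RelSig.conv P).1 = P.1 from hS.conv_id P.1]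
  · have hid : IsRegular 0 (ident : atomSubalgebra (SplitAlg (blockSubalgebra hr))).1 :=
      (regularSubalgebra hr 0).ident_mem'
    rw [holds_iff hid le_rfl]
    have h1 : trunc 0 (N p q) ∈ (ident : atomSubalgebra (SplitAlg (blockSubalgebra hr))).1 ↔
        trunc 0 (N p q) = none := hS.mem_ident
    rw [h1, trunc, Option.map_eq_none_iff]
    exact ⟨hN.proper p q, fun h => h ▸ hN.net.diag p⟩

end Construction

end RelCyl

theorem theorem3 (r : ℕ) (hr : 4 ≤ r) :
    ∃ E : RelSubalgebra (E23 (r + 3)),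
      -- the atoms of `E` are the `r` distinct elements `a₀, …, a_{r-1}`
      Set.BijOn (blockAtom (r + 3)) (Set.Iio r) {x | E.IsAtomOf x} ∧
      IsSpecialExtension E ∧
      (∃ a₁ a₂ a₃ : E, (a₁ : E23 (r + 3)) = blockAtom (r + 3) 1 ∧
        (a₂ : E23 (r + 3)) = blockAtom (r + 3) 2 ∧ (a₃ : E23 (r + 3)) = blockAtom (r + 3) 3 ∧
        IsFlexibleTrio a₁ a₂ a₃) ∧
      -- `C_E(A)` is a complete atomic relation algebra
      (IsRelationAlgebra (SplitAlg E) ∧ HasAllJoins (SplitAlg E) ∧ IsAtomic (SplitAlg E)) ∧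
      -- the atom-generated subalgebra of `C_E(A)`
      (IsRelationAlgebra (atomSubalgebra (SplitAlg E)) ∧
        IsAtomic (atomSubalgebra (SplitAlg E)) ∧
        IsAtomGenerated (atomSubalgebra (SplitAlg E)) ∧
        IsSymmetric (atomSubalgebra (SplitAlg E)) ∧
        IsIntegralRA (atomSubalgebra (SplitAlg E)) ∧
        IsRepresentable (atomSubalgebra (SplitAlg E)) ∧
        FinGenSubalgebrasFinite (atomSubalgebra (SplitAlg E))) ∧
      (∀ (n : ℕ) (hn : 3 ≤ n) (hnr : n ≤ r + 3),
        IsCylindricBasis hn (basicMatrices n (SplitAlg E)) ∧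
        (IsCylindricAlgebra n (Ca (basicMatrices n (SplitAlg E))) ∧
          HasAllJoins (Ca (basicMatrices n (SplitAlg E))) ∧
          IsAtomic (Ca (basicMatrices n (SplitAlg E)))) ∧
        ((∃ f : SplitAlg E → Ca (basicMatrices n (SplitAlg E)), IsIsoOntoRa hn f) ∧
          InRaCA.{0} hn (SplitAlg E)) ∧
        ¬ InSNrCA.{u} (show n ≤ r + 4 by omega) (Ca (basicMatrices n (SplitAlg E)))) ∧
      -- the exact position of `C_E(A)` for `A = E23 7`
      (r = 4 → InRaCA.{0} (show 3 ≤ 7 by omega) (SplitAlg E) ∧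
        ¬ InRaCA.{u} (show 3 ≤ 8 by omega) (SplitAlg E)) := by
  have hS := isSymCyc_split hr
  have hE := hasExt_split hr
  have hRA := hS.isRelationAlgebra (hE.mono (by omega))
  have hA : ∀ n, n ≤ r + 3 → HasAmalg (splitStructure (blockSubalgebra hr)) none (Fin n) :=
    fun n hn => hE.hasAmalg hS (by rw [Fintype.card_fin]; omega)
  have hRaCA : ∀ n (hn : 3 ≤ n), n ≤ r + 3 →
      InRaCA.{0} hn (SplitAlg (blockSubalgebra hr)) := fun n hn hnr =>
    inRaCA_of_hasAmalg hS hn (hA n hnr) (hA 3 (by omega))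
  refine ⟨blockSubalgebra hr, bijOn_blockAtom hr, isSpecialExtension_blockSubalgebra hr,
    ⟨_, _, _, rfl, rfl, rfl, isFlexibleTrio_blockAtom hr⟩,
    ⟨hRA, Cm.hasAllJoins, Cm.isAtomic⟩,
    ⟨hRA.sub _, isAtomic_atomSubalgebra Cm.isAtomic, isAtomGenerated_atomSubalgebra,
      hS.conv_id.sub _, (hS.isIntegral (hE.mono (by omega))).sub _,
      isRepresentable_atomSubalgebra hr, finGenSubalgebrasFinite_atomSubalgebra hr⟩,
    fun n hn hnr => ⟨isCylindricBasis_basicMatrices hS hn (hA n hnr),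
      ⟨isCylindricAlgebra_Ca hS (hA n hnr), Ca.hasAllJoins, Ca.isAtomic⟩,
      ⟨⟨_, isIsoOntoRa_raMap hS hn (hA n hnr)⟩, hRaCA n hn hnr⟩, ?_⟩, ?_⟩
  · rintro ⟨D, _, _, hD, f, hf⟩
    exact not_isRaEmbedding hr hD _ _ ((isIsoOntoRa_raMap hS hn (hA n hnr)).comp_neat hf)
  · rintro rfl
    refine ⟨hRaCA 7 (by omega) (by omega), ?_⟩
    rintro ⟨B, _, _, ⟨D, _, _, hD, f, hf⟩, g, hg⟩
    exact not_isRaEmbedding hr hD _ _ (hg.comp_neat hf)
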